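/- **Setting.** Let $g$ be a finite-dimensional simple complex Lie algebra with a Cartan subalgebra, simple roots $\alpha_1,\dots,\alpha_n$, highest root $\theta=\sum_{i=1}^n\eta_i\alpha_i$, $\alpha_0=-\theta$, $\eta_0=1$, height function $l$ and Coxeter number $h=l(\theta)+1$. Fix a positive multiple $\mathrm{tr}(xy)$ of the Killing form, a basis $H_1,\dots,H_n$ of the Cartan subalgebra with $\mathrm{tr}(H_aH_b)=\delta_{ab}$, and root vectors $E_\alpha$ with $\mathrm{tr}(E_\alpha E_{-\alpha})=2/\alpha^2$ such that $E_\alpha^t=E_{-\alpha}$, $H_a^t=H_a$ defines an anti-automorphism $t$ of $g$ (transposition; this is the choice $\sigma=t$). Identify a root $\alpha$ with the vector $(\alpha(H_a))_a$, put $\alpha\cdot\phi=\sum_a\alpha(H_a)\phi_a$, $\alpha^2=\alpha\cdot\alpha$, $v\cdot H=\sum_a v_aH_a$. Fields $\phi$ take values in $\mathbb C^n$, and $\lambda$ is a real spectral parameter. Put $$a_t(\lambda)=\tfrac12\partial_x\phi\cdot H+\sum_{i=0}^n\sqrt{\eta_i\alpha_i^2/8}\,\bigl(\lambda E_{\alpha_i}-\lambda^{-1}E_{-\alpha_i}\bigr)e^{\alpha_i\cdot\phi/2},$$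 $$a_x(\lambda)=\tfrac12\partial_t\phi\cdot H+\sum_{i=0}^n\sqrt{\eta_i\alpha_i^2/8}\,\bigl(\lambda E_{\alpha_i}+\lambda^{-1}E_{-\alpha_i}\bigr)e^{\alpha_i\cdot\phi/2},$$ $$r(\lambda)=\frac{\lambda^h+1}{\lambda^h-1}\sum_aH_a\otimes H_a-\frac{2}{1-\lambda^h}\sum_{\alpha>0}\frac{\alpha^2}{2}\lambda^{l(\alpha)}E_\alpha\otimes E_{-\alpha}+\frac{2}{1-\lambda^{-h}}\sum_{\alpha>0}\frac{\alpha^2}{2}\lambda^{-l(\alpha)}E_{-\alpha}\otimes E_\alpha .$$ Let $t_1$, $t_2$ denote $t$ acting on the first and second tensor factor. Fix a finite-dimensional matrix representation of $g$, in which all equations below are read. The Durham boundary condition with coefficients $A_0,\dots,A_n\in\mathbb C$ is $$\partial_x\phi=\sum_{i=0}^nA_i\sqrt{2\eta_i/\alpha_i^2}\;\alpha_i\,e^{\alpha_i\cdot\phi/2}\quad\text{at the boundary point.}\tag{cbc}$$ For matrix functions $K_\pm$ on a set $\Lambda\subseteq\mathbb R\setminus\{0\}$ consider, for all $\lambda\in\Lambda$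 and all boundary values $(\phi,\partial_x\phi)$ satisfying (cbc), $$K_+(\lambda)a_t(\lambda)+a_t^t(1/\lambda)K_+(\lambda)=0,\tag{ibc}$$ $$K_-(\lambda)a_t^t(\lambda)+a_t(1/\lambda)K_-(\lambda)=0,\tag{mbc}$$ and, with $\overset1K=K\otimes1$, $\overset2K=1\otimes K$, for all $\lambda_1,\lambda_2\in\Lambda$ with $(\lambda_1/\lambda_2)^h\ne1$ and $(\lambda_1\lambda_2)^h\neq1$ (so that the $r$-matrices are regular), $$0=\overset1K_+(\lambda_1)\overset2K_+(\lambda_2)\,r(\lambda_1/\lambda_2)+r^{t_1t_2}(\lambda_2/\lambda_1)\overset1K_+(\lambda_1)\overset2K_+(\lambda_2)+\overset1K_+(\lambda_1)r^{t_2}(\lambda_1\lambda_2)\overset2K_+(\lambda_2)+\overset2K_+(\lambda_2)r^{t_1}(1/(\lambda_1\lambda_2))\overset1K_+(\lambda_1),\tag{refl}$$ $$0=\overset1K_-(\lambda_1)\overset2K_-(\lambda_2)\,r^{t_1t_2}(\lambda_1/\lambda_2)+r(\lambda_2/\lambda_1)\overset1K_-(\lambda_1)\overset2K_-(\lambda_2)+\overset1K_-(\lambda_1)r^{t_1}(\lambda_1\lambda_2)\overset2K_-(\lambda_2)+\overset2K_-(\lambda_2)r^{t_2}(1/(\lambda_1\lambda_2))\overset1K_-(\lambda_1).\tag{mrefl}$$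 **Statement.** 1. $a_t^t(-1/\lambda)=a_t(\lambda)$ for $\lambda\ne0$, and $r^{t_1t_2}(\lambda)=-r(1/\lambda)$ for $\lambda\neq0$, $\lambda^h\ne1$. 2. Let $K_+$ be a matrix function on $\Lambda\subseteq\mathbb R\setminus\{0\}$ and $K_-(\lambda)=K_+(-1/\lambda)$, defined where $-1/\lambda\in\Lambda$. If $K_+$ solves (ibc) for a Durham boundary condition, then $K_-$ solves (mbc) for the same boundary condition. If $K_+$ solves (refl), then $K_-$ solves (mrefl). 3. If $\Lambda$ is open, $K_+$ is continuous on $\Lambda$ and $K_+$ solves (ibc) for a Durham boundary condition, then $K_+$ automatically solves (refl), and $K_-(\lambda)=K_+(-1/\lambda)$ solves (mrefl). 4. Affine Toda theory is integrable on every interval $[x_-,x_+]$, $x_-<x_+$, with possibly different Durham conditions at the two ends, in the following sense. Let $K_+$ on $\Lambda_+\subseteq\mathbb R\setminus\{0\}$ and $\tilde K_+$ on $\Lambda_-\subseteq\mathbb R\setminus\{0\}$ solve (ibc) for the Durham conditions with coefficients $A^+$ and $A^-$, let $K_-(\lambda)=\tilde K_+(-1/\lambda)$, let $T(\lambda)=P\exp\bigl(-\int_{x_-}^{x_+}a_x(\lambda,x)\,dx\bigr)$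 with points nearer to $x_+$ further to the left, let $T^t(\lambda)$ be the ordered exponential of $-a_x^t(\lambda)$ with the opposite order, and put $$\tau(\lambda)=\mathrm{tr}\bigl(K_+(\lambda)T(\lambda)K_-(1/\lambda)T^t(1/\lambda)\bigr)$$ for $\lambda$ in the common domain ($\lambda\in\Lambda_+$, $-\lambda\in\Lambda_-$), a functional of $\phi$ and $\pi=\partial_t\phi$ on $[x_-,x_+]$. Then $\frac{d}{dt}\tau(\lambda)=0$ along every $C^2$ solution of $\ddot\phi-\phi''+\sum_{i=0}^n\eta_i\alpha_ie^{\alpha_i\cdot\phi}=0$ on $[x_-,x_+]$, over any open set of times, which satisfies (cbc) with coefficients $A^-$ at $x_-$ and $A^+$ at $x_+$. If moreover $\Lambda_\pm$ are open and $K_+$, $\tilde K_+$ are continuous, then for all $\lambda_1,\lambda_2$ in the common domain the functionals $\tau(\lambda_1),\tau(\lambda_2)$ have continuous functional derivatives at all continuous $(\phi,\pi)$ and are in involution, $\{\tau(\lambda_1),\tau(\lambda_2)\}=0$, for the canonical bracket $\{F,G\}=\int_{x_-}^{x_+}\sum_a\Bigl(\frac{\delta F}{\delta\phi_a}\frac{\delta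 G}{\delta\pi_a}-\frac{\delta F}{\delta\pi_a}\frac{\delta G}{\delta\phi_a}\Bigr)dx$. -/

import Mathlib

open scoped TensorProduct Kronecker

noncomputable section

namespace AffineToda

open LieAlgebra LieAlgebra.IsKilling

section Algebra

variable {g : Type*} [LieRing g] [LieAlgebra ℂ g] [Module.Finite ℂ g] [LieAlgebra.IsSimple ℂ g]
variable {H : LieSubalgebra ℂ g} [H.IsCartanSubalgebra]

/-- The root `-α`. -/
def negRoot (α : H.root) : H.root := (rootSystem H).reflectionPerm α α

theorem root_negRoot (α : H.root) :
    (rootSystem H).root (negRoot α) = -(rootSystem H).root α := by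
  rw [negRoot, RootPairing.root_reflectionPerm, RootPairing.reflection_apply_self]

/-- The components `α_a = α(H_a)` of a root with respect to a basis `H_a` of the Cartan
subalgebra. -/
def rootVec {n : ℕ} (Hb : Fin n → H) (α : H.root) : Fin n → ℂ :=
  fun a => (rootSystem H).root α (Hb a)

/-- The squared length `α² = ∑ₐ α_a²` of a root; for an orthonormal basis `H_a` with respect to a
positive multiple of the Killing form this sum is a positive real number. -/
def rootSq {n : ℕ} (Hb : Fin n → H) (α : H.root) : ℝ :=
  (∑ a, rootVec Hb α a ^ 2).re

variable (g H) in
/-- The choices which enter the Lax pair of the affine Toda theory of the untwisted affine algebra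
`g⁽¹⁾`: simple roots, the highest root with its marks, an invariant form `scale • killingForm`, an
orthonormal basis of the Cartan subalgebra, normalised root vectors, and the transposition. -/
structure Generators (n : ℕ) where
  /-- the simple roots `α₁, …, αₙ` -/
  base : (rootSystem H).Base
  /-- the highest root `θ = -α₀` -/
  theta : H.root
  theta_highest : ∀ β : H.root, (rootSystem H).root theta - (rootSystem H).root β ∈
    AddSubmonoid.closure ((rootSystem H).root '' (base.support : Set H.root))
  /-- the marks `η₁, …, ηₙ` -/
  mark : base.support → ℕ
  theta_eq : (rootSystem H).root theta = ∑ i, mark i • (rootSystem H).root i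
  /-- the positive multiple of the Killing form which is used as invariant form `tr(xy)` -/
  scale : ℝ
  scale_pos : 0 < scale
  /-- the basis `H_a` of the Cartan subalgebra -/
  Hb : Module.Basis (Fin n) ℂ H
  Hb_orthonormal : ∀ a b, (scale : ℂ) * killingForm ℂ g (Hb a) (Hb b) = if a = b then 1 else 0
  /-- the root vectors `E_α` -/
  E : H.root → g
  E_mem : ∀ α : H.root, E α ∈ rootSpace H ((rootSystem H).root α)
  E_norm : ∀ α : H.root,
    (scale : ℂ) * killingForm ℂ g (E α) (E (negRoot α)) = 2 / (rootSq Hb α : ℂ)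
  /-- the transposition, an anti-automorphism of `g` -/
  tr : g →ₗ[ℂ] g
  tr_lie : ∀ x y : g, tr ⁅x, y⁆ = ⁅tr y, tr x⁆
  tr_cartan : ∀ x ∈ H, tr x = x
  tr_E : ∀ α : H.root, tr (E α) = E (negRoot α)

namespace Generators

variable {n : ℕ} (D : Generators g H n)

/-- The index set `{0, 1, …, n}` of the extended Dynkin diagram; `none` is the index `0`. -/
abbrev Idx : Type _ := Option D.base.support

/-- The extended simple roots `α₀ = -θ, α₁, …, αₙ`. -/
def aroot : D.Idx → H.root
  | none => negRoot D.theta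
  | some i => i

/-- The marks `η₀ = 1, η₁, …, ηₙ`. -/
def eta : D.Idx → ℕ
  | none => 1
  | some i => D.mark i

/-- `α_i · φ` -/
def adot (i : D.Idx) (φ : Fin n → ℂ) : ℂ := ∑ a, rootVec D.Hb (D.aroot i) a * φ a

/-- The Coxeter number. -/
def cox : ℤ := D.base.height D.theta + 1

/-- `√(η_i α_i² / 8)` -/
def coeff (i : D.Idx) : ℝ := Real.sqrt (D.eta i * rootSq D.Hb (D.aroot i) / 8)

/-- `v · H` -/
def cartan (v : Fin n → ℂ) : g := ∑ a, v a • (D.Hb a : g)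

/-- The time component `a_t(λ)` of the Lax connection, as a function of `φ` and `ψ = ∂ₓφ`. -/
def laxT (l : ℝ) (φ ψ : Fin n → ℂ) : g :=
  (1 / 2 : ℂ) • D.cartan ψ +
    ∑ i : D.Idx, ((D.coeff i : ℂ) * Complex.exp (D.adot i φ / 2)) •
      ((l : ℂ) • D.E (D.aroot i) - (l : ℂ)⁻¹ • D.E (negRoot (D.aroot i)))

/-- The space component `a_x(λ)` of the Lax connection, as a function of `φ` and `π = ∂ₜφ`. -/
def laxX (l : ℝ) (φ π : Fin n → ℂ) : g :=
  (1 / 2 : ℂ) • D.cartan π +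
    ∑ i : D.Idx, ((D.coeff i : ℂ) * Complex.exp (D.adot i φ / 2)) •
      ((l : ℂ) • D.E (D.aroot i) + (l : ℂ)⁻¹ • D.E (negRoot (D.aroot i)))

/-- The positive roots. -/
def posRoots : Finset H.root := Finset.univ.filter fun α => 0 < D.base.height α

/-- The classical `r`-matrix of affine Toda theory, regular where `λ ≠ 0` and `λ ^ h ≠ 1`. -/
def rMatrix (l : ℝ) : g ⊗[ℂ] g :=
  (((l : ℂ) ^ D.cox + 1) / ((l : ℂ) ^ D.cox - 1)) •
      ∑ a, (D.Hb a : g) ⊗ₜ[ℂ] (D.Hb a : g)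
    - (2 / (1 - (l : ℂ) ^ D.cox)) •
      ∑ α ∈ D.posRoots, ((rootSq D.Hb α : ℂ) / 2 * (l : ℂ) ^ D.base.height α) •
        (D.E α ⊗ₜ[ℂ] D.E (negRoot α))
    + (2 / (1 - (l : ℂ) ^ (-D.cox))) •
      ∑ α ∈ D.posRoots, ((rootSq D.Hb α : ℂ) / 2 * (l : ℂ) ^ (-D.base.height α)) •
        (D.E (negRoot α) ⊗ₜ[ℂ] D.E α)

/-- Transposition in the first factor. -/
def tr1 : g ⊗[ℂ] g →ₗ[ℂ] g ⊗[ℂ] g := TensorProduct.map D.tr LinearMap.id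

/-- Transposition in the second factor. -/
def tr2 : g ⊗[ℂ] g →ₗ[ℂ] g ⊗[ℂ] g := TensorProduct.map LinearMap.id D.tr

/-- Transposition in both factors. -/
def tr12 : g ⊗[ℂ] g →ₗ[ℂ] g ⊗[ℂ] g := TensorProduct.map D.tr D.tr

/-- The value of `∂ₓφ` which the Durham boundary condition with coefficients `A_i` prescribes at a
boundary point where the field has the value `φ`. -/
def durham (A : D.Idx → ℂ) (φ : Fin n → ℂ) : Fin n → ℂ := fun a =>
  ∑ i : D.Idx, A i * (Real.sqrt (2 * D.eta i / rootSq D.Hb (D.aroot i)) : ℂ) *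
    rootVec D.Hb (D.aroot i) a * Complex.exp (D.adot i φ / 2)

/-- `φ` is a `C²` solution of the affine Toda equations at times `t ∈ J` on `[x₋, x₊]`, which
satisfies the Durham boundary condition with coefficients `A₋` at `x₋` and `A₊` at `x₊`. -/
structure IsSolution (J : Set ℝ) (xm xp : ℝ) (Am Ap : D.Idx → ℂ) (φ : ℝ → ℝ → Fin n → ℂ) :
    Prop where
  smooth : ContDiffOn ℝ 2 (fun p : ℝ × ℝ => φ p.1 p.2) (J ×ˢ Set.univ)
  eom : ∀ t ∈ J, ∀ x ∈ Set.Icc xm xp, ∀ a,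
    iteratedDeriv 2 (fun s => φ s x a) t - iteratedDeriv 2 (fun y => φ t y a) x
      + ∑ i : D.Idx, D.eta i * rootVec D.Hb (D.aroot i) a * Complex.exp (D.adot i (φ t x)) = 0
  bc_left : ∀ t ∈ J, deriv (fun y => φ t y) xm = D.durham Am (φ t xm)
  bc_right : ∀ t ∈ J, deriv (fun y => φ t y) xp = D.durham Ap (φ t xp)

end Generators

end Algebra

/-! ### Path ordered exponentials and Poisson brackets -/

section Analysis

variable {m : Type*} [Fintype m] [DecidableEq m]

/-- The `k`-fold ordered integral `∫ a(y₁) ⋯ a(y_k)` over `x ≥ y₁ ≥ ⋯ ≥ y_k ≥ x₀`. -/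
def orderedIntegral (a : ℝ → Matrix m m ℂ) (x₀ : ℝ) : ℕ → ℝ → Matrix m m ℂ
  | 0 => fun _ => 1
  | k + 1 => fun x => Matrix.of fun i j => ∫ y in x₀..x, (a y * orderedIntegral a x₀ k y) i j

/-- The path ordered exponential of `a` from `x₀` to `x₁`, with points nearer to `x₁` further to
the left. -/
def pathExp (a : ℝ → Matrix m m ℂ) (x₀ x₁ : ℝ) : Matrix m m ℂ :=
  Matrix.of fun i j => ∑' k, orderedIntegral a x₀ k x₁ i j

/-- The path ordered exponential of `a` with the opposite order: points nearer to `x₁` are further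
to the right. -/
def antiPathExp (a : ℝ → Matrix m m ℂ) (x₀ x₁ : ℝ) : Matrix m m ℂ :=
  (pathExp (fun x => (a x).transpose) x₀ x₁).transpose

variable {n : ℕ}

/-- A functional of the field `φ` and the momentum `π = ∂ₜφ` on the interval `[x₋, x₊]`. -/
abbrev Functional (n : ℕ) : Type := (ℝ → Fin n → ℂ) → (ℝ → Fin n → ℂ) → ℂ

/-- At `(φ, π)` the functional `F` has the (continuous) functional derivatives `u = δF/δφ` and
`v = δF/δπ` on `[x₋, x₊]`. -/
def HasFunctionalDeriv (xm xp : ℝ) (F : Functional n) (φ π u v : ℝ → Fin n → ℂ) : Prop :=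
  ContinuousOn u (Set.Icc xm xp) ∧ ContinuousOn v (Set.Icc xm xp) ∧
  ∀ dφ dπ : ℝ → Fin n → ℂ, Continuous dφ → Continuous dπ →
    HasDerivAt (fun ε : ℂ => F (φ + ε • dφ) (π + ε • dπ))
      (∫ x in xm..xp, ∑ a, (u x a * dφ x a + v x a * dπ x a)) 0

/-- At `(φ, π)` the functionals `F`, `G` are differentiable and their canonical Poisson bracket
`{F, G} = ∫ ∑ₐ (δF/δφ_a δG/δπ_a - δF/δπ_a δG/δφ_a) dx` vanishes. -/
def PoissonCommuteAt (xm xp : ℝ) (F G : Functional n) (φ π : ℝ → Fin n → ℂ) : Prop :=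
  ∃ u v u' v' : ℝ → Fin n → ℂ,
    HasFunctionalDeriv xm xp F φ π u v ∧ HasFunctionalDeriv xm xp G φ π u' v' ∧
    ∫ x in xm..xp, ∑ a, (u x a * v' x a - v x a * u' x a) = 0

end Analysis

section Sklyanin

attribute [local instance 100] LieRing.ofAssociativeRing

/-- A matrix representation of `g`. -/
abbrev MatrixRep (g : Type*) [LieRing g] [LieAlgebra ℂ g] (m : Type*) [Fintype m] [DecidableEq m] :
    Type _ := g →ₗ⁅ℂ⁆ Matrix m m ℂ

variable {g : Type*} [LieRing g] [LieAlgebra ℂ g] [Module.Finite ℂ g] [LieAlgebra.IsSimple ℂ g]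
variable {H : LieSubalgebra ℂ g} [H.IsCartanSubalgebra]
variable {n : ℕ} (D : Generators g H n)
variable {m : Type*} [Fintype m] [DecidableEq m] (ρ : MatrixRep g m)

/-- The matrix `(ρ ⊗ ρ)(x)` of an element `x` of `g ⊗ g`. -/
def rep2 : g ⊗[ℂ] g →ₗ[ℂ] Matrix (m × m) (m × m) ℂ :=
  TensorProduct.lift ((Matrix.kroneckerBilinear (R := ℂ) (α := ℂ) (l := m) (m := m) (n := m) (p := m)).compl₁₂ (ρ : g →ₗ[ℂ] Matrix m m ℂ)
    (ρ : g →ₗ[ℂ] Matrix m m ℂ))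

/-- `K ⊗ 1` -/
def leg1 (K : Matrix m m ℂ) : Matrix (m × m) (m × m) ℂ := K ⊗ₖ (1 : Matrix m m ℂ)

/-- `1 ⊗ K` -/
def leg2 (K : Matrix m m ℂ) : Matrix (m × m) (m × m) ℂ := (1 : Matrix m m ℂ) ⊗ₖ K

/-- `K_+(λ) a_t(λ) + a_t^t(1/λ) K_+(λ) = 0` for all `λ ∈ Λ` and all boundary values of the fields
allowed by the Durham boundary condition with coefficients `A`. -/
def SolvesIbc (A : D.Idx → ℂ) (Λ : Set ℝ) (K : ℝ → Matrix m m ℂ) : Prop :=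
  ∀ l ∈ Λ, ∀ φ : Fin n → ℂ,
    K l * ρ (D.laxT l φ (D.durham A φ)) + ρ (D.tr (D.laxT l⁻¹ φ (D.durham A φ))) * K l = 0

/-- `K_-(λ) a_t^t(λ) + a_t(1/λ) K_-(λ) = 0` for all `λ ∈ Λ` and all boundary values of the fields
allowed by the Durham boundary condition with coefficients `A`. -/
def SolvesMbc (A : D.Idx → ℂ) (Λ : Set ℝ) (K : ℝ → Matrix m m ℂ) : Prop :=
  ∀ l ∈ Λ, ∀ φ : Fin n → ℂ,
    K l * ρ (D.tr (D.laxT l φ (D.durham A φ))) + ρ (D.laxT l⁻¹ φ (D.durham A φ)) * K l = 0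

/-- The reflection equation for `K_+`, at all spectral parameters in `Λ` at which the `r`-matrices
that occur in it are regular. -/
def SolvesRefl (Λ : Set ℝ) (K : ℝ → Matrix m m ℂ) : Prop :=
  ∀ l₁ ∈ Λ, ∀ l₂ ∈ Λ, (l₁ / l₂) ^ D.cox ≠ 1 → (l₁ * l₂) ^ D.cox ≠ 1 →
    leg1 (K l₁) * leg2 (K l₂) * rep2 ρ (D.rMatrix (l₁ / l₂))
      + rep2 ρ (D.tr12 (D.rMatrix (l₂ / l₁))) * leg1 (K l₁) * leg2 (K l₂)
      + leg1 (K l₁) * rep2 ρ (D.tr2 (D.rMatrix (l₁ * l₂))) * leg2 (K l₂)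
      + leg2 (K l₂) * rep2 ρ (D.tr1 (D.rMatrix (l₁ * l₂)⁻¹)) * leg1 (K l₁) = 0

/-- The reflection equation for `K_-`, at all spectral parameters in `Λ` at which the `r`-matrices
that occur in it are regular. -/
def SolvesMrefl (Λ : Set ℝ) (K : ℝ → Matrix m m ℂ) : Prop :=
  ∀ l₁ ∈ Λ, ∀ l₂ ∈ Λ, (l₁ / l₂) ^ D.cox ≠ 1 → (l₁ * l₂) ^ D.cox ≠ 1 →
    leg1 (K l₁) * leg2 (K l₂) * rep2 ρ (D.tr12 (D.rMatrix (l₁ / l₂)))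
      + rep2 ρ (D.rMatrix (l₂ / l₁)) * leg1 (K l₁) * leg2 (K l₂)
      + leg1 (K l₁) * rep2 ρ (D.tr1 (D.rMatrix (l₁ * l₂))) * leg2 (K l₂)
      + leg2 (K l₂) * rep2 ρ (D.tr2 (D.rMatrix (l₁ * l₂)⁻¹)) * leg1 (K l₁) = 0

/-- `K_-(λ) = K_+(-1/λ)` -/
def minusK (K : ℝ → Matrix m m ℂ) : ℝ → Matrix m m ℂ := fun l => K (-l⁻¹)

/-- The domain of `λ ↦ K_+(-1/λ)`, where `Λ` is the domain of `K_+`. -/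
def minusDomain (Λ : Set ℝ) : Set ℝ := {l | -l⁻¹ ∈ Λ}

/-- The transfer matrix `T(λ) = P exp(-∫ a_x(λ, x) dx)` from `x₋` to `x₊`. -/
def transfer (xm xp l : ℝ) (φ π : ℝ → Fin n → ℂ) : Matrix m m ℂ :=
  pathExp (fun x => -ρ (D.laxX l (φ x) (π x))) xm xp

/-- The transposed transfer matrix `T^t(λ)`: the ordered exponential of `-a_x^t(λ, x)` with the
order of the factors reversed. -/
def transferTr (xm xp l : ℝ) (φ π : ℝ → Fin n → ℂ) : Matrix m m ℂ :=
  antiPathExp (fun x => -ρ (D.tr (D.laxX l (φ x) (π x)))) xm xp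

/-- `τ(λ) = tr (K_+(λ) T(λ) K_-(1/λ) T^t(1/λ))` -/
def tau (xm xp : ℝ) (Kp Km : ℝ → Matrix m m ℂ) (l : ℝ) : Functional n := fun φ π =>
  (Kp l * transfer D ρ xm xp l φ π * Km l⁻¹ * transferTr D ρ xm xp l⁻¹ φ π).trace

end Sklyanin

end AffineToda

end

/-!
# Integrability of affine Toda theory with Durham boundary conditions

Everything rests on one identity for the `r`-matrix, `act_E_rMatrix`. Let a pair `(y, z)` act on
`g ⊗ g` by `ad y ⊗ 1 + 1 ⊗ ad z`. The invariant form turns `r(λ)` into an operator on `g` which is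
a scalar `c(k)` on the root vectors of height `k`, with `λ c(k) = c(k + 1)` as long as neither
height vanishes, and likewise, by periodicity, when `α₀` lowers the height by `h - 1`. The
variation of `r(λ₁ / λ₂)` under `(λ₁ E_{α_j}, λ₂ E_{α_j})` therefore only sees the height zero
part, and equals `H_{α_j} ⊗ λ₂ E_{α_j} - λ₁ E_{α_j} ⊗ H_{α_j}`, where `H_α = α · H`. Transposition
gives the same for the negative root vectors, and the Cartan subalgebra leaves `r` invariant.

*Boundary equation and reflection equation.* Under the Durham condition `a_t(λ)` is a combination
of the boundary generators `B_j(λ) = λ E_{α_j} - λ⁻¹ E_{-α_j} + a_j α_j · H` with coefficients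
proportional to `e^{α_j · φ / 2}` (`laxT_durham`). These exponentials are linearly independent
characters, so the boundary equation splits into one intertwining relation between `K(λ)` and
`B_j(λ)` for each node of the extended Dynkin diagram (`SolvesIbc.intertwines`). The variation of
`r` under `(B_j(λ₁), B_j(λ₂))` is `H_{α_j} ⊗ B_j(λ₂) - B_j(λ₁) ⊗ H_{α_j}` (`act_bvec_rMatrix`).
For generic `λ₁`, `λ₂` the pairs `(B_j(λ₁), B_j(λ₂))` generate `g × g` (`exists_regular`): for large
spectral parameters they degenerate to the pairs `(ν E_{α_j}, E_{α_j})`, the `E_{α_j}` generate `g`,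
and generation is a Zariski open condition. At such parameters a matrix `K` with the intertwining
property implements an endomorphism of `g`, unless it annihilates the representation
(`exists_twist_of_intertwines`). Moving `K(λ₁) ⊗ K(λ₂)` to the right, the reflection equation
becomes the vanishing of an element of `g ⊗ g` which the coideal property shows to be invariant
under all the pairs, hence under `g × g`; such an element is zero, since `g` has trivial centre
(`reflExpr_eq_zero_of_pairGen`). Continuity of `K` extends the equation to all regular parameters
(`SolvesIbc.solvesRefl`), and the substitution `λ ↦ -1/λ` yields the equations for `K₋`.

*Conservation.* By the zero curvature condition (`zero_curvature`) the time derivative of the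
transfer matrix is a boundary term (`hasDerivAt_transfer_of_isSolution`). In the derivative of
`τ(λ)` the terms at `x₊` and at `x₋` cancel by the boundary equations for `K₊` and `K₋`.

*Involution.* The functional derivatives of `τ(λ)` contract `g`-valued derivatives of the Lax
connection with the functionals `y ↦ tr (ρ(y) P M P⁻¹)`, where `P` is the transfer matrix up to the
point in question (`hasFunctionalDeriv_tau`). These functionals are transported along the interval
by the adjoint action of the Lax connection, so by the `r`-matrix identity the integrand of the
bracket is, up to the factor `-1/4`, the derivative of a sum of four contractions with `r`-matrices,
one for each pair of factors `T` or `Tᵗ` (`sum_grad_eq`, `hasDerivAt_fourPair`). At `x₊` and at `x₋`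
this sum is a trace of the reflection equation for `K₊` and for `K₋` and vanishes
(`SolvesRefl.fourPair_eq_zero`, `SolvesMrefl.fourPair_eq_zero`). Spectral parameters at which an
`r`-matrix is singular are limits of regular ones, and the bracket is continuous in the spectral
parameters (`poissonCommuteAt_tau`).
-/

noncomputable section

namespace AffineToda

open LieAlgebra LieAlgebra.IsKilling

/-! ### Root vectors and the invariant form -/

section RootData

variable {g : Type*} [LieRing g] [LieAlgebra ℂ g] [Module.Finite ℂ g] [LieAlgebra.IsSimple ℂ g]
variable {H : LieSubalgebra ℂ g} [H.IsCartanSubalgebra]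

theorem negRoot_negRoot (α : H.root) : negRoot (negRoot α) = α := by
  apply (rootSystem H).root.injective
  rw [root_negRoot, root_negRoot, neg_neg]

theorem coe_negRoot (α : H.root) : ((negRoot α).1 : H → ℂ) = -(α.1 : H → ℂ) := by
  funext h
  have := LinearMap.congr_fun (root_negRoot α) h
  simpa using this

theorem root_ne_zero (α : H.root) : (rootSystem H).root α ≠ 0 := (rootSystem H).ne_zero α

namespace Generators

variable {n : ℕ} (D : Generators g H n)

theorem tr_tr_E (α : H.root) : D.tr (D.tr (D.E α)) = D.E α := by
  rw [D.tr_E, D.tr_E, negRoot_negRoot]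

/-- The invariant form `tr(xy)` of the Lie algebra. -/
def form : LinearMap.BilinForm ℂ g := (D.scale : ℂ) • killingForm ℂ g

theorem form_apply (x y : g) : D.form x y = (D.scale : ℂ) * killingForm ℂ g x y := rfl

theorem scale_ne_zero : (D.scale : ℂ) ≠ 0 := by exact_mod_cast D.scale_pos.ne'

theorem form_lie (x y z : g) : D.form ⁅x, y⁆ z = D.form x ⁅y, z⁆ := by
  rw [form_apply, form_apply, LieModule.traceForm_apply_lie_apply]

theorem form_lie_left (x y z : g) : D.form ⁅x, y⁆ z = -D.form y ⁅x, z⁆ := by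
  rw [← lie_skew, map_neg, LinearMap.neg_apply, form_lie]

theorem form_comm (x y : g) : D.form x y = D.form y x := by
  rw [form_apply, form_apply, LieModule.traceForm_comm]

theorem eq_zero_of_form_eq_zero {x : g} (h : ∀ y, D.form x y = 0) : x = 0 := by
  have hx : x ∈ LinearMap.ker (killingForm ℂ g) := by
    rw [LinearMap.mem_ker]
    ext y
    exact (mul_eq_zero.mp (h y)).resolve_left D.scale_ne_zero
  rw [LieAlgebra.IsKilling.ker_killingForm_eq_bot] at hx
  exact (Submodule.mem_bot ℂ).mp hx

theorem lie_E (h : H) (α : H.root) :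
    ⁅(h : g), D.E α⁆ = (rootSystem H).root α h • D.E α :=
  lie_eq_smul_of_mem_rootSpace (D.E_mem α) h

theorem lie_E_cartan (h : H) (α : H.root) :
    ⁅D.E α, (h : g)⁆ = -((rootSystem H).root α h • D.E α) := by
  rw [← lie_skew, lie_E]

theorem lie_cartan (x y : H) : ⁅(x : g), (y : g)⁆ = 0 := by
  rw [← LieSubalgebra.coe_bracket, trivial_lie_zero, ZeroMemClass.coe_zero]

/-- The element `α · H` of the Cartan subalgebra. -/
def rootH (α : H.root) : H := ∑ a, rootVec D.Hb α a • D.Hb a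

theorem cartan_rootVec (α : H.root) : D.cartan (rootVec D.Hb α) = (D.rootH α : g) := by
  simp [cartan, rootH]

theorem form_Hb (a b : Fin n) : D.form (D.Hb a) (D.Hb b) = if a = b then 1 else 0 :=
  D.Hb_orthonormal a b

theorem form_rootH (α : H.root) (h : H) :
    D.form (D.rootH α) h = (rootSystem H).root α h := by
  have key : ∀ a, D.form (D.rootH α) (D.Hb a) = (rootSystem H).root α (D.Hb a) := fun a => by
    simp [← cartan_rootVec, cartan, D.form_Hb, rootVec]
  have : D.form (D.rootH α) ∘ₗ H.toSubmodule.subtype = (rootSystem H).root α :=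
    D.Hb.ext key
  exact LinearMap.congr_fun this h

theorem rootH_eq (α : H.root) :
    (D.scale : ℂ) • D.rootH α = (cartanEquivDual H).symm α.1.toLinear := by
  rw [LinearEquiv.eq_symm_apply]
  ext h
  rw [cartanEquivDual_apply_apply]
  have := D.form_rootH α h
  rw [form_apply, ← smul_eq_mul, ← LinearMap.smul_apply, ← map_smul] at this
  exact this

theorem sum_rootVec_sq (α : H.root) :
    ∑ a, rootVec D.Hb α a ^ 2 = (rootSystem H).root α (D.rootH α) := by
  simp [rootH, rootVec, pow_two]

theorem root_rootH_ne_zero (α : H.root) : (rootSystem H).root α (D.rootH α) ≠ 0 := by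
  have h := root_apply_cartanEquivDual_symm_ne_zero (LieSubalgebra.isNonZero_coe_root α)
  rw [← D.rootH_eq] at h
  intro h0
  apply h
  change (rootSystem H).root α ((D.scale : ℂ) • D.rootH α) = 0
  rw [map_smul, h0, smul_zero]

theorem coroot_eq (α : H.root) :
    coroot α.1 = (2 / (rootSystem H).root α (D.rootH α)) • D.rootH α := by
  rw [coroot, ← D.rootH_eq]
  have : α.1 ((D.scale : ℂ) • D.rootH α) = D.scale * (rootSystem H).root α (D.rootH α) := by
    rw [← smul_eq_mul, ← map_smul]; rfl
  rw [this, smul_smul, ← Nat.cast_smul_eq_nsmul ℂ, smul_smul]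
  congr 1
  have := D.scale_ne_zero
  have := D.root_rootH_ne_zero α
  field_simp
  simp

/-- The Killing form takes on coroots the value `∑ β(α^∨)²`, a sum of squares of integers; hence
the squared length of a root is a positive real number. -/
theorem exists_root_rootH_eq (α : H.root) :
    ∃ q : ℝ, 0 < q ∧ (rootSystem H).root α (D.rootH α) = q := by
  set q := (rootSystem H).root α (D.rootH α) with hq
  have hq0 := D.root_rootH_ne_zero α
  have h1 : killingForm ℂ g (coroot α.1) (coroot α.1) = 4 / (D.scale * q) := by
    have h2 : D.form (coroot α.1) (coroot α.1) = 4 / q := by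
      rw [D.coroot_eq α]
      simp only [SetLike.val_smul, map_smul, LinearMap.smul_apply, D.form_rootH, ← hq,
        smul_eq_mul]
      field_simp
      norm_num
    rw [form_apply] at h2
    have := D.scale_ne_zero
    field_simp at h2 ⊢
    exact h2
  have h3 : killingForm ℂ g (coroot α.1) (coroot α.1)
      = ((∑ β ∈ H.root, ((LieModule.chainBotCoeff α.1 β
        - LieModule.chainTopCoeff α.1 β : ℤ) : ℝ) ^ 2 : ℝ) : ℂ) := by
    have h4 := LinearMap.congr_fun (LinearMap.congr_fun
      (restrict_killingForm_eq_sum (K := ℂ) (L := g) (H := H)) (coroot α.1)) (coroot α.1)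
    have h5 : ((killingForm ℂ g).restrict H) (coroot α.1) (coroot α.1)
      = killingForm ℂ g (coroot α.1) (coroot α.1) := rfl
    rw [← h5, h4]
    simp only [LinearMap.sum_apply, LinearMap.smulRight_apply, LinearMap.smul_apply, smul_eq_mul]
    rw [Complex.ofReal_sum]
    refine Finset.sum_congr rfl fun β _ => ?_
    have h6 : (β.toLinear : H →ₗ[ℂ] ℂ) (coroot α.1)
        = ((LieModule.chainBotCoeff α.1 β - LieModule.chainTopCoeff α.1 β : ℤ) : ℂ) :=
      apply_coroot_eq_cast α.1 β
    rw [h6]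
    push_cast
    ring
  set N : ℝ := ∑ β ∈ H.root,
    ((LieModule.chainBotCoeff α.1 β - LieModule.chainTopCoeff α.1 β : ℤ) : ℝ) ^ 2
  have hN : 0 ≤ N := Finset.sum_nonneg fun β _ => sq_nonneg _
  have h6 : (N : ℂ) = 4 / (D.scale * q) := h3.symm.trans h1
  have hs := D.scale_ne_zero
  have hN0 : N ≠ 0 := by
    intro h
    rw [h, Complex.ofReal_zero, eq_comm, div_eq_zero_iff] at h6
    rcases h6 with h6 | h6
    · norm_num at h6
    · exact mul_ne_zero hs hq0 h6
  refine ⟨4 / (D.scale * N), by have := D.scale_pos; positivity, ?_⟩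
  have hNc : (N : ℂ) ≠ 0 := by exact_mod_cast hN0
  push_cast
  rw [eq_div_iff (mul_ne_zero hs hNc), h6]
  have : q ≠ 0 := hq0
  field_simp

theorem rootSq_pos (α : H.root) : 0 < rootSq D.Hb α := by
  obtain ⟨q, hq, h⟩ := D.exists_root_rootH_eq α
  rw [rootSq, D.sum_rootVec_sq, h]
  exact hq

theorem root_rootH (α : H.root) : (rootSystem H).root α (D.rootH α) = rootSq D.Hb α := by
  obtain ⟨q, hq, h⟩ := D.exists_root_rootH_eq α
  rw [rootSq, D.sum_rootVec_sq, h, Complex.ofReal_re]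

theorem rootSq_ne_zero (α : H.root) : (rootSq D.Hb α : ℂ) ≠ 0 := by
  exact_mod_cast (D.rootSq_pos α).ne'

theorem form_E_negRoot (α : H.root) :
    D.form (D.E α) (D.E (negRoot α)) = 2 / (rootSq D.Hb α : ℂ) := D.E_norm α

theorem E_ne_zero (α : H.root) : D.E α ≠ 0 := by
  intro h
  have := D.form_E_negRoot α
  rw [h, map_zero, LinearMap.zero_apply, eq_comm, div_eq_zero_iff] at this
  exact this.elim two_ne_zero (D.rootSq_ne_zero α)

theorem lie_E_negRoot (α : H.root) :
    ⁅D.E α, D.E (negRoot α)⁆ = (2 / (rootSq D.Hb α : ℂ)) • (D.rootH α : g) := by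
  have h := lie_eq_killingForm_smul_of_mem_rootSpace_of_mem_rootSpace_neg
    (α := α.1) (D.E_mem α) (by have := D.E_mem (negRoot α); rwa [rootSystem_root_apply,
      LieModule.Weight.coe_coe, coe_negRoot] at this)
  rw [h, ← D.rootH_eq, SetLike.val_smul, smul_smul, ← D.form_E_negRoot, form_apply, mul_comm]

theorem rootSq_negRoot (α : H.root) : rootSq D.Hb (negRoot α) = rootSq D.Hb α := by
  simp [rootSq, rootVec, coe_negRoot]

theorem form_E_cartan (α : H.root) (h : H) : D.form (D.E α) h = 0 := by
  rw [form_apply, killingForm_apply_eq_zero_of_mem_rootSpace_of_add_ne_zero ℂ g H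
    (D.E_mem α) (β := 0) (by rw [rootSpace_zero_eq]; exact h.2) ?_, mul_zero]
  rw [add_zero]
  intro h0
  exact root_ne_zero α (LinearMap.ext (congrFun h0))

theorem form_E_E (α β : H.root) (h : (rootSystem H).root α + (rootSystem H).root β ≠ 0) :
    D.form (D.E α) (D.E β) = 0 := by
  rw [form_apply, killingForm_apply_eq_zero_of_mem_rootSpace_of_add_ne_zero ℂ g H
    (D.E_mem α) (D.E_mem β) ?_, mul_zero]
  intro h0
  exact h (LinearMap.ext (congrFun h0))

theorem mem_rootSpace_iff (α : H.root) (x : g) :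
    x ∈ rootSpace H ((rootSystem H).root α) ↔ ∃ c : ℂ, x = c • D.E α := by
  constructor
  · intro hx
    have h1 := finrank_rootSpace_eq_one (K := ℂ) (L := g) α.1 (LieSubalgebra.isNonZero_coe_root α)
    obtain ⟨c, hc⟩ := (finrank_eq_one_iff_of_nonzero' (⟨D.E α, D.E_mem α⟩ :
      rootSpace H α.1) fun h => D.E_ne_zero α (congrArg Subtype.val h)).mp h1 ⟨x, hx⟩
    exact ⟨c, (congrArg Subtype.val hc).symm⟩
  · rintro ⟨c, rfl⟩
    exact (rootSpace H ((rootSystem H).root α)).smul_mem c (D.E_mem α)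

/-- The root vectors and the Cartan subalgebra span the Lie algebra. -/
theorem induction_cartan_E {p : g → Prop} (hH : ∀ h : H, p h) (hE : ∀ α, p (D.E α))
    (hadd : ∀ x y, p x → p y → p (x + y)) (hsmul : ∀ (c : ℂ) x, p x → p (c • x)) (x : g) : p x := by
  have hx : x ∈ (⨆ χ : LieModule.Weight ℂ H g, rootSpace H χ) := by
    rw [LieModule.iSup_genWeightSpace_eq_top']
    trivial
  have h0 : p 0 := hH 0
  rw [← LieSubmodule.mem_toSubmodule, LieSubmodule.iSup_toSubmodule] at hx
  refine Submodule.iSup_induction _ (motive := p) hx (fun χ y hy => ?_) h0 hadd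
  by_cases hχ : χ.IsZero
  · have hy' : y ∈ rootSpace H (0 : H → ℂ) := by
      have : (χ : H → ℂ) = 0 := hχ
      rw [← this]; exact hy
    rw [rootSpace_zero_eq] at hy'
    exact hH ⟨y, hy'⟩
  · obtain ⟨c, rfl⟩ := (D.mem_rootSpace_iff ⟨χ, by simpa using hχ⟩ y).mp hy
    exact hsmul c _ (hE _)

end Generators
end RootData

/-! ### The extended simple roots generate the Lie algebra -/

section Heights

variable {g : Type*} [LieRing g] [LieAlgebra ℂ g] [Module.Finite ℂ g] [LieAlgebra.IsSimple ℂ g]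
variable {H : LieSubalgebra ℂ g} [H.IsCartanSubalgebra]

namespace Generators

variable {n : ℕ} (D : Generators g H n)

theorem height_negRoot (α : H.root) : D.base.height (negRoot α) = -D.base.height α :=
  D.base.height_reflectionPerm_self α

/-- `θ - β` is a sum of simple roots with natural coefficients, for every root `β`. -/
theorem exists_theta_sub (β : H.root) : ∃ c : H.root → ℕ,
    (rootSystem H).root D.theta - (rootSystem H).root β
      = ∑ j ∈ D.base.support, c j • (rootSystem H).root j := by
  have h := D.theta_highest β
  rw [← Submodule.span_nat_eq_addSubmonoidClosure, Submodule.mem_toAddSubmonoid,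
    Submodule.mem_span_image_finset_iff_exists_fun] at h
  obtain ⟨c, hc⟩ := h
  classical
  refine ⟨fun j => if hj : j ∈ D.base.support then c ⟨j, hj⟩ else 0, ?_⟩
  rw [← hc, ← Finset.sum_attach D.base.support]
  exact Finset.sum_congr rfl fun j _ => by simp

theorem height_eq_theta_sub {β : H.root} {c : H.root → ℕ}
    (hc : (rootSystem H).root D.theta - (rootSystem H).root β
      = ∑ j ∈ D.base.support, c j • (rootSystem H).root j) :
    D.base.height β = D.base.height D.theta - ∑ j ∈ D.base.support, (c j : ℤ) := by
  obtain ⟨f, -, -, hf⟩ := D.base.exists_root_eq_sum_int D.theta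
  have h : (rootSystem H).root β
      = ∑ j ∈ D.base.support, (f j - (c j : ℤ)) • (rootSystem H).root j := by
    simp only [sub_smul, Finset.sum_sub_distrib, ← hf, natCast_zsmul, ← hc, sub_sub_cancel]
  rw [RootPairing.Base.height_eq_sum hf, RootPairing.Base.height_eq_sum h, Finset.sum_sub_distrib]

theorem height_le_theta (β : H.root) : D.base.height β ≤ D.base.height D.theta := by
  obtain ⟨c, hc⟩ := D.exists_theta_sub β
  rw [D.height_eq_theta_sub hc]
  have : 0 ≤ ∑ j ∈ D.base.support, (c j : ℤ) := Finset.sum_nonneg fun j _ => by positivity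
  lia

theorem height_lt_cox (β : H.root) : D.base.height β < D.cox := by
  have := D.height_le_theta β
  rw [cox]; lia

theorem neg_cox_lt_height (β : H.root) : -D.cox < D.base.height β := by
  have := D.height_lt_cox (negRoot β)
  rw [height_negRoot] at this; lia

theorem one_le_height_theta : 1 ≤ D.base.height D.theta := by
  have h := D.height_le_theta (negRoot D.theta)
  rw [height_negRoot] at h
  have := D.base.height_ne_zero D.theta
  lia

theorem two_le_cox : 2 ≤ D.cox := by
  have := D.one_le_height_theta
  rw [cox]; lia

theorem height_aroot_none : D.base.height (D.aroot none) = 1 - D.cox := by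
  rw [aroot, height_negRoot, cox]; ring

theorem height_aroot_some (i : D.base.support) : D.base.height (D.aroot (some i)) = 1 :=
  D.base.height_one_of_mem_support i.2

/-- A difference of two extended simple roots is not a root. If one of the two is `α₀`, its height
is `±h`, which no root attains. -/
theorem aroot_sub_ne_root {i j : D.Idx} (hij : i ≠ j) (β : H.root) :
    (rootSystem H).root (D.aroot i) - (rootSystem H).root (D.aroot j) ≠ (rootSystem H).root β := by
  intro h
  have hβ := D.base.height_sub h.symm
  have h1 := D.height_lt_cox β
  have h2 := D.neg_cox_lt_height β
  rcases i with _ | i <;> rcases j with _ | j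
  · exact hij rfl
  · rw [height_aroot_none, height_aroot_some] at hβ
    lia
  · rw [height_aroot_none, height_aroot_some] at hβ
    lia
  · exact D.base.sub_notMem_range_root i.2 j.2 ⟨β, h.symm⟩

theorem aroot_injective : Function.Injective D.aroot := by
  intro i j h
  have hc := D.two_le_cox
  have hh := congrArg D.base.height h
  rcases i with _ | i <;> rcases j with _ | j
  · rfl
  · rw [height_aroot_none, height_aroot_some] at hh; lia
  · rw [height_aroot_none, height_aroot_some] at hh; lia
  · exact congrArg some (Subtype.ext h)

/-- `θ - α_i` is a non-negative combination of the simple roots, so the coefficient of `α_i` in `θ`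
is at least one. -/
theorem mark_pos (i : D.base.support) : 0 < D.mark i := by
  classical
  obtain ⟨c, hc⟩ := D.exists_theta_sub i.1
  have h1 := D.theta_eq
  have h2 : (rootSystem H).root i.1 + ∑ j : D.base.support, c j • (rootSystem H).root j
      = ∑ j : D.base.support, D.mark j • (rootSystem H).root j := by
    rw [← h1, Finset.sum_coe_sort D.base.support fun j => c j • (rootSystem H).root j, ← hc]
    abel
  have hco : ∀ j : D.base.support, D.base.toWeightBasis.coord i ((rootSystem H).root j)
      = if j = i then 1 else 0 := fun j => by
    rw [Module.Basis.coord_apply, ← RootPairing.Base.toWeightBasis_apply,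
      Module.Basis.repr_self_apply]
  have h3 := congrArg (D.base.toWeightBasis.coord i) h2
  simp only [map_add, map_sum, map_nsmul, hco, nsmul_eq_mul, mul_ite, mul_one, mul_zero,
    Finset.sum_ite_eq', Finset.mem_univ, if_true] at h3
  have h4 : 1 + c i = D.mark i := by exact_mod_cast h3
  lia

theorem eta_pos (i : D.Idx) : 0 < D.eta i := by
  rcases i with _ | i
  · exact one_pos
  · exact D.mark_pos i

theorem lie_E_E_mem (α β : H.root) :
    ⁅D.E α, D.E β⁆ ∈ rootSpace H ((rootSystem H).root α + (rootSystem H).root β : H → ℂ) :=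
  LieAlgebra.lie_mem_genWeightSpace_of_mem_genWeightSpace (D.E_mem α) (D.E_mem β)

theorem exists_lie_E_E {α β γ : H.root}
    (h : (rootSystem H).root γ = (rootSystem H).root α + (rootSystem H).root β) :
    ∃ c : ℂ, ⁅D.E α, D.E β⁆ = c • D.E γ := by
  rw [← D.mem_rootSpace_iff, h]
  exact D.lie_E_E_mem α β

theorem lie_E_E_eq_zero {α β : H.root}
    (h0 : (rootSystem H).root α + (rootSystem H).root β ≠ 0)
    (h : ∀ γ, (rootSystem H).root γ ≠ (rootSystem H).root α + (rootSystem H).root β) :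
    ⁅D.E α, D.E β⁆ = 0 := by
  by_contra hne
  let χ : LieModule.Weight ℂ H g := ⟨(rootSystem H).root α + (rootSystem H).root β, fun hbot => by
    have := D.lie_E_E_mem α β
    have h1 : rootSpace H ((rootSystem H).root α + (rootSystem H).root β : H → ℂ) = ⊥ := hbot
    rw [h1] at this
    exact hne ((LieSubmodule.mem_bot _).mp this)⟩
  have hχ : χ ∈ H.root := by
    rw [Finset.mem_filter]
    refine ⟨Finset.mem_univ _, fun hz => h0 ?_⟩
    exact LinearMap.ext (congrFun hz)
  exact h ⟨χ, hχ⟩ (LinearMap.ext fun _ => rfl)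

theorem lie_E_aroot_negRoot {i j : D.Idx} (hij : i ≠ j) :
    ⁅D.E (D.aroot i), D.E (negRoot (D.aroot j))⁆ = 0 := by
  apply D.lie_E_E_eq_zero
  · rw [root_negRoot, ← sub_eq_add_neg, sub_ne_zero]
    exact fun h => hij (D.aroot_injective ((rootSystem H).root.injective h))
  · intro γ h
    rw [root_negRoot, ← sub_eq_add_neg] at h
    exact D.aroot_sub_ne_root hij γ h.symm

/-- The bracket of root vectors does not vanish if the sum of the roots is a root, by the
representation theory of `sl₂` on root strings. -/
theorem lie_E_E_ne_zero {α γ δ : H.root}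
    (h : (rootSystem H).root δ = (rootSystem H).root α + (rootSystem H).root γ) :
    ⁅D.E α, D.E γ⁆ ≠ 0 := by
  have hα := LieSubalgebra.isNonZero_coe_root α
  have hδ : (δ.1 : H → ℂ) = (1 : ℤ) • (α.1 : H → ℂ) + (γ.1 : H → ℂ) := by
    rw [one_smul]
    funext x
    exact LinearMap.congr_fun h x
  have htop : 1 ≤ LieModule.chainTopCoeff α.1 γ.1 := by
    have := (rootSpace_zsmul_add_ne_bot_iff α.1 γ.1 hα 1).mp (by rw [← hδ]; exact δ.1.2)
    exact_mod_cast this.1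
  -- In the `sl₂`-module with highest vector `x` on the `α`-string through `γ`, the root vector of
  -- `γ` is a multiple of `f ^ (k + 1) x`, which `e` maps to a non-zero multiple of `f ^ k x`.
  obtain ⟨x, hx, x_ne0⟩ := (LieModule.chainTop α.1 γ.1).exists_ne_zero
  obtain ⟨h', e, f, isSl2, he, hf⟩ := exists_isSl2Triple_of_weight_isNonZero hα
  obtain rfl := isSl2.h_eq_coroot hα he hf
  have prim : isSl2.HasPrimitiveVectorWith x (chainLength α.1 γ.1 : ℂ) :=
    have := lie_mem_genWeightSpace_of_mem_genWeightSpace he hx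
    ⟨x_ne0, (chainLength_smul _ _ hx).symm, by
      rwa [LieModule.genWeightSpace_add_chainTop _ _ hα] at this⟩
  obtain ⟨k, hk⟩ : ∃ k, LieModule.chainTopCoeff α.1 γ.1 = k + 1 :=
    ⟨_, (Nat.sub_add_cancel htop).symm⟩
  have hle : k + 1 ≤ chainLength α.1 γ.1 := hk ▸ chainTopCoeff_le_chainLength α.1 γ.1
  have hy := prim.pow_toEnd_f_ne_zero_of_eq_nat rfl hle
  have hy' := prim.pow_toEnd_f_ne_zero_of_eq_nat rfl (Nat.le_of_succ_le hle)
  have hlie := prim.lie_e_pow_succ_toEnd_f k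
  have hmem := toEnd_pow_apply_mem hf hx (k + 1)
  have hw : ((k + 1) • (-(α.1 : H → ℂ)) + (LieModule.chainTop α.1 γ.1 : H → ℂ))
      = ((rootSystem H).root γ : H → ℂ) := by
    rw [LieModule.coe_chainTop, hk]
    simp
  rw [hw] at hmem
  obtain ⟨c, hc⟩ := (D.mem_rootSpace_iff γ _).mp hmem
  obtain ⟨d, hd⟩ := (D.mem_rootSpace_iff α e).mp he
  intro h0
  rw [hc, hd, lie_smul, smul_lie, h0, smul_zero, smul_zero, eq_comm, smul_eq_zero] at hlie
  refine hlie.elim (fun h1 => ?_) hy'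
  rcases mul_eq_zero.mp h1 with h1 | h1
  · exact absurd h1 (by exact_mod_cast Nat.succ_ne_zero k)
  · rw [sub_eq_zero, Nat.cast_inj] at h1
    lia

/-- The Lie algebra is generated by the root vectors of the simple roots and their negatives. -/
theorem eq_top_of_forall_simple_mem {S : LieSubalgebra ℂ g}
    (h : ∀ i ∈ D.base.support, D.E i ∈ S) (h' : ∀ i ∈ D.base.support, D.E (negRoot i) ∈ S) :
    S = ⊤ := by
  have hpos : ∀ β : H.root, D.base.IsPos β → D.E β ∈ S ∧ D.E (negRoot β) ∈ S := by
    intro β hβ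
    refine hβ.induction_on_add (p := fun β => D.E β ∈ S ∧ D.E (negRoot β) ∈ S)
      (fun i hi => ⟨h i hi, h' i hi⟩) fun i j k hk hi hj => ?_
    · have aux : ∀ a b c : H.root, (rootSystem H).root c
          = (rootSystem H).root a + (rootSystem H).root b → D.E a ∈ S → D.E b ∈ S → D.E c ∈ S := by
        intro a b c hc ha hb
        obtain ⟨r, hr⟩ := D.exists_lie_E_E hc
        have hne := D.lie_E_E_ne_zero hc
        have hr0 : r ≠ 0 := fun h0 => hne (by rw [hr, h0, zero_smul])
        have : D.E c = r⁻¹ • ⁅D.E a, D.E b⁆ := by rw [hr, smul_smul, inv_mul_cancel₀ hr0, one_smul]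
        rw [this]
        exact S.smul_mem _ (S.lie_mem ha hb)
      refine ⟨aux i j k hk hi.1 (h j hj), aux _ _ _ ?_ hi.2 (h' j hj)⟩
      rw [root_negRoot, root_negRoot, root_negRoot, hk]
      abel
  have hE : ∀ β : H.root, D.E β ∈ S := by
    intro β
    rcases RootPairing.Base.IsPos.or_neg D.base β with hβ | hβ
    · exact (hpos β hβ).1
    · have := (hpos (negRoot β) hβ).2
      rwa [negRoot_negRoot] at this
  have hH : ∀ x : H, (x : g) ∈ S := by
    intro x
    have hx : x ∈ Submodule.span ℂ (Set.range (rootSystem H).coroot) := by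
      rw [RootPairing.IsRootSystem.span_coroot_eq_top]; trivial
    induction hx using Submodule.span_induction with
    | mem y hy =>
      obtain ⟨β, rfl⟩ := hy
      have h1 := D.lie_E_negRoot β
      have h2 : ((rootSystem H).coroot β : g) = ⁅D.E β, D.E (negRoot β)⁆ := by
        rw [h1, rootSystem_coroot_apply, D.coroot_eq β, D.root_rootH]; rfl
      rw [h2]
      exact S.lie_mem (hE _) (hE _)
    | zero => exact S.zero_mem
    | add y z _ _ hy hz => exact S.add_mem hy hz
    | smul c y _ hy => exact S.smul_mem c hy
  rw [eq_top_iff]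
  intro x _
  exact D.induction_cartan_E (p := fun x => x ∈ S) hH hE (fun _ _ => S.add_mem)
    (fun c _ => S.smul_mem c) x

/-- A subspace which is stable under the simple root vectors and their negatives is an ideal. -/
theorem lie_mem_of_forall_simple {W : Submodule ℂ g}
    (hE : ∀ i ∈ D.base.support, ∀ w ∈ W, ⁅D.E i, w⁆ ∈ W)
    (hF : ∀ i ∈ D.base.support, ∀ w ∈ W, ⁅D.E (negRoot i), w⁆ ∈ W) (x : g) :
    ∀ w ∈ W, ⁅x, w⁆ ∈ W := by
  let N : LieSubalgebra ℂ g :=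
    { carrier := {x | ∀ w ∈ W, ⁅x, w⁆ ∈ W}
      add_mem' := fun {a b} ha hb w hw => by rw [add_lie]; exact W.add_mem (ha w hw) (hb w hw)
      zero_mem' := fun w _ => by rw [zero_lie]; exact W.zero_mem
      smul_mem' := fun c a ha w hw => by rw [smul_lie]; exact W.smul_mem c (ha w hw)
      lie_mem' := fun {a b} ha hb w hw => by
        rw [lie_lie]; exact W.sub_mem (ha _ (hb w hw)) (hb _ (ha w hw)) }
  have hN : N = ⊤ := D.eq_top_of_forall_simple_mem (S := N) hE hF
  have : x ∈ N := hN ▸ LieSubalgebra.mem_top x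
  exact this

theorem lie_negRoot_E_negTheta {i : H.root} (hi : i ∈ D.base.support) :
    ⁅D.E (negRoot i), D.E (negRoot D.theta)⁆ = 0 := by
  rw [← lie_skew, neg_eq_zero]
  exact D.lie_E_aroot_negRoot (i := none) (j := some ⟨i, hi⟩) (by simp)

/-- The Lie algebra is generated by the root vectors of the extended simple roots: the lowest root
vector generates `g` under the raising operators, because the span of the elements so obtained is
also stable under the lowering operators and hence an ideal. -/
theorem lieSpan_aroot_eq_top :
    LieSubalgebra.lieSpan ℂ g (Set.range fun j : D.Idx => D.E (D.aroot j)) = ⊤ := by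
  set N := LieSubalgebra.lieSpan ℂ g (Set.range fun j : D.Idx => D.E (D.aroot j)) with hN
  have hmem : ∀ j, D.E (D.aroot j) ∈ N := fun j => LieSubalgebra.subset_lieSpan ⟨j, rfl⟩
  -- `W` is the span of the elements obtained from the lowest root vector by raising operators.
  let 𝒲 : Set (Submodule ℂ g) := {V | D.E (negRoot D.theta) ∈ V ∧
    ∀ i ∈ D.base.support, ∀ v ∈ V, ⁅D.E i, v⁆ ∈ V}
  set W : Submodule ℂ g := sInf 𝒲 with hW
  have hW0 : D.E (negRoot D.theta) ∈ W := by
    rw [hW, Submodule.mem_sInf]; exact fun V hV => hV.1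
  have hWE : ∀ i ∈ D.base.support, ∀ v ∈ W, ⁅D.E i, v⁆ ∈ W := by
    intro i hi v hv
    rw [hW, Submodule.mem_sInf] at hv ⊢
    exact fun V hV => hV.2 i hi v (hv V hV)
  -- The vectors which the lowering operators and the Cartan subalgebra do not move out of `W`.
  let V' : Submodule ℂ g :=
    { carrier := {v | v ∈ W ∧ (∀ j ∈ D.base.support, ⁅D.E (negRoot j), v⁆ ∈ W) ∧
        ∀ h : H, ⁅(h : g), v⁆ ∈ W}
      add_mem' := fun {a b} ha hb => ⟨W.add_mem ha.1 hb.1,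
        fun j hj => by rw [lie_add]; exact W.add_mem (ha.2.1 j hj) (hb.2.1 j hj),
        fun h => by rw [lie_add]; exact W.add_mem (ha.2.2 h) (hb.2.2 h)⟩
      zero_mem' := ⟨W.zero_mem, fun j _ => by rw [lie_zero]; exact W.zero_mem,
        fun h => by rw [lie_zero]; exact W.zero_mem⟩
      smul_mem' := fun c a ha => ⟨W.smul_mem c ha.1,
        fun j hj => by rw [lie_smul]; exact W.smul_mem c (ha.2.1 j hj),
        fun h => by rw [lie_smul]; exact W.smul_mem c (ha.2.2 h)⟩ }
  have hV' : V' ∈ 𝒲 := by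
    refine ⟨⟨hW0, fun j hj => ?_, fun h => ?_⟩, ?_⟩
    · rw [D.lie_negRoot_E_negTheta hj]; exact W.zero_mem
    · rw [D.lie_E]; exact W.smul_mem _ hW0
    · rintro i hi v ⟨hv, hvF, hvH⟩
      refine ⟨hWE i hi v hv, fun j hj => ?_, fun h => ?_⟩
      · rw [leibniz_lie]
        refine W.add_mem ?_ (hWE i hi _ (hvF j hj))
        by_cases hij : i = j
        · subst hij
          rw [show ⁅D.E (negRoot i), D.E i⁆ = -⁅D.E i, D.E (negRoot i)⁆ from (lie_skew _ _).symm,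
            D.lie_E_negRoot, neg_lie, smul_lie]
          exact W.neg_mem (W.smul_mem _ (hvH _))
        · have h0 : ⁅D.E i, D.E (negRoot j)⁆ = 0 :=
            D.lie_E_aroot_negRoot (i := some ⟨i, hi⟩) (j := some ⟨j, hj⟩) (by simpa using hij)
          rw [show ⁅D.E (negRoot j), D.E i⁆ = -⁅D.E i, D.E (negRoot j)⁆ from (lie_skew _ _).symm,
            h0, neg_zero, zero_lie]
          exact W.zero_mem
      · rw [leibniz_lie, D.lie_E, smul_lie]
        exact W.add_mem (W.smul_mem _ (hWE i hi v hv)) (hWE i hi _ (hvH h))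
  have hWV : W ≤ V' := sInf_le hV'
  have hideal := D.lie_mem_of_forall_simple (W := W) hWE fun i hi w hw => (hWV hw).2.1 i hi
  let I : LieIdeal ℂ g := { W with lie_mem := fun {x m} hm => hideal x m hm }
  have hI : I = ⊤ := by
    refine (LieAlgebra.IsSimple.eq_bot_or_eq_top I).resolve_left fun h => ?_
    have : D.E (negRoot D.theta) ∈ I := hW0
    rw [h] at this
    exact D.E_ne_zero _ ((LieSubmodule.mem_bot _).mp this)
  have hWN : W ≤ N.toSubmodule := sInf_le
    ⟨hmem none, fun i hi v hv => N.lie_mem (hmem (some ⟨i, hi⟩)) hv⟩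
  rw [eq_top_iff]
  intro x _
  have : x ∈ I := hI ▸ LieSubmodule.mem_top x
  exact hWN this

end Generators
end Heights

/-! ### The action of pairs on the tensor square -/

section TensorAction

variable {g : Type*} [LieRing g] [LieAlgebra ℂ g]

/-- The action of the pair `(y, z)` on `g ⊗ g`, the operator `ad y ⊗ 1 + 1 ⊗ ad z`. -/
def act (y z : g) : g ⊗[ℂ] g →ₗ[ℂ] g ⊗[ℂ] g :=
  TensorProduct.map (ad ℂ g y) LinearMap.id + TensorProduct.map LinearMap.id (ad ℂ g z)

@[simp]
theorem act_tmul (y z a b : g) : act y z (a ⊗ₜ[ℂ] b) = ⁅y, a⁆ ⊗ₜ b + a ⊗ₜ ⁅z, b⁆ := by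
  simp [act]

theorem act_add (y y' z z' : g) : act (y + y') (z + z') = act y z + act y' z' := by
  ext a b
  simp [TensorProduct.add_tmul, TensorProduct.tmul_add]
  abel

theorem act_smul (c : ℂ) (y z : g) : act (c • y) (c • z) = c • act y z := by
  ext a b
  simp [TensorProduct.smul_tmul']

theorem act_zero : act (0 : g) 0 = 0 := by
  ext a b
  simp

theorem act_sum {ι : Type*} (s : Finset ι) (y z : ι → g) :
    act (∑ i ∈ s, y i) (∑ i ∈ s, z i) = ∑ i ∈ s, act (y i) (z i) := by
  classical
  induction s using Finset.induction_on with
  | empty => simp [act_zero]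
  | insert a s ha ih => rw [Finset.sum_insert ha, Finset.sum_insert ha, Finset.sum_insert ha,
      act_add, ih]

/-- `act` is a representation of `g × g`. -/
theorem act_lie (y y' z z' : g) (s : g ⊗[ℂ] g) :
    act ⁅y, y'⁆ ⁅z, z'⁆ s = act y z (act y' z' s) - act y' z' (act y z s) := by
  induction s using TensorProduct.induction_on with
  | zero => simp
  | tmul a b =>
    simp only [act_tmul, map_add, lie_lie, TensorProduct.sub_tmul, TensorProduct.tmul_sub]
    abel
  | add a b ha hb => rw [map_add, ha, hb]; simp only [map_add]; abel

theorem act_neg (y z : g) : act (-y) (-z) = -act y z := by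
  ext a b
  simp only [TensorProduct.AlgebraTensorModule.curry_apply, TensorProduct.curry_apply,
    LinearMap.coe_restrictScalars, act_tmul, LinearMap.neg_apply, neg_lie,
    TensorProduct.neg_tmul, TensorProduct.tmul_neg, neg_add]

theorem map_act {ω₁ ω₂ : g →ₗ[ℂ] g} (h₁ : ∀ x y, ω₁ ⁅x, y⁆ = ⁅ω₁ x, ω₁ y⁆)
    (h₂ : ∀ x y, ω₂ ⁅x, y⁆ = ⁅ω₂ x, ω₂ y⁆) (y z : g) (s : g ⊗[ℂ] g) :
    act (ω₁ y) (ω₂ z) (TensorProduct.map ω₁ ω₂ s) = TensorProduct.map ω₁ ω₂ (act y z s) := by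
  induction s using TensorProduct.induction_on with
  | zero => simp
  | tmul a b => simp [h₁, h₂]
  | add a b ha hb => simp only [map_add, ha, hb]

end TensorAction

/-! ### The `r`-matrix and transposition -/

section RMatrix

variable {g : Type*} [LieRing g] [LieAlgebra ℂ g] [Module.Finite ℂ g] [LieAlgebra.IsSimple ℂ g]
variable {H : LieSubalgebra ℂ g} [H.IsCartanSubalgebra]

namespace Generators

variable {n : ℕ} (D : Generators g H n)

/-- The invariant form turns `a ⊗ b` into the operator `x ↦ tr(bx) a`. -/
def toOp : g ⊗[ℂ] g →ₗ[ℂ] g →ₗ[ℂ] g :=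
  dualTensorHom ℂ g g ∘ₗ LinearMap.rTensor g D.form ∘ₗ (TensorProduct.comm ℂ g g).toLinearMap

@[simp]
theorem toOp_tmul (a b x : g) : D.toOp (a ⊗ₜ b) x = D.form b x • a := by
  simp [toOp]

theorem toOp_injective : Function.Injective D.toOp := by
  have h1 : Function.Injective D.form := by
    rw [← LinearMap.ker_eq_bot, LinearMap.ker_eq_bot']
    intro x hx
    exact D.eq_zero_of_form_eq_zero fun y => by rw [hx]; rfl
  have h2 : Function.Injective (dualTensorHom ℂ g g) :=
    (dualTensorHomEquiv ℂ g g).injective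
  exact h2.comp ((Module.Flat.rTensor_preserves_injective_linearMap _ h1).comp
    (TensorProduct.comm ℂ g g).injective)

/-- In terms of operators, `act y z` is `S ↦ ad y ∘ S - S ∘ ad z`. -/
theorem toOp_act (y z : g) (s : g ⊗[ℂ] g) (x : g) :
    D.toOp (act y z s) x = ⁅y, D.toOp s x⁆ - D.toOp s ⁅z, x⁆ := by
  induction s using TensorProduct.induction_on with
  | zero => simp
  | tmul a b => simp [form_lie_left, sub_eq_add_neg]
  | add a b ha hb => simp only [map_add, LinearMap.add_apply, ha, hb, lie_add]; abel

/-- An element of `g ⊗ g` killed by the first tensor factor of the action vanishes, since the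
centre of a simple Lie algebra is trivial. -/
theorem eq_zero_of_act_left (D : Generators g H n) {s : g ⊗[ℂ] g} (h : ∀ y : g, act y 0 s = 0) :
    s = 0 := by
  apply D.toOp_injective
  rw [map_zero]
  ext x
  have hc : D.toOp s x ∈ LieAlgebra.center ℂ g := by
    rw [LieModule.mem_maxTrivSubmodule]
    intro y
    have := congrArg (fun t => D.toOp t x) (h y)
    simpa [toOp_act] using this
  rw [LieAlgebra.center_eq_bot] at hc
  exact (LieSubmodule.mem_bot _).mp hc

/-- The eigenvalue of `r(l)`, regarded as an operator by means of `toOp`, on the root vectors of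
height `k` and, for `k = 0`, on the Cartan subalgebra. Here `h` is the Coxeter number. -/
def rFun (l : ℝ) (h k : ℤ) : ℂ :=
  if k = 0 then ((l : ℂ) ^ h + 1) / ((l : ℂ) ^ h - 1)
  else if 0 < k then -(2 / (1 - (l : ℂ) ^ h) * (l : ℂ) ^ k)
  else 2 / (1 - (l : ℂ) ^ (-h)) * (l : ℂ) ^ k

theorem rFun_zero (l : ℝ) (h : ℤ) : rFun l h 0 = ((l : ℂ) ^ h + 1) / ((l : ℂ) ^ h - 1) := if_pos rfl

theorem rFun_pos (l : ℝ) (h : ℤ) {k : ℤ} (hk : 0 < k) (hl : (l : ℂ) ^ h ≠ 1) :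
    rFun l h k = 2 * (l : ℂ) ^ k / ((l : ℂ) ^ h - 1) := by
  rw [rFun, if_neg hk.ne', if_pos hk]
  have h1 : (l : ℂ) ^ h - 1 ≠ 0 := sub_ne_zero.mpr hl
  have h2 : 1 - (l : ℂ) ^ h ≠ 0 := sub_ne_zero.mpr hl.symm
  field_simp
  ring

theorem rFun_neg {l : ℝ} (hl0 : l ≠ 0) (h : ℤ) {k : ℤ} (hk : k < 0) (hl : (l : ℂ) ^ h ≠ 1) :
    rFun l h k = 2 * ((l : ℂ) ^ h * (l : ℂ) ^ k) / ((l : ℂ) ^ h - 1) := by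
  rw [rFun, if_neg hk.ne, if_neg hk.not_gt, zpow_neg]
  have h0 : (l : ℂ) ^ h ≠ 0 := zpow_ne_zero _ (by exact_mod_cast hl0)
  have h1 : (l : ℂ) ^ h - 1 ≠ 0 := sub_ne_zero.mpr hl
  have h2 : 1 - ((l : ℂ) ^ h)⁻¹ ≠ 0 := by
    rw [sub_ne_zero, ne_comm, ne_eq, inv_eq_one]
    exact hl
  field_simp

theorem toOp_rMatrix_cartan (l : ℝ) (x : H) :
    D.toOp (D.rMatrix l) x = rFun l D.cox 0 • (x : g) := by
  have h1 : ∑ a, D.form (D.Hb a) x • (D.Hb a : g) = x := by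
    have h2 : ∀ a, D.form (D.Hb a) x = D.Hb.repr x a := fun a => by
      have := congrArg (D.form (D.Hb a) ∘ₗ H.toSubmodule.subtype) (D.Hb.sum_repr x)
      rw [map_sum] at this
      simpa [D.form_Hb] using this.symm
    simp only [h2]
    have := congrArg H.toSubmodule.subtype (D.Hb.sum_repr x)
    rw [map_sum] at this
    simpa using this
  have h3 : ∀ α, D.form (D.E α) x = 0 := fun α => D.form_E_cartan α x
  simp [rMatrix, rFun_zero, h3, h1]

theorem toOp_rMatrix_E (l : ℝ) (β : H.root) :
    D.toOp (D.rMatrix l) (D.E β) = rFun l D.cox (D.base.height β) • D.E β := by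
  classical
  have h1 : ∀ a, D.form (D.Hb a) (D.E β) = 0 := fun a => by
    rw [form_comm]; exact D.form_E_cartan β _
  have h2 : ∀ α, D.form (D.E (negRoot α)) (D.E β)
      = if α = β then 2 / (rootSq D.Hb β : ℂ) else 0 := fun α => by
    split_ifs with h
    · rw [h, form_comm, D.form_E_negRoot]
    · refine D.form_E_E _ _ fun h0 => h ?_
      rw [root_negRoot, neg_add_eq_zero] at h0
      exact (rootSystem H).root.injective h0
  have h3 : ∀ α, D.form (D.E α) (D.E β)
      = if α = negRoot β then 2 / (rootSq D.Hb β : ℂ) else 0 := fun α => by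
    have := h2 (negRoot α)
    rw [negRoot_negRoot] at this
    rw [this]
    have hiff : negRoot α = β ↔ α = negRoot β :=
      ⟨fun h => by rw [← h, negRoot_negRoot], fun h => by rw [h, negRoot_negRoot]⟩
    simp only [hiff]
  have h4 := D.rootSq_ne_zero β
  have h5 := D.base.height_ne_zero β
  simp only [rMatrix, map_add, map_sub, map_smul, map_sum, LinearMap.add_apply,
    LinearMap.sub_apply, LinearMap.smul_apply, LinearMap.sum_apply, toOp_tmul, h1, h2, h3,
    zero_smul, Finset.sum_const_zero, smul_zero, ite_smul, smul_ite, Finset.sum_ite_eq',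
    posRoots, Finset.mem_filter, Finset.mem_univ, true_and, height_negRoot, rootSq_negRoot,
    negRoot_negRoot, neg_neg, rFun, if_neg h5, smul_smul]
  rcases lt_or_gt_of_ne h5 with h6 | h6
  · rw [if_neg h6.not_gt, if_pos (by lia), if_neg h6.not_gt, sub_zero, zero_add]
    congr 1
    field_simp
  · rw [if_pos h6, if_neg (by lia), if_pos h6, add_zero, zero_sub, ← neg_smul]
    congr 1
    field_simp

/-- The failure of `λ c(k) = c(k + ht α_j)` at `k = 0`, for the eigenvalues `c = rFun`. -/
theorem mul_rFun_zero_sub {l : ℝ} (hl0 : l ≠ 0) (hl : (l : ℂ) ^ D.cox ≠ 1) (j : D.Idx) :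
    (l : ℂ) * rFun l D.cox 0 - rFun l D.cox (D.base.height (D.aroot j)) = l := by
  have h1 : (l : ℂ) ^ D.cox - 1 ≠ 0 := sub_ne_zero.mpr hl
  have h2 := D.two_le_cox
  have h3 : (l : ℂ) ≠ 0 := by exact_mod_cast hl0
  rcases j with _ | j
  · rw [height_aroot_none, rFun_zero, rFun_neg hl0 _ (by lia) hl, ← zpow_add₀ h3,
      add_sub_cancel, zpow_one]
    field_simp
    ring
  · rw [height_aroot_some, rFun_zero, rFun_pos _ _ one_pos hl, zpow_one]
    field_simp
    ring

/-- The failure of `λ c(k) = c(k + ht α_j)` at `k = -ht α_j`, for the eigenvalues `c = rFun`. -/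
theorem mul_rFun_neg_sub {l : ℝ} (hl0 : l ≠ 0) (hl : (l : ℂ) ^ D.cox ≠ 1) (j : D.Idx) :
    (l : ℂ) * rFun l D.cox (-D.base.height (D.aroot j)) - rFun l D.cox 0 = 1 := by
  have h1 : (l : ℂ) ^ D.cox - 1 ≠ 0 := sub_ne_zero.mpr hl
  have h2 := D.two_le_cox
  have h3 : (l : ℂ) ≠ 0 := by exact_mod_cast hl0
  rcases j with _ | j
  · rw [height_aroot_none, rFun_zero, rFun_pos _ _ (by lia) hl, neg_sub, zpow_sub₀ h3, zpow_one]
    field_simp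
    ring
  · rw [height_aroot_some, rFun_zero, rFun_neg hl0 _ (by lia) hl, zpow_neg, zpow_one]
    field_simp
    ring

/-- Away from height zero, adding `α_j` multiplies the eigenvalue by `λ`. For `α₀` the height drops
from a positive to a negative value, and the two branches of `rFun` differ there by `λ ^ h`. -/
theorem mul_rFun_eq {l : ℝ} (hl0 : l ≠ 0) (hl : (l : ℂ) ^ D.cox ≠ 1) (j : D.Idx) {β δ : H.root}
    (h : (rootSystem H).root δ = (rootSystem H).root (D.aroot j) + (rootSystem H).root β) :
    (l : ℂ) * rFun l D.cox (D.base.height β) = rFun l D.cox (D.base.height δ) := by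
  have h1 : (l : ℂ) ^ D.cox - 1 ≠ 0 := sub_ne_zero.mpr hl
  have h3 : (l : ℂ) ≠ 0 := by exact_mod_cast hl0
  have h4 := D.base.height_add h
  have h5 := D.base.height_ne_zero β
  have h6 := D.base.height_ne_zero δ
  have h7 := D.height_lt_cox β
  have h8 := D.neg_cox_lt_height δ
  rcases j with _ | j
  · rw [height_aroot_none] at h4
    rw [rFun_pos _ _ (by lia) hl, rFun_neg hl0 _ (by lia) hl, ← zpow_add₀ h3, h4,
      show D.cox + (1 - D.cox + D.base.height β) = D.base.height β + 1 by ring,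
      zpow_add_one₀ h3]
    ring
  · rw [height_aroot_some] at h4
    rw [h4, add_comm 1]
    rcases lt_or_gt_of_ne h5 with h9 | h9
    · rw [rFun_neg hl0 _ h9 hl, rFun_neg hl0 _ (by lia) hl, zpow_add_one₀ h3]
      ring
    · rw [rFun_pos _ _ h9 hl, rFun_pos _ _ (by lia) hl, zpow_add_one₀ h3]
      ring

/-- The `r`-matrix is not invariant under the affine root vectors `λ E_{α_j}`, but its variation is
the cobracket of a Lie bialgebra, in which the `r`-matrix no longer appears. -/
theorem act_E_rMatrix {l₁ l₂ : ℝ} (h₁ : l₁ ≠ 0) (h₂ : l₂ ≠ 0)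
    (hl : ((l₁ / l₂ : ℝ) : ℂ) ^ D.cox ≠ 1) (j : D.Idx) :
    act ((l₁ : ℂ) • D.E (D.aroot j)) ((l₂ : ℂ) • D.E (D.aroot j)) (D.rMatrix (l₁ / l₂))
      = (D.rootH (D.aroot j) : g) ⊗ₜ ((l₂ : ℂ) • D.E (D.aroot j))
        - ((l₁ : ℂ) • D.E (D.aroot j)) ⊗ₜ (D.rootH (D.aroot j) : g) := by
  -- Compare both sides as operators on the Cartan subalgebra and on each root vector.
  set l := l₁ / l₂ with hldef
  have hl0 : l ≠ 0 := div_ne_zero h₁ h₂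
  have hl1 : (l₁ : ℂ) = l₂ * l := by
    rw [hldef, Complex.ofReal_div, mul_div_cancel₀]
    exact_mod_cast h₂
  set γ := D.aroot j with hγ
  have hE := D.toOp_rMatrix_E l
  have hC := D.toOp_rMatrix_cartan l
  apply D.toOp_injective
  ext x
  refine D.induction_cartan_E (p := fun x => D.toOp _ x = D.toOp _ x) (fun x => ?_) (fun β => ?_)
    (fun x y hx hy => by rw [map_add, map_add, hx, hy])
    (fun c x hx => by rw [map_smul, map_smul, hx]) x
  · simp only [toOp_act, hC, map_sub, LinearMap.sub_apply, toOp_tmul, smul_lie, lie_smul,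
      D.lie_E_cartan, map_smul, map_neg, hE, D.form_rootH, D.form_E_cartan,
      LinearMap.smul_apply, hl1]
    have := D.mul_rFun_zero_sub hl0 hl j
    rw [← hγ] at this
    rw [← sub_eq_zero]
    simp only [smul_smul, ← neg_smul, ← sub_smul, smul_zero, zero_smul, zero_sub]
    convert zero_smul ℂ (D.E γ) using 2
    linear_combination (-((rootSystem H).root γ x) * l₂) * this
  · simp only [toOp_act, hE, map_sub, LinearMap.sub_apply, toOp_tmul, smul_lie, lie_smul,
      map_smul, D.form_comm _ (D.E β), D.form_E_cartan, LinearMap.smul_apply, zero_smul, sub_zero]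
    by_cases h0 : (rootSystem H).root γ + (rootSystem H).root β = 0
    · have hβ : β = negRoot γ := by
        apply (rootSystem H).root.injective
        rw [root_negRoot, eq_neg_iff_add_eq_zero, add_comm]
        exact h0
      have := D.mul_rFun_neg_sub hl0 hl j
      rw [hβ, D.lie_E_negRoot, height_negRoot, D.form_comm _ (D.E γ), D.form_E_negRoot, map_smul,
        hC, hl1]
      simp only [smul_smul, ← sub_smul]
      congr 1
      linear_combination (l₂ * (2 / (rootSq D.Hb γ : ℂ))) * this
    · rw [D.form_comm, D.form_E_E _ _ h0]
      by_cases h : ∃ δ, (rootSystem H).root δ = (rootSystem H).root γ + (rootSystem H).root β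
      · obtain ⟨δ, hδ⟩ := h
        obtain ⟨c, hc⟩ := D.exists_lie_E_E hδ
        rw [hc, map_smul, hE, ← D.mul_rFun_eq hl0 hl j hδ, hl1]
        module
      · rw [D.lie_E_E_eq_zero h0 (not_exists.mp h)]
        simp

/-- The `r`-matrix has weight zero. -/
theorem act_cartan_rMatrix (l : ℝ) (h : H) : act (h : g) h (D.rMatrix l) = 0 := by
  apply D.toOp_injective
  rw [map_zero]
  ext x
  refine D.induction_cartan_E (p := fun x => D.toOp _ x = 0) (fun x => ?_) (fun β => ?_)
    (fun x y hx hy => by rw [map_add, hx, hy, add_zero])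
    (fun c x hx => by rw [map_smul, hx, smul_zero]) x
  · rw [toOp_act, D.toOp_rMatrix_cartan, lie_smul, lie_cartan, map_zero, smul_zero, sub_zero]
  · rw [toOp_act, D.toOp_rMatrix_E, lie_smul, D.lie_E, map_smul, D.toOp_rMatrix_E, smul_comm,
      sub_self]

theorem tr_rootH (α : H.root) : D.tr (D.rootH α) = D.rootH α := D.tr_cartan _ (D.rootH α).2

theorem tr_tr (x : g) : D.tr (D.tr x) = x := by
  refine D.induction_cartan_E (p := fun x => D.tr (D.tr x) = x) (fun h => ?_) (fun β => ?_)
    (fun x y hx hy => by rw [map_add, map_add, hx, hy])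
    (fun c x hx => by rw [map_smul, map_smul, hx]) x
  · rw [D.tr_cartan _ h.2, D.tr_cartan _ h.2]
  · rw [D.tr_tr_E]

@[simp]
theorem tr1_tmul (a b : g) : D.tr1 (a ⊗ₜ b) = D.tr a ⊗ₜ b := rfl

@[simp]
theorem tr2_tmul (a b : g) : D.tr2 (a ⊗ₜ b) = a ⊗ₜ D.tr b := rfl

@[simp]
theorem tr12_tmul (a b : g) : D.tr12 (a ⊗ₜ b) = D.tr a ⊗ₜ D.tr b := rfl

theorem tr2_tr12 (s : g ⊗[ℂ] g) : D.tr2 (D.tr12 s) = D.tr1 s := by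
  have : D.tr2 ∘ₗ D.tr12 = D.tr1 := by ext a b; simp [tr_tr]
  exact LinearMap.congr_fun this s

theorem tr1_tr12 (s : g ⊗[ℂ] g) : D.tr1 (D.tr12 s) = D.tr2 s := by
  have : D.tr1 ∘ₗ D.tr12 = D.tr2 := by ext a b; simp [tr_tr]
  exact LinearMap.congr_fun this s

theorem tr12_tr12 (s : g ⊗[ℂ] g) : D.tr12 (D.tr12 s) = s := by
  have : D.tr12 ∘ₗ D.tr12 = LinearMap.id := by ext a b; simp [tr_tr]
  exact LinearMap.congr_fun this s

theorem tr12_act (y z : g) (s : g ⊗[ℂ] g) :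
    D.tr12 (act y z s) = -act (D.tr y) (D.tr z) (D.tr12 s) := by
  induction s using TensorProduct.induction_on with
  | zero => simp
  | tmul a b =>
    simp only [act_tmul, map_add, tr12_tmul, D.tr_lie]
    rw [← lie_skew (D.tr y), ← lie_skew (D.tr z), TensorProduct.neg_tmul, TensorProduct.tmul_neg]
    abel
  | add a b ha hb => simp only [map_add, ha, hb]; abel

theorem tr2_act (y z : g) (s : g ⊗[ℂ] g) :
    D.tr2 (act y z s) = act y (-D.tr z) (D.tr2 s) := by
  induction s using TensorProduct.induction_on with
  | zero => simp
  | tmul a b =>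
    simp only [act_tmul, map_add, tr2_tmul, D.tr_lie]
    rw [neg_lie, lie_skew]
  | add a b ha hb => simp only [map_add, ha, hb]

theorem tr12_rMatrix {l : ℝ} (hl0 : l ≠ 0) (hl : l ^ D.cox ≠ 1) :
    D.tr12 (D.rMatrix l) = -D.rMatrix l⁻¹ := by
  have hl' : (l : ℂ) ^ D.cox ≠ 1 := by exact_mod_cast hl
  have h0 : (l : ℂ) ^ D.cox ≠ 0 := zpow_ne_zero _ (by exact_mod_cast hl0)
  have h1 : ((l : ℂ) ^ D.cox + 1) / ((l : ℂ) ^ D.cox - 1)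
      = -((((l : ℂ) ^ D.cox)⁻¹ + 1) / (((l : ℂ) ^ D.cox)⁻¹ - 1)) := by
    have h2 : (l : ℂ) ^ D.cox - 1 ≠ 0 := sub_ne_zero.mpr hl'
    have h3 : ((l : ℂ) ^ D.cox)⁻¹ - 1 ≠ 0 := by
      rw [sub_ne_zero, ne_eq, inv_eq_one]; exact hl'
    rw [← neg_div, div_eq_div_iff h2 h3]
    field_simp
    ring
  simp only [rMatrix, map_add, map_sub, map_smul, map_sum, tr12_tmul, D.tr_E, negRoot_negRoot,
    D.tr_cartan _ (D.Hb _).2, Complex.ofReal_inv, inv_zpow', h1, zpow_neg, inv_inv]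
  module

/-- The variation of the `r`-matrix under `λ⁻¹ E_{-α_j}`, obtained from that under `λ E_{α_j}` by
transposition. -/
theorem act_E_negRoot_rMatrix {l₁ l₂ : ℝ} (h₁ : l₁ ≠ 0) (h₂ : l₂ ≠ 0)
    (hl : (l₁ / l₂) ^ D.cox ≠ 1) (j : D.Idx) :
    act ((l₁ : ℂ)⁻¹ • D.E (negRoot (D.aroot j))) ((l₂ : ℂ)⁻¹ • D.E (negRoot (D.aroot j)))
        (D.rMatrix (l₁ / l₂))
      = (D.rootH (D.aroot j) : g) ⊗ₜ ((l₂ : ℂ)⁻¹ • D.E (negRoot (D.aroot j)))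
        - ((l₁ : ℂ)⁻¹ • D.E (negRoot (D.aroot j))) ⊗ₜ (D.rootH (D.aroot j) : g) := by
  have hinv : l₁⁻¹ / l₂⁻¹ = (l₁ / l₂)⁻¹ := by rw [inv_div_inv, inv_div]
  have hl' : ((l₁⁻¹ / l₂⁻¹ : ℝ) : ℂ) ^ D.cox ≠ 1 := by
    rw [hinv]
    have : (l₁ / l₂)⁻¹ ^ D.cox ≠ 1 := by rw [inv_zpow, ne_eq, inv_eq_one]; exact hl
    exact_mod_cast this
  have h := congrArg D.tr12 (D.act_E_rMatrix (inv_ne_zero h₁) (inv_ne_zero h₂) hl' j)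
  rw [hinv, D.tr12_act, ← neg_eq_iff_eq_neg.mpr (D.tr12_rMatrix (div_ne_zero h₁ h₂) hl), map_neg,
    D.tr12_tr12, map_neg, neg_neg] at h
  simpa [D.tr_E, tr_rootH] using h

theorem tr_laxT {l : ℝ} (hl : l ≠ 0) (φ ψ : Fin n → ℂ) :
    D.tr (D.laxT (-l⁻¹) φ ψ) = D.laxT l φ ψ := by
  have hl' : (l : ℂ) ≠ 0 := by exact_mod_cast hl
  simp only [laxT, cartan, map_add, map_sum, map_smul, map_sub, D.tr_E, negRoot_negRoot,
    D.tr_cartan _ (D.Hb _).2]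
  congr 1
  refine Finset.sum_congr rfl fun i _ => ?_
  congr 1
  push_cast
  rw [inv_neg, inv_inv]
  module

theorem tr_laxT' {l : ℝ} (hl : l ≠ 0) (φ ψ : Fin n → ℂ) :
    D.tr (D.laxT l φ ψ) = D.laxT (-l⁻¹) φ ψ := by
  rw [← D.tr_laxT hl, D.tr_tr]

end Generators
end RMatrix

/-! ### Generation is a Zariski open condition -/

section PolynomialCurves

/-- A curve in a vector space whose coordinates are polynomials in the parameter. -/
def IsPolyCurve {V : Type*} [AddCommGroup V] [Module ℂ V] (f : ℂ → V) : Prop :=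
  ∀ ξ : Module.Dual ℂ V, ∃ p : Polynomial ℂ, ∀ ε, ξ (f ε) = p.eval ε

namespace IsPolyCurve

variable {V : Type*} [AddCommGroup V] [Module ℂ V] {f f' : ℂ → V}

theorem const (v : V) : IsPolyCurve fun _ => v := fun ξ => ⟨Polynomial.C (ξ v), by simp⟩

theorem add (hf : IsPolyCurve f) (hf' : IsPolyCurve f') : IsPolyCurve fun ε => f ε + f' ε := by
  intro ξ
  obtain ⟨p, hp⟩ := hf ξ
  obtain ⟨q, hq⟩ := hf' ξ
  exact ⟨p + q, fun ε => by rw [map_add, hp, hq, Polynomial.eval_add]⟩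

theorem poly_smul (q : Polynomial ℂ) (hf : IsPolyCurve f) :
    IsPolyCurve fun ε => q.eval ε • f ε := by
  intro ξ
  obtain ⟨p, hp⟩ := hf ξ
  exact ⟨q * p, fun ε => by rw [map_smul, hp, Polynomial.eval_mul, smul_eq_mul]⟩

theorem pow_smul (k : ℕ) (v : V) : IsPolyCurve fun ε => ε ^ k • v := by
  simpa using (const v).poly_smul (Polynomial.X ^ k)

theorem prodMk {W : Type*} [AddCommGroup W] [Module ℂ W] {f₂ : ℂ → W}
    (hf : IsPolyCurve f) (hf₂ : IsPolyCurve f₂) : IsPolyCurve fun ε => (f ε, f₂ ε) := by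
  intro ξ
  obtain ⟨p, hp⟩ := hf (ξ ∘ₗ LinearMap.inl ℂ V W)
  obtain ⟨q, hq⟩ := hf₂ (ξ ∘ₗ LinearMap.inr ℂ V W)
  refine ⟨p + q, fun ε => ?_⟩
  rw [Polynomial.eval_add, ← hp, ← hq, LinearMap.comp_apply, LinearMap.comp_apply, ← map_add]
  simp

theorem lie {L : Type*} [LieRing L] [LieAlgebra ℂ L] [Module.Finite ℂ L] {f f' : ℂ → L}
    (hf : IsPolyCurve f) (hf' : IsPolyCurve f') : IsPolyCurve fun ε => ⁅f ε, f' ε⁆ := by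
  intro ξ
  let b := Module.finBasis ℂ L
  choose p hp using fun i => hf (b.coord i)
  choose q hq using fun i => hf' (b.coord i)
  refine ⟨∑ i, ∑ j, Polynomial.C (ξ ⁅b i, b j⁆) * (p i * q j), fun ε => ?_⟩
  change ξ ⁅f ε, f' ε⁆ = _
  conv_lhs => rw [← b.sum_repr (f ε), ← b.sum_repr (f' ε)]
  simp only [sum_lie, lie_sum, smul_lie, lie_smul, map_sum, map_smul,
    Polynomial.eval_finsetSum, Polynomial.eval_mul, Polynomial.eval_C, ← hp, ← hq,
    Module.Basis.coord_apply, smul_eq_mul]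
  simp only [Finset.mul_sum]
  rw [Finset.sum_comm]
  exact Finset.sum_congr rfl fun i _ => Finset.sum_congr rfl fun j _ => by ring

end IsPolyCurve

/-- Generation of a Lie algebra by a family which depends polynomially on a parameter is an open
condition in the Zariski topology, so it fails at most finitely often if it holds once. -/
theorem finite_lieSpan_ne_top {L ι : Type*} [LieRing L] [LieAlgebra ℂ L] [Module.Finite ℂ L]
    {p : ι → ℂ → L} (hp : ∀ j, IsPolyCurve (p j))
    (h0 : LieSubalgebra.lieSpan ℂ L (Set.range fun j => p j 0) = ⊤) :
    {ε | LieSubalgebra.lieSpan ℂ L (Set.range fun j => p j ε) ≠ ⊤}.Finite := by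
  classical
  -- The values at `0` of the polynomial curves in the generated subalgebras form a subalgebra, so
  -- that some such curve passes through any given element at `0`.
  have key : ∀ x : L, ∃ f : ℂ → L, IsPolyCurve f ∧ f 0 = x ∧
      ∀ ε, f ε ∈ LieSubalgebra.lieSpan ℂ L (Set.range fun j => p j ε) := by
    intro x
    have hx : x ∈ LieSubalgebra.lieSpan ℂ L (Set.range fun j => p j 0) := by rw [h0]; trivial
    induction hx using LieSubalgebra.lieSpan_induction with
    | mem y hy =>
      obtain ⟨j, rfl⟩ := hy
      exact ⟨p j, hp j, rfl, fun ε => LieSubalgebra.subset_lieSpan ⟨j, rfl⟩⟩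
    | zero => exact ⟨fun _ => 0, .const 0, rfl, fun ε => LieSubalgebra.zero_mem _⟩
    | add y z _ _ hy hz =>
      obtain ⟨f, hf, rfl, hf'⟩ := hy
      obtain ⟨f₂, hf₂, rfl, hf₂'⟩ := hz
      exact ⟨_, hf.add hf₂, rfl, fun ε => LieSubalgebra.add_mem _ (hf' ε) (hf₂' ε)⟩
    | smul a y _ hy =>
      obtain ⟨f, hf, rfl, hf'⟩ := hy
      refine ⟨fun ε => a • f ε, ?_, rfl, fun ε => LieSubalgebra.smul_mem _ a (hf' ε)⟩
      simpa using hf.poly_smul (Polynomial.C a)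
    | lie y z _ _ hy hz =>
      obtain ⟨f, hf, rfl, hf'⟩ := hy
      obtain ⟨f₂, hf₂, rfl, hf₂'⟩ := hz
      exact ⟨_, hf.lie hf₂, rfl, fun ε => LieSubalgebra.lie_mem _ (hf' ε) (hf₂' ε)⟩
  let b := Module.finBasis ℂ L
  -- Curves through a basis at `0` form a basis unless their determinant vanishes.
  choose f hf hf0 hfmem using fun i => key (b i)
  choose q hq using fun i j => hf j (b.coord i)
  let M : Matrix _ _ (Polynomial ℂ) := Matrix.of q
  have hdet : ∀ ε, M.det.eval ε = b.det fun j => f j ε := by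
    intro ε
    rw [Module.Basis.det_apply, ← Polynomial.coe_evalRingHom, RingHom.map_det]
    congr 1
    ext i j
    simp [M, ← hq, Module.Basis.toMatrix_apply]
  have hne : M.det ≠ 0 := by
    intro h
    have := hdet 0
    rw [h, Polynomial.eval_zero] at this
    simp only [hf0] at this
    rw [b.det_self] at this
    exact zero_ne_one this
  refine (Polynomial.finite_setOfPred_isRoot hne).subset fun ε hε => ?_
  by_contra hroot
  apply hε
  have hunit : IsUnit (b.det fun j => f j ε) := by
    rw [← hdet, isUnit_iff_ne_zero]
    exact hroot
  have hspan := ((Module.Basis.is_basis_iff_det b).mpr hunit).2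
  rw [eq_top_iff, ← LieSubalgebra.toSubmodule_le_toSubmodule, LieSubalgebra.top_toSubmodule,
    ← hspan, Submodule.span_le]
  rintro _ ⟨j, rfl⟩
  exact hfmem j ε

end PolynomialCurves

/-! ### Families generating `g × g` -/

section Pairs

variable {g : Type*} [LieRing g] [LieAlgebra ℂ g]

theorem exists_lie_ne_zero [LieAlgebra.IsSimple ℂ g] {ι : Type*} {e : ι → g}
    (he : LieSubalgebra.lieSpan ℂ g (Set.range e) = ⊤) {w : g} (hw : w ≠ 0) :
    ∃ j, ⁅e j, w⁆ ≠ 0 := by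
  by_contra! h
  have hc : w ∈ LieAlgebra.center ℂ g := by
    rw [LieModule.mem_maxTrivSubmodule]
    intro x
    have hx : x ∈ LieSubalgebra.lieSpan ℂ g (Set.range e) := he ▸ LieSubalgebra.mem_top x
    induction hx using LieSubalgebra.lieSpan_induction with
    | mem y hy => obtain ⟨j, rfl⟩ := hy; exact h j
    | zero => exact zero_lie w
    | add y z _ _ hy hz => rw [add_lie, hy, hz, add_zero]
    | smul a y _ hy => rw [smul_lie, hy, smul_zero]
    | lie y z _ _ hy hz => rw [lie_lie, hy, hz, lie_zero, lie_zero, sub_zero]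
  rw [LieAlgebra.center_eq_bot] at hc
  exact hw ((LieSubmodule.mem_bot _).mp hc)

theorem exists_mk_mem_lieSpan_of_left {ι : Type*} {u v : ι → g}
    (h : LieSubalgebra.lieSpan ℂ g (Set.range u) = ⊤) (x : g) :
    ∃ y, (x, y) ∈ LieSubalgebra.lieSpan ℂ (g × g) (Set.range fun j => (u j, v j)) := by
  have hx : x ∈ LieSubalgebra.lieSpan ℂ g (Set.range u) := h ▸ LieSubalgebra.mem_top x
  induction hx using LieSubalgebra.lieSpan_induction with
  | mem x hx => obtain ⟨j, rfl⟩ := hx; exact ⟨v j, LieSubalgebra.subset_lieSpan ⟨j, rfl⟩⟩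
  | zero => exact ⟨0, LieSubalgebra.zero_mem _⟩
  | add a b _ _ ha hb =>
    obtain ⟨y, hy⟩ := ha
    obtain ⟨z, hz⟩ := hb
    exact ⟨y + z, LieSubalgebra.add_mem _ hy hz⟩
  | smul c a _ ha =>
    obtain ⟨y, hy⟩ := ha
    exact ⟨c • y, LieSubalgebra.smul_mem _ c hy⟩
  | lie a b _ _ ha hb =>
    obtain ⟨y, hy⟩ := ha
    obtain ⟨z, hz⟩ := hb
    exact ⟨⁅y, z⁆, LieSubalgebra.lie_mem _ hy hz⟩

theorem exists_mk_mem_lieSpan_of_right {ι : Type*} {u v : ι → g}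
    (h : LieSubalgebra.lieSpan ℂ g (Set.range v) = ⊤) (y : g) :
    ∃ x, (x, y) ∈ LieSubalgebra.lieSpan ℂ (g × g) (Set.range fun j => (u j, v j)) := by
  have hy : y ∈ LieSubalgebra.lieSpan ℂ g (Set.range v) := h ▸ LieSubalgebra.mem_top y
  induction hy using LieSubalgebra.lieSpan_induction with
  | mem x hx => obtain ⟨j, rfl⟩ := hx; exact ⟨u j, LieSubalgebra.subset_lieSpan ⟨j, rfl⟩⟩
  | zero => exact ⟨0, LieSubalgebra.zero_mem _⟩
  | add a b _ _ ha hb =>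
    obtain ⟨y, hy⟩ := ha
    obtain ⟨z, hz⟩ := hb
    exact ⟨y + z, LieSubalgebra.add_mem _ hy hz⟩
  | smul c a _ ha =>
    obtain ⟨y, hy⟩ := ha
    exact ⟨c • y, LieSubalgebra.smul_mem _ c hy⟩
  | lie a b _ _ ha hb =>
    obtain ⟨y, hy⟩ := ha
    obtain ⟨z, hz⟩ := hb
    exact ⟨⁅y, z⁆, LieSubalgebra.lie_mem _ hy hz⟩

theorem lieSpan_smul_le {L ι : Type*} [LieRing L] [LieAlgebra ℂ L] (c : ℂ) (u : ι → L) :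
    LieSubalgebra.lieSpan ℂ L (Set.range fun j => c • u j)
      ≤ LieSubalgebra.lieSpan ℂ L (Set.range u) := by
  rw [LieSubalgebra.lieSpan_le]
  rintro _ ⟨j, rfl⟩
  exact LieSubalgebra.smul_mem _ c (LieSubalgebra.subset_lieSpan ⟨j, rfl⟩)

/-- Generators `e_j` of a simple Lie algebra have non-zero iterated brackets `w_k` of every length
`k`, and `(ν ^ k w_k, w_k)` lies in the algebra generated by the pairs `(ν e_j, e_j)`. A linear
dependence between the `w_k` yields an element `(x, 0)`, which is non-zero unless `ν` is a root of a
certain polynomial, and the ideal property of `g × 0` then gives everything. -/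
theorem finite_lieSpan_pair_ne_top [Module.Finite ℂ g] [LieAlgebra.IsSimple ℂ g] {ι : Type*}
    {e : ι → g}
    (he : LieSubalgebra.lieSpan ℂ g (Set.range e) = ⊤) :
    {ν : ℂ | ν ≠ 0 ∧
      LieSubalgebra.lieSpan ℂ (g × g) (Set.range fun j => (ν • e j, e j)) ≠ ⊤}.Finite := by
  have hword : ∀ k : ℕ, ∃ w : g, w ≠ 0 ∧ ∀ ν : ℂ, (ν ^ (k + 1) • w, w) ∈
      LieSubalgebra.lieSpan ℂ (g × g) (Set.range fun j => (ν • e j, e j)) := by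
    intro k
    induction k with
    | zero =>
      have : ∃ j, e j ≠ 0 := by
        by_contra! h
        obtain ⟨w, hw⟩ : ∃ w : g, w ≠ 0 := by
          by_contra! h0
          exact LieAlgebra.IsSimple.non_abelian ℂ (L := g) ⟨fun x m => h0 _⟩
        obtain ⟨j, hj⟩ := exists_lie_ne_zero he hw
        exact hj (by rw [h, zero_lie])
      obtain ⟨j, hj⟩ := this
      exact ⟨e j, hj, fun ν => LieSubalgebra.subset_lieSpan ⟨j, by simp⟩⟩
    | succ k ih =>
      obtain ⟨w, hw, hmem⟩ := ih
      obtain ⟨j, hj⟩ := exists_lie_ne_zero he hw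
      refine ⟨⁅e j, w⁆, hj, fun ν => ?_⟩
      have := LieSubalgebra.lie_mem _
        (LieSubalgebra.subset_lieSpan (R := ℂ) (s := Set.range fun j => (ν • e j, e j)) ⟨j, rfl⟩)
        (hmem ν)
      rw [LieAlgebra.Prod.bracket_apply] at this
      simpa [smul_lie, lie_smul, smul_smul, pow_succ, mul_comm, mul_assoc] using this
  choose w hw hmem using hword
  -- More iterated brackets than the dimension are linearly dependent; `q` is a coordinate of the
  -- first component of the corresponding combination of the pairs `(ν ^ (i + 1) w_i, w_i)`.
  obtain ⟨c, hc, i₀, hi₀⟩ : ∃ c : Fin (Module.finrank ℂ g + 1) → ℂ,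
      ∑ i, c i • w i = 0 ∧ ∃ i, c i ≠ 0 := by
    rw [← Fintype.not_linearIndependent_iff]
    intro h
    have := h.fintype_card_le_finrank
    simp at this
  obtain ⟨ξ, hξ⟩ : ∃ ξ : Module.Dual ℂ g, ξ (w i₀) ≠ 0 := by
    by_contra! h
    exact hw _ ((Module.forall_dual_apply_eq_zero_iff ℂ _).mp h)
  let q : Polynomial ℂ := ∑ i : Fin (Module.finrank ℂ g + 1),
    Polynomial.C (c i * ξ (w i)) * Polynomial.X ^ (i.1 + 1)
  have hq : q ≠ 0 := by
    intro h
    have := congrArg (fun p => p.coeff (i₀.1 + 1)) h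
    simp only [q, Polynomial.finsetSum_coeff, Polynomial.coeff_C_mul_X_pow,
      Polynomial.coeff_zero] at this
    rw [Finset.sum_eq_single i₀ (fun i _ hi => if_neg (by
      rw [add_left_inj]; exact fun h => hi (Fin.ext h.symm))) (by simp), if_pos rfl] at this
    exact mul_ne_zero hi₀ hξ this
  refine (Polynomial.finite_setOfPred_isRoot hq).subset fun ν hν => ?_
  obtain ⟨hν0, hν⟩ := hν
  by_contra hroot
  apply hν
  set M := LieSubalgebra.lieSpan ℂ (g × g) (Set.range fun j => (ν • e j, e j)) with hM
  set x := ∑ i, c i • ν ^ (i.1 + 1) • w i with hx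
  have hx0 : x ≠ 0 := by
    intro h
    apply hroot
    have := congrArg ξ h
    rw [hx, map_sum, map_zero] at this
    rw [Set.mem_ofPred_eq, Polynomial.IsRoot, Polynomial.eval_finsetSum, ← this]
    refine Finset.sum_congr rfl fun i _ => ?_
    simp
    ring
  have hxM : (x, (0 : g)) ∈ M := by
    have : (x, (0 : g)) = ∑ i, c i • (ν ^ (i.1 + 1) • w i, w i) := by
      rw [Prod.ext_iff]
      simp [Prod.fst_sum, Prod.snd_sum, hx, hc]
    rw [this]
    exact sum_mem fun i _ => M.smul_mem _ (hmem i ν)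
  have hνe : LieSubalgebra.lieSpan ℂ g (Set.range fun j => ν • e j) = ⊤ := by
    rw [eq_top_iff, ← he]
    have := lieSpan_smul_le ν⁻¹ fun j => ν • e j
    simpa [smul_smul, inv_mul_cancel₀ hν0] using this
  let I : LieIdeal ℂ g :=
    { carrier := {y | (y, (0 : g)) ∈ M}
      add_mem' := fun {a b} ha hb => by
        have := M.add_mem ha hb
        rwa [Prod.mk_add_mk, add_zero] at this
      zero_mem' := M.zero_mem
      smul_mem' := fun r a ha => by
        have := M.smul_mem r ha
        rwa [Prod.smul_mk, smul_zero] at this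
      lie_mem := fun {a b} hb => by
        obtain ⟨z, hz⟩ := exists_mk_mem_lieSpan_of_left (v := e) hνe a
        have := M.lie_mem hz hb
        rwa [LieAlgebra.Prod.bracket_apply, lie_zero] at this }
  have hI : I = ⊤ := by
    refine (LieAlgebra.IsSimple.eq_bot_or_eq_top I).resolve_left fun h => hx0 ?_
    have : x ∈ I := hxM
    rw [h] at this
    exact (LieSubmodule.mem_bot _).mp this
  rw [eq_top_iff]
  rintro ⟨a, b⟩ -
  obtain ⟨a', ha'⟩ := exists_mk_mem_lieSpan_of_right (u := fun j => ν • e j) he b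
  have h1 : a - a' ∈ I := hI ▸ LieSubmodule.mem_top _
  have h2 := M.add_mem h1 ha'
  rwa [Prod.mk_add_mk, zero_add, sub_add_cancel] at h2

end Pairs

/-! ### Boundary generators at generic spectral parameters -/

section BoundaryGenerators

variable {g : Type*} [LieRing g] [LieAlgebra ℂ g] [Module.Finite ℂ g] [LieAlgebra.IsSimple ℂ g]
variable {H : LieSubalgebra ℂ g} [H.IsCartanSubalgebra]

theorem exists_mem_notMem_of_mem_nhds {U : Set ℝ} {x : ℝ} (hU : U ∈ nhds x) {F : Set ℝ}
    (hF : F.Finite) : ∃ y ∈ U, y ∉ F :=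
  ((infinite_of_mem_nhds x hU).sdiff hF).nonempty

theorem abs_eq_one_of_zpow_eq_one {x : ℝ} {k : ℤ} (hk : k ≠ 0) (h : x ^ k = 1) : |x| = 1 := by
  have h1 : |x| ^ k = 1 := by rw [← abs_zpow, h, abs_one]
  by_contra hne
  exact hk ((zpow_eq_one_iff_right₀ (abs_nonneg x) hne).mp h1)

namespace Generators

variable {n : ℕ} (D : Generators g H n)

/-- The coideal generators `B_j(λ) = λ E_{α_j} - λ⁻¹ E_{-α_j} + a_j α_j · H`. -/
def bvec (a : D.Idx → ℂ) (l : ℝ) (j : D.Idx) : g :=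
  (l : ℂ) • D.E (D.aroot j) - (l : ℂ)⁻¹ • D.E (negRoot (D.aroot j))
    + a j • (D.rootH (D.aroot j) : g)

/-- The pairs `(B_j(λ₁), B_j(λ₂))` generate `g × g`. -/
def PairGen (a : D.Idx → ℂ) (l₁ l₂ : ℝ) : Prop :=
  LieSubalgebra.lieSpan ℂ (g × g) (Set.range fun j => (D.bvec a l₁ j, D.bvec a l₂ j)) = ⊤

/-- In the limit of large spectral parameters with fixed ratio `ν` the generators `B_j` degenerate
to the pairs `(ν E_{α_j}, E_{α_j})`. -/
theorem finite_not_pairGen (a : D.Idx → ℂ) {ν : ℝ} (hν0 : ν ≠ 0)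
    (hν : LieSubalgebra.lieSpan ℂ (g × g)
      (Set.range fun j : D.Idx => ((ν : ℂ) • D.E (D.aroot j), D.E (D.aroot j))) = ⊤) :
    {s : ℝ | s ≠ 0 ∧ ¬ D.PairGen a (ν * s) s}.Finite := by
  -- At `ε = s⁻¹` this is `s⁻¹` times the pair of generators, at `ε = 0` the degenerate pair.
  let p : D.Idx → ℂ → g × g := fun j ε =>
    ((ν : ℂ) • D.E (D.aroot j) + ε ^ 1 • a j • (D.rootH (D.aroot j) : g)
      + ε ^ 2 • (-((ν : ℂ)⁻¹ • D.E (negRoot (D.aroot j)))),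
     D.E (D.aroot j) + ε ^ 1 • a j • (D.rootH (D.aroot j) : g)
      + ε ^ 2 • (-D.E (negRoot (D.aroot j))))
  have hp : ∀ j, IsPolyCurve (p j) := fun j =>
    (((IsPolyCurve.const _).add (.pow_smul 1 _)).add (.pow_smul 2 _)).prodMk
      (((IsPolyCurve.const _).add (.pow_smul 1 _)).add (.pow_smul 2 _))
  have hfin := finite_lieSpan_ne_top hp (by simpa [p] using hν)
  have hinj : Set.InjOn (fun s : ℝ => ((s⁻¹ : ℝ) : ℂ)) ((fun s : ℝ => ((s⁻¹ : ℝ) : ℂ)) ⁻¹'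
      {ε | LieSubalgebra.lieSpan ℂ (g × g) (Set.range fun j => p j ε) ≠ ⊤}) := by
    intro s _ s' _ h
    exact inv_injective (Complex.ofReal_injective h)
  refine (hfin.preimage hinj).subset fun s hs => ?_
  obtain ⟨hs0, hs⟩ := hs
  intro htop
  apply hs
  have hsc : (s : ℂ) ≠ 0 := by exact_mod_cast hs0
  have hνc : (ν : ℂ) ≠ 0 := by exact_mod_cast hν0
  rw [PairGen, eq_top_iff, ← htop]
  have heq : ∀ j, p j ((s⁻¹ : ℝ) : ℂ) = (s : ℂ)⁻¹ • (D.bvec a (ν * s) j, D.bvec a s j) := by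
    intro j
    simp only [p, bvec, Prod.smul_mk, Prod.mk.injEq, smul_add, smul_sub, smul_smul]
    push_cast
    constructor
    · rw [show (s : ℂ)⁻¹ * (ν * s) = ν by field_simp, mul_inv, pow_one, pow_two]
      module
    · rw [inv_mul_cancel₀ hsc, pow_one, pow_two]
      module
  simp only [heq]
  exact lieSpan_smul_le _ _

/-- Arbitrarily close to any pair of spectral parameters there are pairs for which the `r`-matrices
are regular and the generators `B_j` are generic. -/
theorem exists_regular {l₁ l₂ : ℝ} (h₂ : l₂ ≠ 0) {O : Set (ℝ × ℝ)}
    (hO : O ∈ nhds (l₁, l₂)) (a : D.Idx → ℂ) :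
    ∃ m₁ m₂ : ℝ, (m₁, m₂) ∈ O ∧ m₁ ≠ 0 ∧ m₂ ≠ 0 ∧ (m₁ / m₂) ^ D.cox ≠ 1 ∧
      (m₁ * m₂) ^ D.cox ≠ 1 ∧ D.PairGen a m₁ m₂ ∧ D.PairGen (-a) m₁ m₂ := by
  have hcox : D.cox ≠ 0 := by have := D.two_le_cox; lia
  -- The parameters are `(ν s, s)`; first `ν` and then `s` has to avoid a finite set.
  have hcont : ContinuousAt (fun p : ℝ × ℝ => (p.1 * p.2, p.2)) (l₁ / l₂, l₂) := by fun_prop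
  have hO' : (fun p : ℝ × ℝ => (p.1 * p.2, p.2)) ⁻¹' O ∈ nhds (l₁ / l₂, l₂) := by
    apply hcont.preimage_mem_nhds
    simpa [div_mul_cancel₀ _ h₂] using hO
  rw [nhds_prod_eq, Filter.mem_prod_iff] at hO'
  obtain ⟨U, hU, V, hV, hUV⟩ := hO'
  have hF := D.lieSpan_aroot_eq_top
  have hF1 : {ν : ℝ | (ν : ℂ) ≠ 0 ∧ LieSubalgebra.lieSpan ℂ (g × g) (Set.range fun j : D.Idx =>
      ((ν : ℂ) • D.E (D.aroot j), D.E (D.aroot j))) ≠ ⊤}.Finite :=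
    (finite_lieSpan_pair_ne_top hF).preimage Complex.ofReal_injective.injOn
  obtain ⟨ν, hνU, hν⟩ := exists_mem_notMem_of_mem_nhds hU
    (hF1.union (Set.toFinite ({0, 1, -1} : Set ℝ)))
  simp only [Set.mem_union, Set.mem_insert_iff, Set.mem_singleton_iff, not_or] at hν
  obtain ⟨hν1, hν0, hν2, hν3⟩ := hν
  have hgen : LieSubalgebra.lieSpan ℂ (g × g) (Set.range fun j : D.Idx =>
      ((ν : ℂ) • D.E (D.aroot j), D.E (D.aroot j))) = ⊤ := by
    by_contra h
    exact hν1 ⟨by exact_mod_cast hν0, h⟩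
  have hF2 : {s : ℝ | |ν * s * s| = 1}.Finite := by
    refine (Set.toFinite ({√|ν|⁻¹, -√|ν|⁻¹} : Set ℝ)).subset fun s hs => ?_
    have h3 : s ^ 2 = |ν|⁻¹ := by
      have hs' : |ν * s * s| = 1 := hs
      rw [mul_assoc, abs_mul, ← pow_two, abs_of_nonneg (sq_nonneg s)] at hs'
      exact eq_inv_of_mul_eq_one_right hs'
    have h4 : |s| = √|ν|⁻¹ := by rw [← h3, Real.sqrt_sq_eq_abs]
    rcases abs_choice s with h5 | h5
    · left; rw [← h4, h5]
    · right; rw [Set.mem_singleton_iff, ← h4, h5, neg_neg]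
  obtain ⟨s, hsV, hs⟩ := exists_mem_notMem_of_mem_nhds hV
    (((D.finite_not_pairGen a hν0 hgen).union (D.finite_not_pairGen (-a) hν0 hgen)).union
      (hF2.union (Set.finite_singleton 0)))
  simp only [Set.mem_union, Set.mem_singleton_iff, not_or] at hs
  obtain ⟨⟨hs1, hs2⟩, hs3, hs0⟩ := hs
  have hmem : (ν, s) ∈ U ×ˢ V := ⟨hνU, hsV⟩
  refine ⟨ν * s, s, hUV hmem, mul_ne_zero hν0 hs0, hs0, ?_, ?_, ?_, ?_⟩
  · rw [mul_div_cancel_right₀ _ hs0]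
    intro h
    rcases (abs_eq one_pos.le).mp (abs_eq_one_of_zpow_eq_one hcox h) with h | h
    · exact hν2 h
    · exact hν3 h
  · exact fun h => hs3 (abs_eq_one_of_zpow_eq_one hcox h)
  · by_contra h; exact hs1 ⟨hs0, h⟩
  · by_contra h; exact hs2 ⟨hs0, h⟩

end Generators

end BoundaryGenerators

/-! ### The Durham condition and the coideal property -/

section BoundaryAlgebra

variable {g : Type*} [LieRing g] [LieAlgebra ℂ g] [Module.Finite ℂ g] [LieAlgebra.IsSimple ℂ g]
variable {H : LieSubalgebra ℂ g} [H.IsCartanSubalgebra]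

namespace Generators

variable {n : ℕ} (D : Generators g H n)

theorem eta_mul_rootSq_pos (i : D.Idx) : 0 < (D.eta i : ℝ) * rootSq D.Hb (D.aroot i) :=
  mul_pos (by exact_mod_cast D.eta_pos i) (D.rootSq_pos _)

theorem coeff_pos (i : D.Idx) : 0 < D.coeff i :=
  Real.sqrt_pos.mpr (div_pos (D.eta_mul_rootSq_pos i) (by norm_num))

theorem coeff_sq (i : D.Idx) : (D.coeff i) ^ 2 = D.eta i * rootSq D.Hb (D.aroot i) / 8 :=
  Real.sq_sqrt (div_pos (D.eta_mul_rootSq_pos i) (by norm_num)).le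

/-- The normalisations of the Durham condition and of the Lax connection differ by `2 / α_i²`. -/
theorem half_sqrt_eq (i : D.Idx) :
    Real.sqrt (2 * D.eta i / rootSq D.Hb (D.aroot i)) / 2
      = D.coeff i * (2 / rootSq D.Hb (D.aroot i)) := by
  have hq := D.rootSq_pos (D.aroot i)
  set q := rootSq D.Hb (D.aroot i)
  have h1 : (D.eta i : ℝ) * q / 8 = 2 * D.eta i / q * (q / 4) ^ 2 := by
    field_simp
    ring
  have h2 : D.coeff i = Real.sqrt (2 * D.eta i / q) * (q / 4) := by
    rw [coeff, h1, Real.sqrt_mul' _ (sq_nonneg _), Real.sqrt_sq (by positivity)]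
  rw [h2]
  field_simp
  ring

/-- The exponential weight `√(η_i α_i² / 8) e^{α_i · φ / 2}` of the `i`-th root vector. -/
def weight (i : D.Idx) (φ : Fin n → ℂ) : ℂ := (D.coeff i : ℂ) * Complex.exp (D.adot i φ / 2)

/-- The coefficients of `α_j · H` in the boundary generators for the Durham condition with
coefficients `A_j`. -/
def bcoef (A : D.Idx → ℂ) (j : D.Idx) : ℂ := A j * (2 / (rootSq D.Hb (D.aroot j) : ℂ))

theorem laxT_durham (A : D.Idx → ℂ) (l : ℝ) (φ : Fin n → ℂ) :
    D.laxT l φ (D.durham A φ) = ∑ j, D.weight j φ • D.bvec (D.bcoef A) l j := by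
  have h1 : D.cartan (D.durham A φ) = ∑ j : D.Idx,
      (A j * (Real.sqrt (2 * D.eta j / rootSq D.Hb (D.aroot j)) : ℂ) *
        Complex.exp (D.adot j φ / 2)) • (D.rootH (D.aroot j) : g) := by
    simp only [cartan, durham, ← cartan_rootVec, Finset.sum_smul, Finset.smul_sum, smul_smul]
    rw [Finset.sum_comm]
    refine Finset.sum_congr rfl fun j _ => Finset.sum_congr rfl fun a _ => ?_
    congr 1
    ring
  rw [laxT, h1, Finset.smul_sum, ← Finset.sum_add_distrib]
  refine Finset.sum_congr rfl fun j _ => ?_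
  have h2 : ((Real.sqrt (2 * D.eta j / rootSq D.Hb (D.aroot j)) : ℝ) : ℂ)
      = 2 * (D.coeff j * (2 / rootSq D.Hb (D.aroot j))) := by
    have := D.half_sqrt_eq j
    rw [div_eq_iff two_ne_zero] at this
    rw [this]
    push_cast
    ring
  rw [h2, weight, bvec, bcoef]
  module

/-- Transposition and inversion of the spectral parameter map the boundary generators, up to sign,
to those with opposite coefficients. -/
theorem tr_bvec (a : D.Idx → ℂ) {l : ℝ} (j : D.Idx) :
    D.tr (D.bvec a l⁻¹ j) = -D.bvec (-a) l j := by
  simp only [bvec, map_add, map_sub, map_smul, D.tr_E, negRoot_negRoot, tr_rootH,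
    Complex.ofReal_inv, inv_inv, Pi.neg_apply]
  module

theorem adot_eq (i : D.Idx) (φ : Fin n → ℂ) :
    D.adot i φ = (rootSystem H).root (D.aroot i) (∑ a, φ a • D.Hb a) := by
  simp [adot, rootVec, mul_comm]

/-- The character `φ ↦ e^{α_i · φ / 2}` of the additive group of field values. -/
def expChar (i : D.Idx) : Multiplicative (Fin n → ℂ) →* ℂ where
  toFun φ := Complex.exp (D.adot i φ.toAdd / 2)
  map_one' := by simp [adot]
  map_mul' φ ψ := by
    rw [← Complex.exp_add]
    congr 1
    simp [adot, mul_add, Finset.sum_add_distrib, add_div]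

/-- Distinct roots give distinct characters. -/
theorem expChar_injective : Function.Injective D.expChar := by
  intro i j h
  apply D.aroot_injective
  apply (rootSystem H).root.injective
  have key : ∀ φ, D.adot i φ = D.adot j φ := by
    intro φ
    by_contra hne
    have hd : D.adot i φ - D.adot j φ ≠ 0 := sub_ne_zero.mpr hne
    -- Rescaling the field makes the difference of the two exponents equal to one.
    have h1 := DFunLike.congr_fun h
      (Multiplicative.ofAdd ((2 / (D.adot i φ - D.adot j φ)) • φ))
    have hs : ∀ k (c : ℂ), D.adot k (c • φ) = c * D.adot k φ := fun k c => by
      simp [adot, Finset.mul_sum, mul_left_comm]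
    have h2 : Complex.exp (D.adot i ((2 / (D.adot i φ - D.adot j φ)) • φ) / 2)
        = Complex.exp (D.adot j ((2 / (D.adot i φ - D.adot j φ)) • φ) / 2) := h1
    rw [hs, hs, ← div_eq_one_iff_eq (Complex.exp_ne_zero _), ← Complex.exp_sub] at h2
    have h3 : 2 / (D.adot i φ - D.adot j φ) * D.adot i φ / 2
        - 2 / (D.adot i φ - D.adot j φ) * D.adot j φ / 2 = ((1 : ℝ) : ℂ) := by
      push_cast
      field_simp
    rw [h3, ← Complex.ofReal_exp] at h2
    have h4 : Real.exp 1 = 1 := by exact_mod_cast h2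
    simp at h4
  refine D.Hb.ext fun a => ?_
  have := key (Pi.single a 1)
  rw [adot_eq, adot_eq] at this
  simpa [Pi.single_apply] using this

/-- The boundary generators span a coideal: their cobracket lies in `B ⊗ g + g ⊗ B`. -/
theorem act_bvec_rMatrix (a : D.Idx → ℂ) {l₁ l₂ : ℝ} (h₁ : l₁ ≠ 0) (h₂ : l₂ ≠ 0)
    (hl : (l₁ / l₂) ^ D.cox ≠ 1) (j : D.Idx) :
    act (D.bvec a l₁ j) (D.bvec a l₂ j) (D.rMatrix (l₁ / l₂))
      = (D.rootH (D.aroot j) : g) ⊗ₜ D.bvec a l₂ j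
        - D.bvec a l₁ j ⊗ₜ (D.rootH (D.aroot j) : g) := by
  have hl' : ((l₁ / l₂ : ℝ) : ℂ) ^ D.cox ≠ 1 := by exact_mod_cast hl
  have h3 := act_neg ((l₁ : ℂ)⁻¹ • D.E (negRoot (D.aroot j)))
    ((l₂ : ℂ)⁻¹ • D.E (negRoot (D.aroot j)))
  rw [bvec, bvec, act_add, sub_eq_add_neg, sub_eq_add_neg, act_add, act_smul (a j), h3]
  simp only [LinearMap.add_apply, LinearMap.neg_apply, LinearMap.smul_apply,
    D.act_E_rMatrix h₁ h₂ hl' j, D.act_E_negRoot_rMatrix h₁ h₂ hl j, D.act_cartan_rMatrix,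
    TensorProduct.tmul_add, TensorProduct.add_tmul, TensorProduct.neg_tmul,
    TensorProduct.tmul_neg, TensorProduct.smul_tmul', TensorProduct.tmul_smul]
  module

/-- The coideal property for the partially transposed `r`-matrix, where the second factor carries
the boundary generators with opposite coefficients. -/
theorem act_bvec_tr2_rMatrix (a : D.Idx → ℂ) {l₁ l₂ : ℝ} (h₁ : l₁ ≠ 0) (h₂ : l₂ ≠ 0)
    (hl : (l₁ * l₂) ^ D.cox ≠ 1) (j : D.Idx) :
    act (D.bvec a l₁ j) (D.bvec (-a) l₂ j) (D.tr2 (D.rMatrix (l₁ * l₂)))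
      = -((D.rootH (D.aroot j) : g) ⊗ₜ D.bvec (-a) l₂ j)
        - D.bvec a l₁ j ⊗ₜ (D.rootH (D.aroot j) : g) := by
  have h := congrArg D.tr2 (D.act_bvec_rMatrix a h₁ (inv_ne_zero h₂) (by rwa [div_inv_eq_mul]) j)
  rw [tr2_act, div_inv_eq_mul, tr_bvec, neg_neg, map_sub, tr2_tmul, tr2_tmul, tr_bvec, tr_rootH,
    TensorProduct.tmul_neg] at h
  exact h

/-- At generic spectral parameters only zero is invariant under the boundary generators. -/
theorem eq_zero_of_pairGen {a : D.Idx → ℂ} {l₁ l₂ : ℝ} (hgen : D.PairGen a l₁ l₂)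
    {s : g ⊗[ℂ] g} (hs : ∀ j, act (D.bvec a l₁ j) (D.bvec a l₂ j) s = 0) : s = 0 := by
  have key : ∀ p : g × g, act p.1 p.2 s = 0 := by
    intro p
    have hp : p ∈ LieSubalgebra.lieSpan ℂ (g × g)
        (Set.range fun j => (D.bvec a l₁ j, D.bvec a l₂ j)) := by
      rw [PairGen] at hgen; rw [hgen]; trivial
    induction hp using LieSubalgebra.lieSpan_induction with
    | mem y hy => obtain ⟨j, rfl⟩ := hy; exact hs j
    | zero => rw [Prod.fst_zero, Prod.snd_zero, act_zero, LinearMap.zero_apply]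
    | add y z _ _ hy hz =>
      rw [Prod.fst_add, Prod.snd_add, act_add, LinearMap.add_apply, hy, hz, add_zero]
    | smul c y _ hy =>
      rw [Prod.smul_fst, Prod.smul_snd, act_smul, LinearMap.smul_apply, hy, smul_zero]
    | lie y z _ _ hy hz =>
      rw [LieAlgebra.Prod.bracket_apply, act_lie, hy, hz, map_zero, map_zero, sub_zero]
  exact eq_zero_of_act_left D fun y => key (y, 0)

theorem lieSpan_bvec_left {a : D.Idx → ℂ} {l₁ l₂ : ℝ} (hgen : D.PairGen a l₁ l₂) :
    LieSubalgebra.lieSpan ℂ g (Set.range (D.bvec a l₁)) = ⊤ := by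
  rw [eq_top_iff]
  rintro x -
  have hx : (x, (0 : g)) ∈ LieSubalgebra.lieSpan ℂ (g × g)
      (Set.range fun j => (D.bvec a l₁ j, D.bvec a l₂ j)) := by
    rw [PairGen] at hgen; rw [hgen]; trivial
  have := (LieSubalgebra.mem_map (LieHom.fst ℂ g g) _ x).mpr ⟨_, hx, rfl⟩
  rw [LieSubalgebra.map_lieSpan, ← Set.range_comp] at this
  exact this

theorem lieSpan_bvec_right {a : D.Idx → ℂ} {l₁ l₂ : ℝ} (hgen : D.PairGen a l₁ l₂) :
    LieSubalgebra.lieSpan ℂ g (Set.range (D.bvec a l₂)) = ⊤ := by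
  rw [eq_top_iff]
  rintro x -
  have hx : ((0 : g), x) ∈ LieSubalgebra.lieSpan ℂ (g × g)
      (Set.range fun j => (D.bvec a l₁ j, D.bvec a l₂ j)) := by
    rw [PairGen] at hgen; rw [hgen]; trivial
  have := (LieSubalgebra.mem_map (LieHom.snd ℂ g g) _ x).mpr ⟨_, hx, rfl⟩
  rw [LieSubalgebra.map_lieSpan, ← Set.range_comp] at this
  exact this

end Generators

end BoundaryAlgebra

/-! ### Intertwiners of a matrix representation -/

section Representations

attribute [local instance 100] LieRing.ofAssociativeRing

variable {g : Type*} [LieRing g] [LieAlgebra ℂ g]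
variable {m : Type*} [Fintype m] [DecidableEq m] (ρ : MatrixRep g m)

@[simp]
theorem rep2_tmul (x y : g) : rep2 ρ (x ⊗ₜ y) = ρ x ⊗ₖ ρ y := by
  rw [rep2, TensorProduct.lift.tmul]
  rfl

theorem rho_lie (x y : g) : ρ ⁅x, y⁆ = ρ x * ρ y - ρ y * ρ x := by
  rw [LieHom.map_lie, Ring.lie_def]

theorem leg1_mul_leg2 (K L : Matrix m m ℂ) : leg1 K * leg2 L = K ⊗ₖ L := by
  rw [leg1, leg2, ← Matrix.mul_kronecker_mul, mul_one, one_mul]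

theorem leg2_mul_leg1 (K L : Matrix m m ℂ) : leg2 L * leg1 K = K ⊗ₖ L := by
  rw [leg1, leg2, ← Matrix.mul_kronecker_mul, mul_one, one_mul]

theorem leg1_mul_rep2 {K : Matrix m m ℂ} {ω : g →ₗ[ℂ] g} (h : ∀ x, K * ρ x = ρ (ω x) * K)
    (s : g ⊗[ℂ] g) :
    leg1 K * rep2 ρ s = rep2 ρ (TensorProduct.map ω LinearMap.id s) * leg1 K := by
  induction s using TensorProduct.induction_on with
  | zero => simp
  | tmul a b => simp [leg1, ← Matrix.mul_kronecker_mul, h]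
  | add a b ha hb => simp only [map_add, mul_add, add_mul, ha, hb]

theorem leg2_mul_rep2 {K : Matrix m m ℂ} {ω : g →ₗ[ℂ] g} (h : ∀ x, K * ρ x = ρ (ω x) * K)
    (s : g ⊗[ℂ] g) :
    leg2 K * rep2 ρ s = rep2 ρ (TensorProduct.map LinearMap.id ω s) * leg2 K := by
  induction s using TensorProduct.induction_on with
  | zero => simp
  | tmul a b => simp [leg2, ← Matrix.mul_kronecker_mul, h]
  | add a b ha hb => simp only [map_add, mul_add, add_mul, ha, hb]

theorem leg1_mul_rep2_eq_zero {K : Matrix m m ℂ} (h : ∀ x, K * ρ x = 0) (s : g ⊗[ℂ] g) :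
    leg1 K * rep2 ρ s = 0 := by
  rw [leg1_mul_rep2 ρ (ω := 0) (by simpa using h)]
  simp

theorem leg2_mul_rep2_eq_zero {K : Matrix m m ℂ} (h : ∀ x, K * ρ x = 0) (s : g ⊗[ℂ] g) :
    leg2 K * rep2 ρ s = 0 := by
  rw [leg2_mul_rep2 ρ (ω := 0) (by simpa using h)]
  simp

theorem rep2_mul_leg1_eq_zero {K : Matrix m m ℂ} (h : ∀ x, ρ x * K = 0) (s : g ⊗[ℂ] g) :
    rep2 ρ s * leg1 K = 0 := by
  induction s using TensorProduct.induction_on with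
  | zero => simp
  | tmul a b => simp [leg1, ← Matrix.mul_kronecker_mul, h]
  | add a b ha hb => rw [map_add, add_mul, ha, hb, add_zero]

theorem rep2_mul_leg2_eq_zero {K : Matrix m m ℂ} (h : ∀ x, ρ x * K = 0) (s : g ⊗[ℂ] g) :
    rep2 ρ s * leg2 K = 0 := by
  induction s using TensorProduct.induction_on with
  | zero => simp
  | tmul a b => simp [leg2, ← Matrix.mul_kronecker_mul, h]
  | add a b ha hb => rw [map_add, add_mul, ha, hb, add_zero]

/-- A matrix which intertwines two generating families of a simple Lie algebra either annihilates
the representation, or intertwines it with its twist by an endomorphism of the Lie algebra. -/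
theorem exists_twist_of_intertwines [LieAlgebra.IsSimple ℂ g] {ι : Type*} {u v : ι → g}
    (hu : LieSubalgebra.lieSpan ℂ g (Set.range u) = ⊤)
    (hv : LieSubalgebra.lieSpan ℂ g (Set.range v) = ⊤) {K : Matrix m m ℂ}
    (hK : ∀ j, K * ρ (u j) = ρ (v j) * K) :
    (∀ x, K * ρ x = 0 ∧ ρ x * K = 0) ∨ ∃ ω : g →ₗ[ℂ] g, (∀ x, K * ρ x = ρ (ω x) * K) ∧
      (∀ x y, ω ⁅x, y⁆ = ⁅ω x, ω y⁆) ∧ ∀ j, ω (u j) = v j := by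
  have hmul : ∀ {x x' y y' : g}, K * ρ x = ρ y * K → K * ρ x' = ρ y' * K →
      K * ρ ⁅x, x'⁆ = ρ ⁅y, y'⁆ * K := by
    intro x x' y y' h h'
    rw [rho_lie, rho_lie, mul_sub, sub_mul, ← mul_assoc, h, mul_assoc, h', ← mul_assoc K, h',
      mul_assoc _ K, h, mul_assoc, mul_assoc]
  have hspan : ∀ p ∈ LieSubalgebra.lieSpan ℂ (g × g) (Set.range fun j => (u j, v j)),
      K * ρ p.1 = ρ p.2 * K := by
    intro p hp
    induction hp using LieSubalgebra.lieSpan_induction with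
    | mem y hy => obtain ⟨j, rfl⟩ := hy; exact hK j
    | zero => simp
    | add y z _ _ hy hz => simp [mul_add, add_mul, hy, hz]
    | smul c y _ hy => simp [hy]
    | lie y z _ _ hy hz => exact hmul hy hz
  have hl : ∀ x, ∃ y, K * ρ x = ρ y * K := fun x => by
    obtain ⟨y, hy⟩ := exists_mk_mem_lieSpan_of_left (v := v) hu x
    exact ⟨y, hspan _ hy⟩
  have hr : ∀ y, ∃ x, K * ρ x = ρ y * K := fun y => by
    obtain ⟨x, hx⟩ := exists_mk_mem_lieSpan_of_right (u := u) hv y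
    exact ⟨x, hspan _ hx⟩
  -- If this ideal is zero, then `y` is determined by `x` in `K ρ(x) = ρ(y) K`.
  let I : LieIdeal ℂ g :=
    { carrier := {y | ρ y * K = 0}
      add_mem' := fun {a b} (ha : _ = _) (hb : _ = _) => by
        rw [Set.mem_ofPred_eq, map_add, add_mul, ha, hb, add_zero]
      zero_mem' := by simp
      smul_mem' := fun r a (ha : _ = _) => by
        rw [Set.mem_ofPred_eq, map_smul, smul_mul_assoc, ha, smul_zero]
      lie_mem := fun {a b} (hb : ρ b * K = 0) => by
        change ρ ⁅a, b⁆ * K = 0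
        obtain ⟨z, hz⟩ := hr a
        rw [rho_lie, sub_mul, mul_assoc, hb, mul_assoc, ← hz, ← mul_assoc, hb, mul_zero, zero_mul,
          sub_zero] }
  rcases LieAlgebra.IsSimple.eq_bot_or_eq_top I with hI | hI
  · right
    have huniq : ∀ {y y'}, ρ y * K = ρ y' * K → y = y' := by
      intro y y' h
      have : y - y' ∈ I := by
        change ρ (y - y') * K = 0
        rw [map_sub, sub_mul, h, sub_self]
      rw [hI] at this
      exact sub_eq_zero.mp ((LieSubmodule.mem_bot _).mp this)
    choose ω hω using hl
    refine ⟨{ toFun := ω, map_add' := fun x y => huniq ?_, map_smul' := fun c x => huniq ?_ },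
      hω, fun x y => huniq ?_, fun j => huniq ?_⟩
    · rw [← hω, map_add, map_add, mul_add, add_mul, hω, hω]
    · rw [← hω, map_smul, RingHom.id_apply, map_smul, mul_smul_comm, hω, smul_mul_assoc]
    · exact (hω _).symm.trans (hmul (hω x) (hω y))
    · exact (hω _).symm.trans (hK j)
  · left
    have h0 : ∀ y, ρ y * K = 0 := fun y => by
      have : y ∈ I := hI ▸ LieSubmodule.mem_top y
      exact this
    intro x
    obtain ⟨y, hy⟩ := hl x
    exact ⟨by rw [hy, h0], h0 x⟩

end Representations

/-! ### From the boundary equation to the reflection equations -/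

section Legs

variable {m : Type*} [DecidableEq m]

theorem continuous_leg1 : Continuous (leg1 : Matrix m m ℂ → _) := by
  refine continuous_matrix fun i j => ?_
  simp only [leg1, Matrix.kroneckerMap_apply]
  fun_prop

theorem continuous_leg2 : Continuous (leg2 : Matrix m m ℂ → _) := by
  refine continuous_matrix fun i j => ?_
  simp only [leg2, Matrix.kroneckerMap_apply]
  fun_prop

end Legs

section Reflection

attribute [local instance 100] LieRing.ofAssociativeRing

variable {g : Type*} [LieRing g] [LieAlgebra ℂ g] [Module.Finite ℂ g] [LieAlgebra.IsSimple ℂ g]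
variable {H : LieSubalgebra ℂ g} [H.IsCartanSubalgebra]
variable {n : ℕ} (D : Generators g H n)
variable {m : Type*} [Fintype m] [DecidableEq m] (ρ : MatrixRep g m)

variable {D ρ} in
/-- The exponentials `e^{α_j · φ / 2}` are linearly independent characters, so the boundary
equation splits into one intertwining relation for each node of the extended Dynkin diagram. -/
theorem SolvesIbc.intertwines {A : D.Idx → ℂ} {Λ : Set ℝ} {K : ℝ → Matrix m m ℂ}
    (h : SolvesIbc D ρ A Λ K) {l : ℝ} (hl : l ∈ Λ) (j : D.Idx) :
    K l * ρ (D.bvec (D.bcoef A) l j) = ρ (D.bvec (-D.bcoef A) l j) * K l := by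
  set M : D.Idx → Matrix m m ℂ := fun j =>
    K l * ρ (D.bvec (D.bcoef A) l j) - ρ (D.bvec (-D.bcoef A) l j) * K l with hM
  have hsum : ∀ φ, ∑ j, D.weight j φ • M j = 0 := by
    intro φ
    have := h l hl φ
    rw [D.laxT_durham, D.laxT_durham] at this
    simp only [map_sum, map_smul, D.tr_bvec, map_neg, Finset.mul_sum, Finset.sum_mul,
      mul_smul_comm, smul_mul_assoc, neg_mul, smul_neg, ← Finset.sum_add_distrib] at this
    rw [← this]
    exact Finset.sum_congr rfl fun j _ => by
      simp only [hM, smul_sub]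
      exact sub_eq_add_neg _ _
  have hli := (linearIndependent_monoidHom (Multiplicative (Fin n → ℂ)) ℂ).comp _
    D.expChar_injective
  rw [Fintype.linearIndependent_iff] at hli
  rw [← sub_eq_zero]
  ext p q
  have h0 := hli (fun j => (D.coeff j : ℂ) * M j p q) (by
    funext φ
    have := congrFun (congrFun (hsum φ.toAdd) p) q
    rw [Matrix.sum_apply] at this
    simp only [Finset.sum_apply, Pi.smul_apply, Function.comp_apply, smul_eq_mul, Pi.zero_apply]
    rw [Matrix.zero_apply] at this
    rw [← this]
    refine Finset.sum_congr rfl fun j _ => ?_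
    change _ * M j p q * Complex.exp _ = _ * Complex.exp _ * M j p q
    ring) j
  exact (mul_eq_zero.mp h0).resolve_left (by exact_mod_cast (D.coeff_pos j).ne')

/-- The left-hand side of the reflection equation. -/
def reflExpr (l₁ l₂ : ℝ) (K L : Matrix m m ℂ) : Matrix (m × m) (m × m) ℂ :=
  leg1 K * leg2 L * rep2 ρ (D.rMatrix (l₁ / l₂))
    + rep2 ρ (D.tr12 (D.rMatrix (l₂ / l₁))) * leg1 K * leg2 L
    + leg1 K * rep2 ρ (D.tr2 (D.rMatrix (l₁ * l₂))) * leg2 L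
    + leg2 L * rep2 ρ (D.tr1 (D.rMatrix (l₁ * l₂)⁻¹)) * leg1 K

variable {D} in
theorem Generators.tr12_rMatrix_inv {l : ℝ} (hl0 : l ≠ 0) (hl : l ^ D.cox ≠ 1) :
    D.tr12 (D.rMatrix l⁻¹) = -D.rMatrix l := by
  rw [D.tr12_rMatrix (inv_ne_zero hl0) (by rwa [inv_zpow, ne_eq, inv_eq_one]), inv_inv]

variable {D} in
theorem Generators.rMatrix_inv {l : ℝ} (hl0 : l ≠ 0) (hl : l ^ D.cox ≠ 1) :
    D.rMatrix l⁻¹ = -D.tr12 (D.rMatrix l) := by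
  rw [D.tr12_rMatrix hl0 hl, neg_neg]

variable {D} in
/-- By `r^{t₁t₂}(λ) = -r(1/λ)` only `r(λ₁/λ₂)` and `r^{t₂}(λ₁λ₂)` occur in the reflection
equation. -/
theorem reflExpr_eq {l₁ l₂ : ℝ} (h₁ : l₁ ≠ 0) (h₂ : l₂ ≠ 0) (hd : (l₁ / l₂) ^ D.cox ≠ 1)
    (hm : (l₁ * l₂) ^ D.cox ≠ 1) (K L : Matrix m m ℂ) :
    reflExpr D ρ l₁ l₂ K L = leg1 K * leg2 L * rep2 ρ (D.rMatrix (l₁ / l₂))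
      - rep2 ρ (D.rMatrix (l₁ / l₂)) * leg1 K * leg2 L
      + leg1 K * rep2 ρ (D.tr2 (D.rMatrix (l₁ * l₂))) * leg2 L
      - leg2 L * rep2 ρ (D.tr2 (D.rMatrix (l₁ * l₂))) * leg1 K := by
  rw [reflExpr, ← inv_div l₁ l₂, Generators.tr12_rMatrix_inv (div_ne_zero h₁ h₂) hd,
    Generators.rMatrix_inv (mul_ne_zero h₁ h₂) hm]
  simp only [map_neg, D.tr1_tr12, neg_mul, mul_neg, sub_eq_add_neg]

theorem leg1_comm_leg2 (K L : Matrix m m ℂ) : leg2 L * leg1 K = leg1 K * leg2 L := by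
  rw [leg1_mul_leg2, leg2_mul_leg1]

/-- The reflection equation at generic spectral parameters: the boundary equation makes the
reflection defect invariant under a pair of generating families of `g`, hence zero. -/
theorem reflExpr_eq_zero_of_pairGen {a : D.Idx → ℂ} {l₁ l₂ : ℝ} (h₁ : l₁ ≠ 0) (h₂ : l₂ ≠ 0)
    (hd : (l₁ / l₂) ^ D.cox ≠ 1) (hm : (l₁ * l₂) ^ D.cox ≠ 1) (hg : D.PairGen a l₁ l₂)
    (hg' : D.PairGen (-a) l₁ l₂) {K L : Matrix m m ℂ}
    (hK : ∀ j, K * ρ (D.bvec a l₁ j) = ρ (D.bvec (-a) l₁ j) * K)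
    (hL : ∀ j, L * ρ (D.bvec a l₂ j) = ρ (D.bvec (-a) l₂ j) * L) :
    reflExpr D ρ l₁ l₂ K L = 0 := by
  rw [reflExpr_eq ρ h₁ h₂ hd hm]
  set r := D.rMatrix (l₁ / l₂) with hr
  set r' := D.tr2 (D.rMatrix (l₁ * l₂)) with hr'
  rcases exists_twist_of_intertwines ρ (D.lieSpan_bvec_left hg) (D.lieSpan_bvec_left hg') hK with
    h | ⟨ω₁, hω₁, hlie₁, hu₁⟩
  · rw [← leg1_comm_leg2, mul_assoc, leg1_mul_rep2_eq_zero ρ fun x => (h x).1,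
      rep2_mul_leg1_eq_zero ρ fun x => (h x).2, leg1_mul_rep2_eq_zero ρ fun x => (h x).1,
      mul_assoc, rep2_mul_leg1_eq_zero ρ fun x => (h x).2]
    simp
  rcases exists_twist_of_intertwines ρ (D.lieSpan_bvec_right hg) (D.lieSpan_bvec_right hg') hL with
    h | ⟨ω₂, hω₂, hlie₂, hu₂⟩
  · rw [mul_assoc, leg2_mul_rep2_eq_zero ρ fun x => (h x).1, mul_assoc, ← leg1_comm_leg2,
      ← mul_assoc (rep2 ρ r), rep2_mul_leg2_eq_zero ρ fun x => (h x).2, mul_assoc,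
      rep2_mul_leg2_eq_zero ρ fun x => (h x).2, leg2_mul_rep2_eq_zero ρ fun x => (h x).1]
    simp
  -- Moving `K` and `L` to the right through the twists turns the defect into `ρ(S) (K ⊗ L)`.
  set S := TensorProduct.map ω₁ ω₂ r - r + TensorProduct.map ω₁ LinearMap.id r'
    - TensorProduct.map LinearMap.id ω₂ r' with hS
  have hid : ∀ x y : g, (LinearMap.id : g →ₗ[ℂ] g) ⁅x, y⁆
    = ⁅(LinearMap.id : g →ₗ[ℂ] g) x, (LinearMap.id : g →ₗ[ℂ] g) y⁆ := fun _ _ => rfl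
  have hS0 : S = 0 := by
    refine D.eq_zero_of_pairGen hg' fun j => ?_
    have e1 := map_act hlie₁ hlie₂ (D.bvec a l₁ j) (D.bvec a l₂ j) r
    rw [D.act_bvec_rMatrix a h₁ h₂ hd, hu₁, hu₂, map_sub, TensorProduct.map_tmul,
      TensorProduct.map_tmul, hu₁, hu₂] at e1
    have e2 := D.act_bvec_rMatrix (-a) h₁ h₂ hd j
    have e3 := map_act hlie₁ hid (D.bvec a l₁ j) (D.bvec (-a) l₂ j) r'
    rw [D.act_bvec_tr2_rMatrix a h₁ h₂ hm, hu₁, map_sub, map_neg, TensorProduct.map_tmul,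
      TensorProduct.map_tmul, hu₁] at e3
    have e4 := map_act hid hlie₂ (D.bvec (-a) l₁ j) (D.bvec a l₂ j) r'
    have e5 := D.act_bvec_tr2_rMatrix (-a) h₁ h₂ hm j
    rw [neg_neg] at e5
    rw [e5, hu₂, map_sub, map_neg, TensorProduct.map_tmul, TensorProduct.map_tmul, hu₂] at e4
    simp only [LinearMap.id_coe, id_eq] at e3 e4
    rw [hS, map_sub, map_add, map_sub, e1, e2, e3, e4]
    abel
  have f1 : leg1 K * leg2 L * rep2 ρ r
      = rep2 ρ (TensorProduct.map ω₁ ω₂ r) * (leg1 K * leg2 L) := by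
    rw [mul_assoc, leg2_mul_rep2 ρ hω₂, ← mul_assoc, leg1_mul_rep2 ρ hω₁, mul_assoc,
      TensorProduct.map_map, LinearMap.comp_id, LinearMap.id_comp]
  rw [f1, leg1_mul_rep2 ρ hω₁, leg2_mul_rep2 ρ hω₂, mul_assoc (rep2 ρ r), mul_assoc (rep2 ρ _),
    mul_assoc (rep2 ρ _) (leg2 L), leg1_comm_leg2, ← sub_mul, ← add_mul, ← sub_mul, ← map_sub,
    ← map_add, ← map_sub, ← hS, hS0, map_zero, zero_mul]

/-- Continuity of the `r`-matrix where it is regular, expressed through linear images because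
`g ⊗ g` carries no topology. -/
theorem Generators.continuousAt_rMatrix {W : Type*} [AddCommGroup W] [Module ℂ W]
    [TopologicalSpace W] [IsTopologicalAddGroup W] [ContinuousSMul ℂ W] (f : g ⊗[ℂ] g →ₗ[ℂ] W)
    {l : ℝ} (hl0 : l ≠ 0) (hl : l ^ D.cox ≠ 1) :
    ContinuousAt (fun x => f (D.rMatrix x)) l := by
  have hz : ∀ k : ℤ, ContinuousAt (fun x : ℝ => (x : ℂ) ^ k) l := fun k =>
    ContinuousAt.zpow₀ Complex.continuous_ofReal.continuousAt k
      (Or.inl (by exact_mod_cast hl0))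
  have hlc : (l : ℂ) ^ D.cox ≠ 1 := by exact_mod_cast hl
  have hlc' : (l : ℂ) ^ (-D.cox) ≠ 1 := by rwa [zpow_neg, ne_eq, inv_eq_one]
  simp only [rMatrix, map_add, map_sub, map_smul, map_sum]
  refine ((ContinuousAt.smul ?_ continuousAt_const).sub (ContinuousAt.smul ?_ ?_)).add
    (ContinuousAt.smul ?_ ?_)
  · exact ((hz _).add continuousAt_const).div ((hz _).sub continuousAt_const) (sub_ne_zero.mpr hlc)
  · exact continuousAt_const.div (continuousAt_const.sub (hz _)) (sub_ne_zero.mpr hlc.symm)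
  · exact tendsto_finsetSum _ fun α _ => (continuousAt_const.mul (hz _)).smul continuousAt_const
  · exact continuousAt_const.div (continuousAt_const.sub (hz _)) (sub_ne_zero.mpr hlc'.symm)
  · exact tendsto_finsetSum _ fun α _ => (continuousAt_const.mul (hz _)).smul continuousAt_const

theorem continuousAt_reflExpr {K : ℝ → Matrix m m ℂ} {l₁ l₂ : ℝ} (h₁ : l₁ ≠ 0) (h₂ : l₂ ≠ 0)
    (hd : (l₁ / l₂) ^ D.cox ≠ 1) (hm : (l₁ * l₂) ^ D.cox ≠ 1) (hK₁ : ContinuousAt K l₁)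
    (hK₂ : ContinuousAt K l₂) :
    ContinuousAt (fun p : ℝ × ℝ => reflExpr D ρ p.1 p.2 (K p.1) (K p.2)) (l₁, l₂) := by
  have c1 : ContinuousAt (fun p : ℝ × ℝ => leg1 (K p.1)) (l₁, l₂) :=
    continuous_leg1.continuousAt.comp (ContinuousAt.comp (f := Prod.fst) hK₁ continuousAt_fst)
  have c2 : ContinuousAt (fun p : ℝ × ℝ => leg2 (K p.2)) (l₁, l₂) :=
    continuous_leg2.continuousAt.comp (ContinuousAt.comp (f := Prod.snd) hK₂ continuousAt_snd)
  have hr : ∀ (f : g ⊗[ℂ] g →ₗ[ℂ] g ⊗[ℂ] g) (u : ℝ × ℝ → ℝ), ContinuousAt u (l₁, l₂) →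
      u (l₁, l₂) ≠ 0 → u (l₁, l₂) ^ D.cox ≠ 1 →
      ContinuousAt (fun p => rep2 ρ (f (D.rMatrix (u p)))) (l₁, l₂) := fun f u hu h0 hc =>
    ContinuousAt.comp (f := u) (D.continuousAt_rMatrix (rep2 ρ ∘ₗ f) h0 hc) hu
  have hfst : ContinuousAt (Prod.fst : ℝ × ℝ → ℝ) (l₁, l₂) := continuousAt_fst
  have hsnd : ContinuousAt (Prod.snd : ℝ × ℝ → ℝ) (l₁, l₂) := continuousAt_snd
  have hinv : ∀ {x : ℝ}, x ^ D.cox ≠ 1 → x⁻¹ ^ D.cox ≠ 1 := fun h => by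
    rwa [inv_zpow, ne_eq, inv_eq_one]
  unfold reflExpr
  refine ((((c1.mul c2).mul (hr LinearMap.id (fun p => p.1 / p.2) (hfst.div hsnd h₂)
    (div_ne_zero h₁ h₂) hd)).add (((hr D.tr12 (fun p => p.2 / p.1) (hsnd.div hfst h₁)
    (div_ne_zero h₂ h₁) ?_).mul c1).mul c2)).add ((c1.mul (hr D.tr2 (fun p => p.1 * p.2)
    (hfst.mul hsnd) (mul_ne_zero h₁ h₂) hm)).mul c2)).add ((c2.mul (hr D.tr1
    (fun p => (p.1 * p.2)⁻¹) ((hfst.mul hsnd).inv₀ (mul_ne_zero h₁ h₂))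
    (inv_ne_zero (mul_ne_zero h₁ h₂)) (hinv hm))).mul c1)
  have := hinv hd
  rwa [inv_div] at this

variable {D ρ} in
/-- The boundary equation implies the reflection equation: if the defect were non-zero at some
regular parameters, it would be so in a neighbourhood, which contains generic parameters. -/
theorem SolvesIbc.solvesRefl {A : D.Idx → ℂ} {Λ : Set ℝ} {K : ℝ → Matrix m m ℂ} (h0 : 0 ∉ Λ)
    (hΛ : IsOpen Λ) (hK : ContinuousOn K Λ) (h : SolvesIbc D ρ A Λ K) : SolvesRefl D ρ Λ K := by
  intro l₁ hl₁ l₂ hl₂ hd hm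
  have hne : ∀ {l}, l ∈ Λ → l ≠ 0 := fun hl hz => h0 (hz ▸ hl)
  have hcont := continuousAt_reflExpr D ρ (hne hl₁) (hne hl₂) hd hm
    (hK.continuousAt (hΛ.mem_nhds hl₁)) (hK.continuousAt (hΛ.mem_nhds hl₂))
  by_contra hcon
  have hO := (hcont.eventually_ne hcon).and (prod_mem_nhds (hΛ.mem_nhds hl₁) (hΛ.mem_nhds hl₂))
  obtain ⟨m₁, m₂, ⟨hne', hm₁, hm₂⟩, h1, h2, hd', hm', hg, hg'⟩ :=
    D.exists_regular (hne hl₂) hO (D.bcoef A)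
  exact hne' (reflExpr_eq_zero_of_pairGen D ρ h1 h2 hd' hm' hg hg' (h.intertwines hm₁)
    (h.intertwines hm₂))

variable {D ρ} in
/-- The substitution `λ ↦ -1/λ` and `a_tᵗ(-1/λ) = a_t(λ)` turn one boundary equation into the
other. -/
theorem SolvesIbc.solvesMbc {A : D.Idx → ℂ} {Λ : Set ℝ} {K : ℝ → Matrix m m ℂ} (h0 : 0 ∉ Λ)
    (h : SolvesIbc D ρ A Λ K) : SolvesMbc D ρ A (minusDomain Λ) (minusK K) := by
  intro l hl φ
  have hl0 : l ≠ 0 := by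
    rintro rfl
    exact h0 (by simpa [minusDomain] using hl)
  have := h (-l⁻¹) hl φ
  rw [inv_neg, inv_inv] at this
  have e1 := D.tr_laxT' hl0 φ (D.durham A φ)
  have e2 := D.tr_laxT (inv_ne_zero hl0) φ (D.durham A φ)
  rw [inv_inv] at e2
  rw [e2] at this
  rw [minusK, e1]
  exact this

variable {D ρ} in
/-- The substitution `λ ↦ -1/λ` and `r^{t₁t₂}(λ) = -r(1/λ)` turn one reflection equation into the
other. -/
theorem SolvesRefl.solvesMrefl {Λ : Set ℝ} {K : ℝ → Matrix m m ℂ} (h0 : 0 ∉ Λ)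
    (h : SolvesRefl D ρ Λ K) : SolvesMrefl D ρ (minusDomain Λ) (minusK K) := by
  intro l₁ hl₁ l₂ hl₂ hd hm
  have hne : ∀ {l}, l ∈ minusDomain Λ → l ≠ 0 := by
    rintro l hl rfl
    exact h0 (by simpa [minusDomain] using hl)
  have h₁ := hne hl₁
  have h₂ := hne hl₂
  have q1 : -l₁⁻¹ / -l₂⁻¹ = (l₁ / l₂)⁻¹ := by field_simp
  have q2 : -l₂⁻¹ / -l₁⁻¹ = l₁ / l₂ := by field_simp
  have q3 : -l₁⁻¹ * -l₂⁻¹ = (l₁ * l₂)⁻¹ := by field_simp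
  have hr := h (-l₁⁻¹) hl₁ (-l₂⁻¹) hl₂ (by rwa [q1, inv_zpow, ne_eq, inv_eq_one])
    (by rwa [q3, inv_zpow, ne_eq, inv_eq_one])
  rw [q1, q2, q3, inv_inv, Generators.rMatrix_inv (div_ne_zero h₁ h₂) hd,
    Generators.rMatrix_inv (mul_ne_zero h₁ h₂) hm] at hr
  rw [← inv_div l₁ l₂, Generators.rMatrix_inv (div_ne_zero h₁ h₂) hd,
    Generators.rMatrix_inv (mul_ne_zero h₁ h₂) hm, ← neg_eq_zero, ← hr]
  simp only [map_neg, D.tr2_tr12, neg_mul, mul_neg, minusK]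
  abel

end Reflection

/-! ### Ordered exponentials -/

section OrderedExponentials

open scoped Matrix.Norms.Operator
open MeasureTheory Set Filter Topology

variable {m : Type*} [Fintype m] [DecidableEq m]

theorem intervalIntegral_matrix_apply {f : ℝ → Matrix m m ℂ} {a b : ℝ}
    (hf : Continuous f) (i j : m) :
    (∫ x in a..b, f x) i j = ∫ x in a..b, f x i j :=
  ((Matrix.entryLinearMap ℂ ℂ i j).toContinuousLinearMap.intervalIntegral_comp_comm
    (hf.intervalIntegrable a b)).symm

variable {X : Type*} [TopologicalSpace X]

/-- Joint continuity in a parameter and in the end point. -/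
theorem continuous_orderedIntegral {a : X → ℝ → Matrix m m ℂ}
    (ha : Continuous fun p : X × ℝ => a p.1 p.2) (x₀ : ℝ) (k : ℕ) :
    Continuous fun p : X × ℝ => orderedIntegral (a p.1) x₀ k p.2 := by
  induction k with
  | zero => exact continuous_const
  | succ k ih =>
    refine continuous_matrix fun i j => ?_
    have h : Continuous fun p : X × ℝ => (a p.1 p.2 * orderedIntegral (a p.1) x₀ k p.2) i j :=
      (ha.mul ih).matrix_elem i j
    exact intervalIntegral.continuous_parametric_primitive_of_continuous
      (f := fun s y => (a s y * orderedIntegral (a s) x₀ k y) i j) h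

variable {a : ℝ → Matrix m m ℂ}

theorem continuous_orderedIntegral' (ha : Continuous a) (x₀ : ℝ) (k : ℕ) :
    Continuous (orderedIntegral a x₀ k) :=
  (continuous_orderedIntegral (X := Unit) (a := fun _ => a) (ha.comp continuous_snd) x₀ k).comp
    (Continuous.prodMk_right ())

theorem orderedIntegral_succ (ha : Continuous a) (x₀ : ℝ) (k : ℕ) (x : ℝ) :
    orderedIntegral a x₀ (k + 1) x = ∫ y in x₀..x, a y * orderedIntegral a x₀ k y := by
  ext i j
  exact (intervalIntegral_matrix_apply (f := fun y => a y * orderedIntegral a x₀ k y)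
    (ha.mul (continuous_orderedIntegral' ha x₀ k)) i j).symm

theorem hasDerivAt_orderedIntegral_succ (ha : Continuous a) (x₀ : ℝ) (k : ℕ) (x : ℝ) :
    HasDerivAt (orderedIntegral a x₀ (k + 1)) (a x * orderedIntegral a x₀ k x) x := by
  have h : orderedIntegral a x₀ (k + 1) = fun x => ∫ y in x₀..x, a y * orderedIntegral a x₀ k y :=
    funext fun x => orderedIntegral_succ ha x₀ k x
  rw [h]
  exact ((ha.mul (continuous_orderedIntegral' ha x₀ k)).integral_hasStrictDerivAt x₀ x).hasDerivAt

/-- The simplex on which the `k`-fold integral is taken contributes the factor `1 / k!`. -/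
theorem norm_orderedIntegral_le (ha : Continuous a) {x₀ M : ℝ} (hM : 0 ≤ M) (k : ℕ) {x : ℝ}
    (hx : ∀ y ∈ uIcc x₀ x, ‖a y‖ ≤ M) :
    ‖orderedIntegral a x₀ k x‖ ≤ ‖(1 : Matrix m m ℂ)‖ * ((M * |x - x₀|) ^ k / k.factorial) := by
  induction k generalizing x with
  | zero => simp [orderedIntegral]
  | succ k ih =>
    set C := ‖(1 : Matrix m m ℂ)‖
    rw [orderedIntegral_succ ha]
    have hb : ∀ y ∈ uIoc x₀ x, ‖a y * orderedIntegral a x₀ k y‖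
        ≤ C * M ^ (k + 1) / k.factorial * |y - x₀| ^ k := by
      intro y hy
      have hy' := uIoc_subset_uIcc hy
      calc ‖a y * orderedIntegral a x₀ k y‖ ≤ ‖a y‖ * ‖orderedIntegral a x₀ k y‖ := norm_mul_le _ _
        _ ≤ M * (C * ((M * |y - x₀|) ^ k / k.factorial)) :=
          mul_le_mul (hx y hy') (ih fun z hz => hx z (uIcc_subset_uIcc_left hy' hz))
            (norm_nonneg _) hM
        _ = _ := by rw [mul_pow, pow_succ]; ring
    refine (intervalIntegral.norm_integral_le_abs_of_norm_le
      (g := fun y => C * M ^ (k + 1) / k.factorial * |y - x₀| ^ k) ?_ ?_).trans ?_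
    · exact (ae_restrict_iff' measurableSet_uIoc).mpr (Eventually.of_forall hb)
    · exact Continuous.intervalIntegrable (by fun_prop) _ _
    · rw [intervalIntegral.integral_const_mul, abs_mul,
        intervalIntegral.abs_intervalIntegral_eq, integral_pow_abs_sub_uIoc,
        abs_of_nonneg (by positivity), abs_of_nonneg (by positivity), Nat.factorial_succ, mul_pow]
      push_cast
      apply le_of_eq
      field_simp

theorem exists_norm_le_of_continuous (ha : Continuous a) (R : ℝ) :
    ∃ M, 0 ≤ M ∧ ∀ y ∈ Icc (-R) R, ‖a y‖ ≤ M := by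
  obtain ⟨M, hM⟩ := isCompact_Icc.exists_bound_of_continuousOn (s := Icc (-R) R) ha.continuousOn
  exact ⟨max M 0, le_max_right _ _, fun y hy => (hM y hy).trans (le_max_left _ _)⟩

theorem uIcc_subset_of_abs_le {x₀ x R : ℝ} (h₀ : |x₀| ≤ R) (h : |x| ≤ R) :
    uIcc x₀ x ⊆ Icc (-R) R :=
  uIcc_subset_Icc (abs_le.mp h₀) (abs_le.mp h)

theorem norm_orderedIntegral_le' (ha : Continuous a) {x₀ M R : ℝ} (hM : 0 ≤ M)
    (hb : ∀ y ∈ Icc (-R) R, ‖a y‖ ≤ M) (h₀ : |x₀| ≤ R) (k : ℕ) {x : ℝ} (hx : |x| ≤ R) :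
    ‖orderedIntegral a x₀ k x‖
      ≤ ‖(1 : Matrix m m ℂ)‖ * ((M * (R + R)) ^ k / k.factorial) := by
  refine (norm_orderedIntegral_le ha hM k
    fun y hy => hb y (uIcc_subset_of_abs_le h₀ hx hy)).trans ?_
  have : |x - x₀| ≤ R + R := (abs_sub _ _).trans (add_le_add hx h₀)
  gcongr

theorem summable_orderedIntegral (ha : Continuous a) (x₀ x : ℝ) :
    Summable fun k => orderedIntegral a x₀ k x := by
  obtain ⟨M, hM, hb⟩ := exists_norm_le_of_continuous ha (max |x₀| |x|)
  exact Summable.of_norm_bounded ((Real.summable_pow_div_factorial _).mul_left _)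
    fun k => norm_orderedIntegral_le' ha hM hb (le_max_left _ _) k (le_max_right _ _)

theorem pathExp_eq_tsum (ha : Continuous a) (x₀ x : ℝ) :
    pathExp a x₀ x = ∑' k, orderedIntegral a x₀ k x := by
  ext i j
  exact ((Matrix.entryLinearMap ℂ ℂ i j).toContinuousLinearMap.map_tsum
    (summable_orderedIntegral ha x₀ x)).symm

/-- The ordered exponential solves `P' = a P`. -/
theorem hasDerivAt_pathExp (ha : Continuous a) (x₀ x : ℝ) :
    HasDerivAt (pathExp a x₀) (a x * pathExp a x₀ x) x := by
  set R := max |x₀| |x| + 1 with hR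
  obtain ⟨M, hM, hb⟩ := exists_norm_le_of_continuous ha R
  have h₀ : |x₀| ≤ R := (le_max_left _ _).trans (by linarith)
  set u : ℕ → ℝ := fun k => M * (‖(1 : Matrix m m ℂ)‖ * ((M * (R + R)) ^ k / k.factorial))
  have hu : Summable u := ((Real.summable_pow_div_factorial _).mul_left _).mul_left _
  let u' : ℕ → ℝ := fun k => k.casesOn 0 u
  let G' : ℕ → ℝ → Matrix m m ℂ := fun k y => k.casesOn 0 fun k => a y * orderedIntegral a x₀ k y
  have hu' : Summable u' := (summable_nat_add_iff 1).mp hu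
  have hxt : x ∈ Ioo (-R) R := abs_lt.mp ((le_max_right _ _).trans_lt (lt_add_one _))
  -- Termwise differentiation of the Dyson series, the first term of which is constant.
  have key := hasDerivAt_tsum_of_isPreconnected (g := fun k => orderedIntegral a x₀ k) (g' := G')
    hu' (isOpen_Ioo (a := -R) (b := R)) isPreconnected_Ioo ?_ ?_ hxt
    (summable_orderedIntegral ha x₀ x) hxt
  · have e1 : pathExp a x₀ = fun z => ∑' k, orderedIntegral a x₀ k z :=
      funext fun z => pathExp_eq_tsum ha x₀ z
    have hs := summable_orderedIntegral ha x₀ x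
    have hG : Summable fun k => G' k x := (summable_nat_add_iff 1).mp (hs.mul_left (a x))
    have e2 : a x * pathExp a x₀ x = ∑' k, G' k x := by
      rw [pathExp_eq_tsum ha, hG.tsum_eq_zero_add, ← hs.tsum_mul_left]
      exact (zero_add _).symm
    rw [e2, e1]
    exact key
  · rintro (_ | k) y -
    · exact hasDerivAt_const y 1
    · exact hasDerivAt_orderedIntegral_succ ha x₀ k y
  · rintro (_ | k) y hy
    · simp [G', u']
    · exact (norm_mul_le _ _).trans (mul_le_mul (hb y (Ioo_subset_Icc_self hy))
        (norm_orderedIntegral_le' ha hM hb h₀ k (abs_le.mpr (Ioo_subset_Icc_self hy)))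
        (norm_nonneg _) hM)

theorem pathExp_self (a : ℝ → Matrix m m ℂ) (x₀ : ℝ) : pathExp a x₀ x₀ = 1 := by
  ext i j
  rw [pathExp, Matrix.of_apply, tsum_eq_single 0]
  · rfl
  · rintro (_ | k) hk
    · exact absurd rfl hk
    · simp [orderedIntegral]

/-- The ordered exponential of the opposite order solves `Q' = Q a`. -/
theorem hasDerivAt_antiPathExp (ha : Continuous a) (x₀ x : ℝ) :
    HasDerivAt (antiPathExp a x₀) (antiPathExp a x₀ x * a x) x := by
  have h := hasDerivAt_pathExp (a := fun x => (a x).transpose) ha.matrix_transpose x₀ x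
  have h2 := (LinearMap.toContinuousLinearMap (Matrix.transposeLinearEquiv m m ℂ ℂ).toLinearMap
    |>.restrictScalars ℝ).hasFDerivAt.comp_hasDerivAt x h
  convert! h2 using 1
  change _ = ((a x).transpose * pathExp (fun x => (a x).transpose) x₀ x).transpose
  rw [Matrix.transpose_mul, Matrix.transpose_transpose, antiPathExp]

/-- The ordered exponential of `a` is inverted by that of `-a` with the opposite order. -/
theorem antiPathExp_mul_pathExp (ha : Continuous a) (x₀ x : ℝ) :
    antiPathExp (fun x => -a x) x₀ x * pathExp a x₀ x = 1 := by
  have hd : ∀ y, HasDerivAt (fun y => antiPathExp (fun x => -a x) x₀ y * pathExp a x₀ y) 0 y := by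
    intro y
    have := (hasDerivAt_antiPathExp (a := fun x => -a x) ha.neg x₀ y).mul
      (hasDerivAt_pathExp ha x₀ y)
    convert! this using 1
    rw [mul_neg, neg_mul, mul_assoc, neg_add_cancel]
  have hc := is_const_of_deriv_eq_zero (fun y => (hd y).differentiableAt) (fun y => (hd y).deriv)
    x x₀
  rw [hc, pathExp_self, antiPathExp, pathExp_self, Matrix.transpose_one, one_mul]

theorem isUnit_pathExp (ha : Continuous a) (x₀ x : ℝ) : IsUnit (pathExp a x₀ x).det :=
  Matrix.isUnit_det_of_left_inverse (antiPathExp_mul_pathExp ha x₀ x)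

theorem inv_pathExp (ha : Continuous a) (x₀ x : ℝ) :
    (pathExp a x₀ x)⁻¹ = antiPathExp (fun x => -a x) x₀ x :=
  Matrix.inv_eq_left_inv (antiPathExp_mul_pathExp ha x₀ x)

theorem hasDerivAt_inv_pathExp (ha : Continuous a) (x₀ x : ℝ) :
    HasDerivAt (fun x => (pathExp a x₀ x)⁻¹) (-((pathExp a x₀ x)⁻¹ * a x)) x := by
  have h : (fun x => (pathExp a x₀ x)⁻¹) = antiPathExp (fun x => -a x) x₀ :=
    funext fun x => inv_pathExp ha x₀ x
  rw [h, inv_pathExp ha, ← mul_neg]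
  exact hasDerivAt_antiPathExp ha.neg x₀ x

theorem continuous_pathExp (ha : Continuous a) (x₀ : ℝ) : Continuous (pathExp a x₀) :=
  continuous_iff_continuousAt.mpr fun x => (hasDerivAt_pathExp ha x₀ x).continuousAt

theorem continuous_inv_pathExp (ha : Continuous a) (x₀ : ℝ) :
    Continuous fun x => (pathExp a x₀ x)⁻¹ :=
  continuous_iff_continuousAt.mpr fun x => (hasDerivAt_inv_pathExp ha x₀ x).continuousAt

/-- The ordered exponential depends continuously on its end point and on a parameter. -/
theorem continuous_pathExp_param {a : X → ℝ → Matrix m m ℂ}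
    (ha : Continuous fun p : X × ℝ => a p.1 p.2) (x₀ : ℝ) :
    Continuous fun p : X × ℝ => pathExp (a p.1) x₀ p.2 := by
  have hs : ∀ s, Continuous (a s) := fun s => ha.comp (Continuous.prodMk_right s)
  rw [continuous_iff_continuousAt]
  rintro ⟨s₀, x⟩
  set R := max |x₀| |x| + 1 with hR
  obtain ⟨M, hM, hb⟩ := exists_norm_le_of_continuous (hs s₀) R
  have hU : ∀ᶠ s in 𝓝 s₀, ∀ y ∈ Icc (-R) R, ‖a s y‖ ≤ M + 1 := by
    refine isCompact_Icc.eventually_forall_of_forall_eventually fun y hy => ?_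
    have : ContinuousAt (fun p : X × ℝ => ‖a p.1 p.2‖) (s₀, y) := ha.norm.continuousAt
    exact (this.eventually (gt_mem_nhds (lt_of_le_of_lt (hb y hy) (lt_add_one M)))).mono
      fun z hz => le_of_lt hz
  have hR' : |x| < R := (le_max_right _ _).trans_lt (lt_add_one _)
  have h₀ : |x₀| ≤ R := (le_max_left _ _).trans (by linarith)
  have hnhds : {s | ∀ y ∈ Icc (-R) R, ‖a s y‖ ≤ M + 1} ×ˢ Ioo (-R) R ∈ 𝓝 (s₀, x) :=
    prod_mem_nhds hU (isOpen_Ioo.mem_nhds (abs_lt.mp hR'))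
  have e : (fun p : X × ℝ => pathExp (a p.1) x₀ p.2)
      = fun p => ∑' k, orderedIntegral (a p.1) x₀ k p.2 :=
    funext fun p => pathExp_eq_tsum (hs p.1) x₀ p.2
  rw [e]
  refine (continuousOn_tsum (fun k => (continuous_orderedIntegral ha x₀ k).continuousOn)
    ((Real.summable_pow_div_factorial ((M + 1) * (R + R))).mul_left ‖(1 : Matrix m m ℂ)‖)
    fun k p hp => ?_).continuousAt hnhds
  exact norm_orderedIntegral_le' (hs p.1) (by linarith) hp.1 h₀ k
    (abs_le.mpr (Ioo_subset_Icc_self hp.2))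

theorem continuousOn_prod_univ_iff {Y : Type*} [TopologicalSpace Y] {S : Set X} {f : X × ℝ → Y} :
    ContinuousOn f (S ×ˢ univ) ↔ Continuous fun q : S × ℝ => f (q.1, q.2) := by
  refine ⟨fun h => h.comp_continuous (by fun_prop) fun q => ⟨q.1.2, trivial⟩, fun h => ?_⟩
  rw [continuousOn_iff_continuous_domRestrict]
  have : Continuous fun p : (S ×ˢ (univ : Set ℝ) : Set (X × ℝ)) =>
      ((⟨p.1.1, p.2.1⟩, p.1.2) : S × ℝ) := by fun_prop
  exact h.comp this

theorem continuousOn_pathExp_param {S : Set X} {a : X → ℝ → Matrix m m ℂ}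
    (ha : ContinuousOn (fun p : X × ℝ => a p.1 p.2) (S ×ˢ univ)) (x₀ : ℝ) :
    ContinuousOn (fun p : X × ℝ => pathExp (a p.1) x₀ p.2) (S ×ˢ univ) := by
  rw [continuousOn_prod_univ_iff] at ha ⊢
  exact continuous_pathExp_param (a := fun s : S => a s) ha x₀

/-- Locally uniform bounds for a family which depends continuously on a parameter. -/
theorem eventually_norm_le {E : Type*} [NormedAddCommGroup E] {S : Set X} {f : X → ℝ → E}
    (hf : ContinuousOn (fun p : X × ℝ => f p.1 p.2) (S ×ˢ univ)) {s₀ : X} (hS : S ∈ 𝓝 s₀)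
    (x₀ x₁ : ℝ) : ∃ C, 0 ≤ C ∧ ∀ᶠ s in 𝓝 s₀, ∀ y ∈ uIcc x₀ x₁, ‖f s y‖ ≤ C := by
  have hs : ∀ y, ContinuousAt (fun p : X × ℝ => f p.1 p.2) (s₀, y) := fun y =>
    hf.continuousAt (prod_mem_nhds hS univ_mem)
  have hc : Continuous (f s₀) := continuous_iff_continuousAt.mpr fun y =>
    ContinuousAt.comp (f := fun y => (s₀, y)) (hs y) (by fun_prop)
  obtain ⟨C, hC⟩ := isCompact_uIcc.exists_bound_of_continuousOn (s := uIcc x₀ x₁) hc.continuousOn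
  have hC0 : 0 ≤ C := (norm_nonneg _).trans (hC x₀ left_mem_uIcc)
  refine ⟨C + 1, by linarith, isCompact_uIcc.eventually_forall_of_forall_eventually
    fun y hy => ?_⟩
  exact ((hs y).norm.eventually (gt_mem_nhds (lt_of_le_of_lt (hC y hy) (lt_add_one C)))).mono
    fun z hz => le_of_lt hz

/-- Variation of constants for the dependence of the ordered exponential on its argument. -/
theorem pathExp_sub_pathExp {b : ℝ → Matrix m m ℂ} (ha : Continuous a) (hb : Continuous b)
    (x₀ x₁ : ℝ) :
    pathExp b x₀ x₁ = pathExp a x₀ x₁ +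
      pathExp a x₀ x₁ * ∫ x in x₀..x₁, (pathExp a x₀ x)⁻¹ * (b x - a x) * pathExp b x₀ x := by
  have hd : ∀ x ∈ uIcc x₀ x₁, HasDerivAt (fun x => (pathExp a x₀ x)⁻¹ * pathExp b x₀ x)
      ((pathExp a x₀ x)⁻¹ * (b x - a x) * pathExp b x₀ x) x := fun x _ => by
    convert! (hasDerivAt_inv_pathExp ha x₀ x).mul (hasDerivAt_pathExp hb x₀ x) using 1
    noncomm_ring
  rw [intervalIntegral.integral_eq_sub_of_hasDerivAt hd (((((continuous_inv_pathExp ha x₀).mul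
      (hb.sub ha)).mul (continuous_pathExp hb x₀))).intervalIntegrable _ _), pathExp_self,
    pathExp_self, mul_sub, ← mul_assoc, Matrix.mul_nonsing_inv _ (isUnit_pathExp ha x₀ x₁)]
  simp

/-- The mean value inequality for difference quotients. -/
theorem norm_inv_smul_sub_le {𝕜 E : Type*} [RCLike 𝕜] [NormedAddCommGroup E] [NormedSpace 𝕜 E]
    {f f' : 𝕜 → E} {ε₀ ε : 𝕜} {δ C : ℝ} (hf : ∀ z ∈ Metric.ball ε₀ δ, HasDerivAt f (f' z) z)
    (hC : ∀ z ∈ Metric.ball ε₀ δ, ‖f' z‖ ≤ C) (hε : ε ∈ Metric.ball ε₀ δ) :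
    ‖(ε - ε₀)⁻¹ • (f ε - f ε₀)‖ ≤ C := by
  have hδ : ε₀ ∈ Metric.ball ε₀ δ := Metric.mem_ball_self (Metric.pos_of_mem_ball hε)
  have hlip : ‖f ε - f ε₀‖ ≤ C * ‖ε - ε₀‖ :=
    (convex_ball ε₀ δ).norm_image_sub_le_of_norm_hasDerivWithin_le
      (fun z hz => (hf z hz).hasDerivWithinAt) hC hδ hε
  rw [norm_smul, norm_inv]
  rcases eq_or_ne ε ε₀ with rfl | hne
  · simpa using (norm_nonneg _).trans (hC _ hδ)
  · rwa [inv_mul_le_iff₀ (norm_pos_iff.mpr (sub_ne_zero.mpr hne)), mul_comm]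

/-- Differentiation of `ε ↦ ∫ Q (a_ε - a_{ε₀}) P_ε` at `ε₀`. -/
theorem hasDerivAt_integral_mul_sub_mul {𝕜 𝔸 : Type*} [RCLike 𝕜] [NormedRing 𝔸]
    [NormedAlgebra ℝ 𝔸] [NormedAlgebra 𝕜 𝔸] [SMulCommClass ℝ 𝕜 𝔸] {S : Set 𝕜}
    {a a' P : 𝕜 → ℝ → 𝔸} {Q : ℝ → 𝔸} {ε₀ : 𝕜} (hS : S ∈ 𝓝 ε₀)
    (ha : ContinuousOn (fun p : 𝕜 × ℝ => a p.1 p.2) (S ×ˢ univ))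
    (ha' : ContinuousOn (fun p : 𝕜 × ℝ => a' p.1 p.2) (S ×ˢ univ))
    (hP : ContinuousOn (fun p : 𝕜 × ℝ => P p.1 p.2) (S ×ˢ univ)) (hQc : Continuous Q)
    (hd : ∀ ε ∈ S, ∀ x, HasDerivAt (fun ε => a ε x) (a' ε x) ε) (x₀ x₁ : ℝ) :
    HasDerivAt (fun ε => ∫ x in x₀..x₁, Q x * (a ε x - a ε₀ x) * P ε x)
      (∫ x in x₀..x₁, Q x * a' ε₀ x * P ε₀ x) ε₀ := by
  have hc : ∀ {f : 𝕜 → ℝ → 𝔸}, ContinuousOn (fun p : 𝕜 × ℝ => f p.1 p.2) (S ×ˢ univ) →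
      ∀ ε ∈ S, Continuous (f ε) := fun {f} hf ε hε =>
    hf.comp_continuous (f := fun y => (ε, y)) (by fun_prop) fun y => ⟨hε, trivial⟩
  have h0 : ε₀ ∈ S := mem_of_mem_nhds hS
  -- The integrand of the difference quotient, which converges with a uniform bound.
  set F : 𝕜 → ℝ → 𝔸 := fun ε x => Q x * ((ε - ε₀)⁻¹ • (a ε x - a ε₀ x)) * P ε x with hF
  obtain ⟨CQ, hCQ0, hCQ⟩ := eventually_norm_le (X := 𝕜) (S := univ) (f := fun _ => Q) (s₀ := ε₀)
    (hQc.comp continuous_snd).continuousOn univ_mem x₀ x₁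
  obtain ⟨CP, hCP0, hCP⟩ := eventually_norm_le hP hS x₀ x₁
  obtain ⟨CA, hCA0, hCA⟩ := eventually_norm_le ha' hS x₀ x₁
  obtain ⟨δ, hδ, hball⟩ := Metric.eventually_nhds_iff_ball.mp ((hCQ.and (hCP.and hCA)).and hS)
  have hbound : ∀ ε ∈ Metric.ball ε₀ δ, ∀ x ∈ uIcc x₀ x₁, ‖F ε x‖ ≤ CQ * CA * CP := by
    intro ε hε x hx
    obtain ⟨⟨h1, h2, -⟩, -⟩ := hball ε hε
    have hsl : ‖(ε - ε₀)⁻¹ • (a ε x - a ε₀ x)‖ ≤ CA :=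
      norm_inv_smul_sub_le (f := fun ε => a ε x) (f' := fun ε => a' ε x)
        (fun z hz => hd z (hball z hz).2 x) (fun z hz => (hball z hz).1.2.2 x hx) hε
    refine (norm_mul_le _ _).trans (mul_le_mul ((norm_mul_le _ _).trans
      (mul_le_mul (h1 x hx) hsl (norm_nonneg _) hCQ0)) (h2 x hx) (norm_nonneg _) (by positivity))
  have hFc : ∀ ε ∈ S, Continuous (F ε) := fun ε hε =>
    (hQc.mul (continuous_const.smul ((hc ha ε hε).sub (hc ha ε₀ h0)))).mul (hc hP ε hε)
  have hlim : Tendsto (fun ε => ∫ x in x₀..x₁, F ε x) (𝓝[≠] ε₀)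
      (𝓝 (∫ x in x₀..x₁, Q x * a' ε₀ x * P ε₀ x)) := by
    refine intervalIntegral.tendsto_integral_filter_of_dominated_convergence
      (fun _ => CQ * CA * CP) ?_ ?_ (by simp) ?_
    · filter_upwards [mem_nhdsWithin_of_mem_nhds hS] with ε hε
      exact (hFc ε hε).aestronglyMeasurable
    · filter_upwards [mem_nhdsWithin_of_mem_nhds (Metric.ball_mem_nhds ε₀ hδ)] with ε hε
      exact Eventually.of_forall fun x hx => hbound ε hε x (uIoc_subset_uIcc hx)
    · refine Eventually.of_forall fun x _ => ?_
      have h1 := hasDerivAt_iff_tendsto_slope.mp (hd ε₀ h0 x)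
      have h2 : Tendsto (fun ε => P ε x) (𝓝[≠] ε₀) (𝓝 (P ε₀ x)) := by
        have := hP.continuousAt (x := (ε₀, x)) (prod_mem_nhds hS univ_mem)
        exact (ContinuousAt.comp (f := fun ε => (ε, x)) this (by fun_prop)).tendsto.mono_left
          nhdsWithin_le_nhds
      exact (tendsto_const_nhds.mul h1).mul h2
  rw [hasDerivAt_iff_tendsto_slope]
  refine hlim.congr fun ε => ?_
  simp only [slope_def_module, sub_self, mul_zero, zero_mul, intervalIntegral.integral_zero,
    sub_zero]
  rw [← intervalIntegral.integral_smul]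
  simp only [hF, mul_smul_comm, smul_mul_assoc]

/-- The derivative of the ordered exponential with respect to a real or complex parameter. -/
theorem hasDerivAt_pathExp_param {𝕜 : Type*} [RCLike 𝕜] [NormedAlgebra 𝕜 ℂ]
    [SMulCommClass ℝ 𝕜 ℂ] {S : Set 𝕜} {a a' : 𝕜 → ℝ → Matrix m m ℂ} {ε₀ : 𝕜} (hS : S ∈ 𝓝 ε₀)
    (ha : ContinuousOn (fun p : 𝕜 × ℝ => a p.1 p.2) (S ×ˢ univ))
    (ha' : ContinuousOn (fun p : 𝕜 × ℝ => a' p.1 p.2) (S ×ˢ univ))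
    (hd : ∀ ε ∈ S, ∀ x, HasDerivAt (fun ε => a ε x) (a' ε x) ε) (x₀ x₁ : ℝ) :
    HasDerivAt (fun ε => pathExp (a ε) x₀ x₁) (pathExp (a ε₀) x₀ x₁ *
      ∫ x in x₀..x₁, (pathExp (a ε₀) x₀ x)⁻¹ * a' ε₀ x * pathExp (a ε₀) x₀ x) ε₀ := by
  have hc : ∀ ε ∈ S, Continuous (a ε) := fun ε hε =>
    ha.comp_continuous (f := fun y => (ε, y)) (by fun_prop) fun y => ⟨hε, trivial⟩
  have h0 : ε₀ ∈ S := mem_of_mem_nhds hS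
  have key := ((hasDerivAt_integral_mul_sub_mul (P := fun ε => pathExp (a ε) x₀) hS ha ha'
    (continuousOn_pathExp_param ha x₀)
    (continuous_inv_pathExp (hc ε₀ h0) x₀) hd x₀ x₁).const_mul (pathExp (a ε₀) x₀ x₁)).const_add
    (pathExp (a ε₀) x₀ x₁)
  refine key.congr_of_eventuallyEq ?_
  filter_upwards [hS] with ε hε
  exact pathExp_sub_pathExp (hc ε₀ h0) (hc ε hε) x₀ x₁

end OrderedExponentials

/-! ### Zero curvature -/

section LaxPair

variable {g : Type*} [LieRing g] [LieAlgebra ℂ g] [Module.Finite ℂ g] [LieAlgebra.IsSimple ℂ g]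
variable {H : LieSubalgebra ℂ g} [H.IsCartanSubalgebra]

namespace Generators

variable {n : ℕ} (D : Generators g H n)

/-- The affine root vectors `λ E_i + λ⁻¹ E_{-i}` in the space component of the Lax connection. -/
def genX (l : ℝ) (i : D.Idx) : g :=
  (l : ℂ) • D.E (D.aroot i) + (l : ℂ)⁻¹ • D.E (negRoot (D.aroot i))

/-- The affine root vectors `λ E_i - λ⁻¹ E_{-i}` in the time component of the Lax connection. -/
def genT (l : ℝ) (i : D.Idx) : g :=
  (l : ℂ) • D.E (D.aroot i) - (l : ℂ)⁻¹ • D.E (negRoot (D.aroot i))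

/-- The common form of both components of the Lax connection. -/
def lax (Z : D.Idx → g) (φ ψ : Fin n → ℂ) : g :=
  (1 / 2 : ℂ) • D.cartan ψ + ∑ i, D.weight i φ • Z i

/-- The differential of `lax` in the direction `(dφ, dψ)`. -/
def dlax (Z : D.Idx → g) (φ dφ dψ : Fin n → ℂ) : g :=
  (1 / 2 : ℂ) • D.cartan dψ + ∑ i, (D.weight i φ * (D.adot i dφ / 2)) • Z i

theorem laxX_eq (l : ℝ) (φ ψ : Fin n → ℂ) : D.laxX l φ ψ = D.lax (D.genX l) φ ψ := rfl

theorem laxT_eq (l : ℝ) (φ ψ : Fin n → ℂ) : D.laxT l φ ψ = D.lax (D.genT l) φ ψ := rfl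

theorem lie_cartan_E_aroot (v : Fin n → ℂ) (i : D.Idx) :
    ⁅D.cartan v, D.E (D.aroot i)⁆ = D.adot i v • D.E (D.aroot i) := by
  simp only [cartan, sum_lie, smul_lie, D.lie_E, smul_smul, ← Finset.sum_smul, adot, rootVec]
  congr 1
  exact Finset.sum_congr rfl fun a _ => mul_comm _ _

theorem lie_cartan_E_negRoot (v : Fin n → ℂ) (i : D.Idx) :
    ⁅D.cartan v, D.E (negRoot (D.aroot i))⁆ = -(D.adot i v • D.E (negRoot (D.aroot i))) := by
  simp only [cartan, sum_lie, smul_lie, D.lie_E, smul_smul, ← Finset.sum_smul, adot, rootVec]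
  rw [← neg_smul]
  congr 1
  rw [← Finset.sum_neg_distrib]
  refine Finset.sum_congr rfl fun a _ => ?_
  rw [root_negRoot, LinearMap.neg_apply]
  ring

theorem lie_cartan_genT (l : ℝ) (v : Fin n → ℂ) (i : D.Idx) :
    ⁅D.cartan v, D.genT l i⁆ = D.adot i v • D.genX l i := by
  rw [genT, genX, lie_sub, lie_smul, lie_smul, lie_cartan_E_aroot, lie_cartan_E_negRoot]
  module

theorem lie_cartan_genX (l : ℝ) (v : Fin n → ℂ) (i : D.Idx) :
    ⁅D.cartan v, D.genX l i⁆ = D.adot i v • D.genT l i := by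
  rw [genT, genX, lie_add, lie_smul, lie_smul, lie_cartan_E_aroot, lie_cartan_E_negRoot]
  module

/-- The brackets of distinct nodes `i`, `j` cancel: `E_i` and `E_{-j}` commute, and the remaining
terms are antisymmetric. -/
theorem lie_genX_genT_add (l : ℝ) {i j : D.Idx} (hij : i ≠ j) :
    ⁅D.genX l i, D.genT l j⁆ + ⁅D.genX l j, D.genT l i⁆ = 0 := by
  have h1 := D.lie_E_aroot_negRoot hij
  have h2 := D.lie_E_aroot_negRoot hij.symm
  have h3 : ⁅D.E (negRoot (D.aroot i)), D.E (D.aroot j)⁆ = 0 := by rw [← lie_skew, h2, neg_zero]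
  have h4 : ⁅D.E (negRoot (D.aroot j)), D.E (D.aroot i)⁆ = 0 := by rw [← lie_skew, h1, neg_zero]
  simp only [genX, genT, add_lie, lie_sub, smul_lie, lie_smul, h1, h2, h3, h4]
  rw [← lie_skew (D.E (D.aroot i)) (D.E (D.aroot j)),
    ← lie_skew (D.E (negRoot (D.aroot i))) (D.E (negRoot (D.aroot j)))]
  module

theorem lie_genX_genT_self {l : ℝ} (hl : l ≠ 0) (i : D.Idx) :
    ⁅D.genX l i, D.genT l i⁆
      = (-(4 / (rootSq D.Hb (D.aroot i) : ℂ))) • (D.rootH (D.aroot i) : g) := by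
  have hl' : (l : ℂ) ≠ 0 := by exact_mod_cast hl
  have h1 := D.lie_E_negRoot (D.aroot i)
  have h2 : ⁅D.E (negRoot (D.aroot i)), D.E (D.aroot i)⁆ = _ := (lie_skew _ _).symm
  rw [h1] at h2
  simp only [genX, genT, add_lie, lie_sub, smul_lie, lie_smul, h1, h2, lie_self]
  match_scalars
  field_simp
  ring

theorem weight_sq (i : D.Idx) (φ : Fin n → ℂ) :
    D.weight i φ * D.weight i φ
      = D.eta i * rootSq D.Hb (D.aroot i) / 8 * Complex.exp (D.adot i φ) := by
  have h : ((D.coeff i : ℂ)) ^ 2 = D.eta i * rootSq D.Hb (D.aroot i) / 8 := by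
    have := D.coeff_sq i
    exact_mod_cast congrArg (fun x : ℝ => (x : ℂ)) this
  rw [weight, mul_mul_mul_comm, ← Complex.exp_add, add_halves, ← sq, h]

/-- The zero curvature condition `∂ₜ a_x = ∂ₓ a_t + [a_x, a_t]` is equivalent to the affine Toda
equation: the brackets of distinct nodes cancel, and `[E_i, E_{-i}]` produces the potential. -/
theorem zero_curvature {l : ℝ} (hl : l ≠ 0) {φ φt φx φtt φxx : Fin n → ℂ}
    (heom : ∀ a, φtt a - φxx a
      + ∑ i : D.Idx, D.eta i * rootVec D.Hb (D.aroot i) a * Complex.exp (D.adot i φ) = 0) :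
    D.dlax (D.genX l) φ φt φtt = D.dlax (D.genT l) φ φx φxx
      + ⁅D.lax (D.genX l) φ φt, D.lax (D.genT l) φ φx⁆ := by
  have hdouble : ∑ i, ∑ j, (D.weight j φ * D.weight i φ) • ⁅D.genX l i, D.genT l j⁆
      = ∑ i, (D.weight i φ * D.weight i φ) • ⁅D.genX l i, D.genT l i⁆ := by
    -- A double sum with antisymmetric off-diagonal terms reduces to its diagonal.
    have hsym : ∀ F : D.Idx → D.Idx → g, (∀ i j, i ≠ j → F i j + F j i = 0) →
        ∑ i, ∑ j, F i j = ∑ i, F i i := by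
      intro F hF
      have h2 : ∑ i, ∑ j, (F i j + F j i) = ∑ i, (F i i + F i i) :=
        Finset.sum_congr rfl fun i _ => Finset.sum_eq_single i
          (fun j _ hj => hF i j (Ne.symm hj)) (by simp)
      simp only [Finset.sum_add_distrib] at h2
      rw [Finset.sum_comm (f := fun i j => F j i), ← two_smul ℂ, ← two_smul ℂ] at h2
      exact smul_right_injective g (two_ne_zero (α := ℂ)) h2
    refine hsym _ fun i j hij => ?_
    rw [mul_comm (D.weight j φ), ← smul_add, D.lie_genX_genT_add l hij, smul_zero]
  have hlie : ⁅D.lax (D.genX l) φ φt, D.lax (D.genT l) φ φx⁆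
      = ∑ i, (D.weight i φ * (D.adot i φt / 2)) • D.genX l i
        - ∑ i, (D.weight i φ * (D.adot i φx / 2)) • D.genT l i
        + ∑ i, (D.weight i φ * D.weight i φ) • ⁅D.genX l i, D.genT l i⁆ := by
    have hcc : ⁅D.cartan φt, D.cartan φx⁆ = 0 := by
      simp only [cartan, sum_lie, lie_sum, smul_lie, lie_smul, Generators.lie_cartan]
      simp
    have e1 : ∑ i, ⁅(1 / 2 : ℂ) • D.cartan φt, D.weight i φ • D.genT l i⁆
        = ∑ i, (D.weight i φ * (D.adot i φt / 2)) • D.genX l i :=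
      Finset.sum_congr rfl fun i _ => by
        rw [smul_lie, lie_smul, lie_cartan_genT]; module
    have e2 : ∑ i, ⁅D.weight i φ • D.genX l i, (1 / 2 : ℂ) • D.cartan φx⁆
        = -∑ i, (D.weight i φ * (D.adot i φx / 2)) • D.genT l i := by
      rw [← Finset.sum_neg_distrib]
      refine Finset.sum_congr rfl fun i _ => ?_
      rw [smul_lie, lie_smul, ← lie_skew, lie_cartan_genX]; module
    rw [← hdouble, lax, lax, add_lie, lie_add, lie_add, smul_lie _ _ ((1 / 2 : ℂ) • D.cartan φx),
      lie_smul, hcc, lie_sum, e1, sum_lie, e2, sum_lie]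
    simp only [lie_sum, smul_lie, lie_smul, smul_smul, smul_zero]
    abel
  have hpot : ∑ i, (D.weight i φ * D.weight i φ) • ⁅D.genX l i, D.genT l i⁆
      = (1 / 2 : ℂ) • D.cartan (fun a => φtt a - φxx a) := by
    have h1 : (fun a => φtt a - φxx a)
        = -∑ i : D.Idx, (D.eta i * Complex.exp (D.adot i φ)) • rootVec D.Hb (D.aroot i) := by
      funext a
      rw [Pi.neg_apply, Finset.sum_apply, eq_neg_iff_add_eq_zero, ← heom a]
      congr 1
      exact Finset.sum_congr rfl fun i _ => by simp only [Pi.smul_apply, smul_eq_mul]; ring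
    have h2 : D.cartan (fun a => φtt a - φxx a)
        = -∑ i : D.Idx, (D.eta i * Complex.exp (D.adot i φ)) • (D.rootH (D.aroot i) : g) := by
      rw [h1]
      simp only [cartan, ← cartan_rootVec, Pi.neg_apply, Finset.sum_apply, Pi.smul_apply,
        smul_eq_mul, neg_smul, Finset.sum_neg_distrib, Finset.sum_smul, Finset.smul_sum, smul_smul]
      rw [Finset.sum_comm]
    rw [h2, ← Finset.sum_neg_distrib, Finset.smul_sum]
    refine Finset.sum_congr rfl fun i _ => ?_
    have hq : (rootSq D.Hb (D.aroot i) : ℂ) ≠ 0 := by exact_mod_cast (D.rootSq_pos _).ne'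
    rw [D.weight_sq, D.lie_genX_genT_self hl, smul_smul, ← neg_smul, smul_smul]
    congr 1
    field_simp
    ring
  rw [hlie, hpot, dlax, dlax]
  have h3 : D.cartan (fun a => φtt a - φxx a) = D.cartan φtt - D.cartan φxx := by
    simp only [cartan, sub_smul, Finset.sum_sub_distrib]
  rw [h3]
  module

section Calculus

variable {W : Type*} [NormedAddCommGroup W] [NormedSpace ℂ W] (f : g →ₗ[ℂ] W)

theorem map_lax (Z : D.Idx → g) (φ ψ : Fin n → ℂ) :
    f (D.lax Z φ ψ) = ∑ a, ((1 / 2 : ℂ) * ψ a) • f (D.Hb a) + ∑ i, D.weight i φ • f (Z i) := by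
  simp only [lax, cartan, map_add, map_smul, map_sum, Finset.smul_sum, smul_smul]

theorem map_dlax (Z : D.Idx → g) (φ dφ dψ : Fin n → ℂ) :
    f (D.dlax Z φ dφ dψ) = ∑ a, ((1 / 2 : ℂ) * dψ a) • f (D.Hb a)
      + ∑ i, (D.weight i φ * (D.adot i dφ / 2)) • f (Z i) := by
  simp only [dlax, cartan, map_add, map_smul, map_sum, Finset.smul_sum, smul_smul]

@[fun_prop]
theorem continuous_adot (i : D.Idx) : Continuous (D.adot i) := by
  unfold adot; fun_prop

@[fun_prop]
theorem continuous_weight (i : D.Idx) : Continuous (D.weight i) := by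
  unfold weight; fun_prop

theorem continuous_map_lax (Z : D.Idx → g) :
    Continuous fun p : (Fin n → ℂ) × (Fin n → ℂ) => f (D.lax Z p.1 p.2) := by
  simp only [map_lax]
  fun_prop

theorem continuous_map_dlax (Z : D.Idx → g) :
    Continuous fun p : (Fin n → ℂ) × (Fin n → ℂ) × (Fin n → ℂ) =>
      f (D.dlax Z p.1 p.2.1 p.2.2) := by
  simp only [map_dlax]
  fun_prop

variable {𝕜 : Type*} [NontriviallyNormedField 𝕜] [NormedAlgebra 𝕜 ℂ]

theorem hasDerivAt_weight {φ : 𝕜 → Fin n → ℂ} {dφ : Fin n → ℂ} {t : 𝕜} (hφ : HasDerivAt φ dφ t)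
    (i : D.Idx) :
    HasDerivAt (fun t => D.weight i (φ t)) (D.weight i (φ t) * (D.adot i dφ / 2)) t := by
  have h1 : HasDerivAt (fun t => D.adot i (φ t)) (D.adot i dφ) t := by
    unfold adot
    exact HasDerivAt.fun_sum fun a _ => ((hasDerivAt_pi.mp hφ) a).const_mul _
  have h2 := ((h1.div_const 2).cexp).const_mul (D.coeff i : ℂ)
  unfold weight
  rwa [mul_assoc]

theorem hasDerivAt_map_lax [NormedSpace 𝕜 W] [IsScalarTower 𝕜 ℂ W] (Z : D.Idx → g)
    {φ ψ : 𝕜 → Fin n → ℂ} {dφ dψ : Fin n → ℂ} {t : 𝕜} (hφ : HasDerivAt φ dφ t)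
    (hψ : HasDerivAt ψ dψ t) :
    HasDerivAt (fun t => f (D.lax Z (φ t) (ψ t))) (f (D.dlax Z (φ t) dφ dψ)) t := by
  simp only [map_lax, map_dlax]
  exact (HasDerivAt.fun_sum fun a _ => (((hasDerivAt_pi.mp hψ) a).const_mul _).smul_const _).add
    (HasDerivAt.fun_sum fun i _ => (D.hasDerivAt_weight hφ i).smul_const _)

end Calculus

end Generators

end LaxPair

/-! ### Conservation in time -/

section Conservation

attribute [local instance 100] LieRing.ofAssociativeRing
open scoped Matrix.Norms.Operator
open MeasureTheory Set Filter Topology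

section PartialDerivatives

variable {E : Type*} [NormedAddCommGroup E] [NormedSpace ℝ E]

theorem hasDerivAt_partial_fst {F : ℝ × ℝ → E} {t x : ℝ} (h : DifferentiableAt ℝ F (t, x)) :
    HasDerivAt (fun s => F (s, x)) (fderiv ℝ F (t, x) (1, 0)) t :=
  h.hasFDerivAt.comp_hasDerivAt t ((hasDerivAt_id t).prodMk (hasDerivAt_const t x))

theorem hasDerivAt_partial_snd {F : ℝ × ℝ → E} {t x : ℝ} (h : DifferentiableAt ℝ F (t, x)) :
    HasDerivAt (fun y => F (t, y)) (fderiv ℝ F (t, x) (0, 1)) x :=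
  h.hasFDerivAt.comp_hasDerivAt x ((hasDerivAt_const x t).prodMk (hasDerivAt_id x))

/-- The partial derivatives of a twice continuously differentiable function of time and space. -/
theorem exists_partial_derivatives {J : Set ℝ} (hJ : IsOpen J) {φ : ℝ → ℝ → E}
    (h : ContDiffOn ℝ 2 (fun p : ℝ × ℝ => φ p.1 p.2) (J ×ˢ univ)) :
    ∃ φt φx φtt φxx : ℝ → ℝ → E,
      ContinuousOn (fun p : ℝ × ℝ => φ p.1 p.2) (J ×ˢ univ) ∧
      ContinuousOn (fun p : ℝ × ℝ => φt p.1 p.2) (J ×ˢ univ) ∧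
      ContinuousOn (fun p : ℝ × ℝ => φtt p.1 p.2) (J ×ˢ univ) ∧
      (∀ t ∈ J, ∀ x, HasDerivAt (fun s => φ s x) (φt t x) t) ∧
      (∀ t ∈ J, ∀ x, HasDerivAt (fun s => φt s x) (φtt t x) t) ∧
      (∀ t ∈ J, ∀ x, HasDerivAt (fun y => φ t y) (φx t x) x) ∧
      (∀ t ∈ J, ∀ x, HasDerivAt (fun y => φx t y) (φxx t x) x) := by
  set F : ℝ × ℝ → E := fun p => φ p.1 p.2 with hF
  have hO : IsOpen (J ×ˢ (univ : Set ℝ)) := hJ.prod isOpen_univ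
  have h1 : ∀ v, ContDiffOn ℝ 1 (fun p => fderiv ℝ F p v) (J ×ˢ univ) := fun v =>
    (h.fderiv_of_isOpen hO (by norm_num)).clm_apply contDiffOn_const
  have hd : ∀ {G : ℝ × ℝ → E}, ContDiffOn ℝ 1 G (J ×ˢ univ) → ∀ t ∈ J, ∀ x,
      DifferentiableAt ℝ G (t, x) := fun hG t ht x =>
    (hG.differentiableOn one_ne_zero).differentiableAt (hO.mem_nhds ⟨ht, trivial⟩)
  have h0 : ContDiffOn ℝ 1 F (J ×ˢ univ) := h.of_le (by norm_num)
  refine ⟨fun t x => fderiv ℝ F (t, x) (1, 0), fun t x => fderiv ℝ F (t, x) (0, 1),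
    fun t x => fderiv ℝ (fun p => fderiv ℝ F p (1, 0)) (t, x) (1, 0),
    fun t x => fderiv ℝ (fun p => fderiv ℝ F p (0, 1)) (t, x) (0, 1), h.continuousOn,
    (h1 _).continuousOn, ?_, fun t ht x => hasDerivAt_partial_fst (hd h0 t ht x),
    fun t ht x => hasDerivAt_partial_fst (hd (h1 (1, 0)) t ht x),
    fun t ht x => hasDerivAt_partial_snd (hd h0 t ht x),
    fun t ht x => hasDerivAt_partial_snd (hd (h1 (0, 1)) t ht x)⟩
  exact ((h1 (1, 0)).continuousOn_fderiv_of_isOpen hO le_rfl).clm_apply continuousOn_const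

theorem iteratedDeriv_two_eq {n : ℕ} {f f' : ℝ → Fin n → ℂ} {f'' : Fin n → ℂ} {t : ℝ}
    (h : ∀ᶠ s in 𝓝 t, HasDerivAt f (f' s) s) (h' : HasDerivAt f' f'' t) (a : Fin n) :
    iteratedDeriv 2 (fun s => f s a) t = f'' a := by
  rw [iteratedDeriv_succ, iteratedDeriv_one]
  have : deriv (fun s => f s a) =ᶠ[𝓝 t] fun s => f' s a :=
    h.mono fun s hs => (hasDerivAt_pi.mp hs a).deriv
  rw [this.deriv_eq]
  exact (hasDerivAt_pi.mp h' a).deriv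

end PartialDerivatives

section Gauge

variable {m : Type*} [Fintype m]

theorem hasDerivAt_matrix_iff {𝕜 : Type*} [NontriviallyNormedField 𝕜] [NormedAlgebra 𝕜 ℂ]
    {f : 𝕜 → Matrix m m ℂ} {f' : Matrix m m ℂ} {t : 𝕜} :
    HasDerivAt f f' t ↔ ∀ i j, HasDerivAt (fun s => f s i j) (f' i j) t :=
  (hasDerivAt_pi (φ := fun s i => f s i)).trans (forall_congr' fun _ => hasDerivAt_pi)

theorem HasDerivAt.matrix_transpose {𝕜 : Type*} [NontriviallyNormedField 𝕜] [NormedAlgebra 𝕜 ℂ]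
    {f : 𝕜 → Matrix m m ℂ} {f' : Matrix m m ℂ} {t : 𝕜} (h : HasDerivAt f f' t) :
    HasDerivAt (fun s => (f s).transpose) f'.transpose t :=
  hasDerivAt_matrix_iff.mpr fun i j => hasDerivAt_matrix_iff.mp h j i

theorem HasDerivAt.matrix_trace {𝕜 : Type*} [NontriviallyNormedField 𝕜] [NormedAlgebra 𝕜 ℂ]
    {f : 𝕜 → Matrix m m ℂ} {f' : Matrix m m ℂ} {t : 𝕜} (h : HasDerivAt f f' t) :
    HasDerivAt (fun s => (f s).trace) f'.trace t :=
  HasDerivAt.fun_sum fun i _ => hasDerivAt_matrix_iff.mp h i i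

variable [DecidableEq m]

/-- If `v` is the covariant derivative of `u`, then the parallel transport of `v` is the total
derivative of the parallel transport of `u`. -/
theorem pathExp_mul_integral_conj {a u u' v : ℝ → Matrix m m ℂ} (ha : Continuous a)
    (hvc : Continuous v) {x₀ x₁ : ℝ} (hu : ∀ x ∈ uIcc x₀ x₁, HasDerivAt u (u' x) x)
    (hv : ∀ x ∈ uIcc x₀ x₁, v x = u' x + u x * a x - a x * u x) :
    pathExp a x₀ x₁ * ∫ x in x₀..x₁, (pathExp a x₀ x)⁻¹ * v x * pathExp a x₀ x
      = u x₁ * pathExp a x₀ x₁ - pathExp a x₀ x₁ * u x₀ := by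
  have hd : ∀ x ∈ uIcc x₀ x₁, HasDerivAt (fun x => (pathExp a x₀ x)⁻¹ * u x * pathExp a x₀ x)
      ((pathExp a x₀ x)⁻¹ * v x * pathExp a x₀ x) x := fun x hx => by
    convert! ((hasDerivAt_inv_pathExp ha x₀ x).fun_mul (hu x hx)).fun_mul
      (hasDerivAt_pathExp ha x₀ x) using 1
    rw [hv x hx]
    noncomm_ring
  rw [intervalIntegral.integral_eq_sub_of_hasDerivAt hd
    ((((continuous_inv_pathExp ha x₀).mul hvc).mul (continuous_pathExp ha x₀)).intervalIntegrable
      _ _), pathExp_self, mul_sub, ← mul_assoc, ← mul_assoc,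
    Matrix.mul_nonsing_inv _ (isUnit_pathExp ha x₀ x₁)]
  simp

end Gauge

variable {g : Type*} [LieRing g] [LieAlgebra ℂ g] [Module.Finite ℂ g] [LieAlgebra.IsSimple ℂ g]
variable {H : LieSubalgebra ℂ g} [H.IsCartanSubalgebra]
variable {n : ℕ} (D : Generators g H n)
variable {m : Type*} [Fintype m] [DecidableEq m] (ρ : MatrixRep g m)

theorem continuous_rho_lax (Z : D.Idx → g) :
    Continuous fun p : (Fin n → ℂ) × (Fin n → ℂ) => ρ (D.lax Z p.1 p.2) :=
  D.continuous_map_lax (ρ : g →ₗ[ℂ] Matrix m m ℂ) Z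

theorem continuous_rho_dlax (Z : D.Idx → g) :
    Continuous fun p : (Fin n → ℂ) × (Fin n → ℂ) × (Fin n → ℂ) =>
      ρ (D.dlax Z p.1 p.2.1 p.2.2) :=
  D.continuous_map_dlax (ρ : g →ₗ[ℂ] Matrix m m ℂ) Z

theorem hasDerivAt_rho_lax {𝕜 : Type*} [NontriviallyNormedField 𝕜] [NormedAlgebra 𝕜 ℂ]
    (Z : D.Idx → g) {φ ψ : 𝕜 → Fin n → ℂ} {dφ dψ : Fin n → ℂ} {t : 𝕜} (hφ : HasDerivAt φ dφ t)
    (hψ : HasDerivAt ψ dψ t) :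
    HasDerivAt (fun t => ρ (D.lax Z (φ t) (ψ t))) (ρ (D.dlax Z (φ t) dφ dψ)) t :=
  D.hasDerivAt_map_lax (ρ : g →ₗ[ℂ] Matrix m m ℂ) Z hφ hψ

/-- The representation `x ↦ ρ(xᵗ)ᵀ`, in which the transposed transfer matrix is an ordered
exponential with the usual order. -/
def dualRep : MatrixRep g m where
  toFun x := (ρ (D.tr x)).transpose
  map_add' x y := by rw [map_add, map_add, Matrix.transpose_add]
  map_smul' c x := by rw [map_smul, map_smul, Matrix.transpose_smul, RingHom.id_apply]
  map_lie' {x y} := by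
    rw [D.tr_lie, rho_lie, Matrix.transpose_sub, Matrix.transpose_mul, Matrix.transpose_mul,
      Ring.lie_def]

theorem dualRep_apply (x : g) : dualRep D ρ x = (ρ (D.tr x)).transpose := rfl

variable {D} in
/-- Along a solution, the time derivative of the transfer matrix is a boundary term. -/
theorem hasDerivAt_transfer_of_isSolution {J : Set ℝ} (hJ : IsOpen J) {xm xp : ℝ}
    (hx : xm ≤ xp) {Am Ap : D.Idx → ℂ} {φ : ℝ → ℝ → Fin n → ℂ}
    (hφ : D.IsSolution J xm xp Am Ap φ) {l : ℝ} (hl : l ≠ 0) {t : ℝ} (ht : t ∈ J) :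
    HasDerivAt (fun s => transfer D ρ xm xp l (φ s) (fun x => deriv (fun s' => φ s' x) s))
      (transfer D ρ xm xp l (φ t) (fun x => deriv (fun s' => φ s' x) t)
          * ρ (D.laxT l (φ t xm) (D.durham Am (φ t xm)))
        - ρ (D.laxT l (φ t xp) (D.durham Ap (φ t xp)))
          * transfer D ρ xm xp l (φ t) (fun x => deriv (fun s' => φ s' x) t)) t := by
  obtain ⟨φt, φx, φtt, φxx, c0, ct, ctt, h1, h2, h3, h4⟩ := exists_partial_derivatives hJ hφ.smooth
  set a : ℝ → ℝ → Matrix m m ℂ := fun s x => -ρ (D.lax (D.genX l) (φ s x) (φt s x)) with ha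
  set v : ℝ → ℝ → Matrix m m ℂ := fun s x => ρ (D.dlax (D.genX l) (φ s x) (φt s x) (φtt s x))
    with hv
  have hT : ∀ s ∈ J, transfer D ρ xm xp l (φ s) (fun x => deriv (fun s' => φ s' x) s)
      = pathExp (a s) xm xp := by
    intro s hs
    rw [transfer]
    congr 1
    funext x
    rw [(h1 s hs x).deriv]
    rfl
  have hac : ContinuousOn (fun p : ℝ × ℝ => a p.1 p.2) (J ×ˢ univ) :=
    ((continuous_rho_lax D ρ (D.genX l)).comp_continuousOn (c0.prodMk ct)).neg
  have hvc : ContinuousOn (fun p : ℝ × ℝ => v p.1 p.2) (J ×ˢ univ) :=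
    (continuous_rho_dlax D ρ (D.genX l)).comp_continuousOn
      (f := fun p : ℝ × ℝ => (φ p.1 p.2, φt p.1 p.2, φtt p.1 p.2)) (c0.prodMk (ct.prodMk ctt))
  have hvc' : ContinuousOn (fun p : ℝ × ℝ => -v p.1 p.2) (J ×ˢ univ) := hvc.neg
  have had : ∀ s ∈ J, ∀ x, HasDerivAt (fun s => a s x) (-v s x) s := fun s hs x =>
    (hasDerivAt_rho_lax D ρ (D.genX l) (h1 s hs x) (h2 s hs x)).fun_neg
  have key := hasDerivAt_pathExp_param (𝕜 := ℝ) (a := a) (a' := fun s x => -v s x)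
    (hJ.mem_nhds ht) hac hvc' had xm xp
  have hcont : ∀ {u : ℝ → ℝ → Matrix m m ℂ},
      ContinuousOn (fun p : ℝ × ℝ => u p.1 p.2) (J ×ˢ univ) → Continuous (u t) := fun {u} hu =>
    hu.comp_continuous (f := fun y => (t, y)) (by fun_prop) fun y => ⟨ht, trivial⟩
  have hconj := pathExp_mul_integral_conj (x₀ := xm) (x₁ := xp) (a := a t) (v := v t)
    (u := fun x => ρ (D.lax (D.genT l) (φ t x) (φx t x)))
    (u' := fun x => ρ (D.dlax (D.genT l) (φ t x) (φx t x) (φxx t x))) (hcont hac) (hcont hvc)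
    (fun x _ => hasDerivAt_rho_lax D ρ (D.genT l) (h3 t ht x) (h4 t ht x)) (fun x hxI => by
      rw [uIcc_of_le hx] at hxI
      have hz := D.zero_curvature hl (φ := φ t x) (φt := φt t x) (φx := φx t x)
        (φtt := φtt t x) (φxx := φxx t x) fun b => by
          rw [← iteratedDeriv_two_eq (f := fun s => φ s x) (f' := fun s => φt s x)
              ((hJ.eventually_mem ht).mono fun s hs => h1 s hs x) (h2 t ht x),
            ← iteratedDeriv_two_eq (f := fun y => φ t y) (f' := fun y => φx t y)
              (Eventually.of_forall fun y => h3 t ht y) (h4 t ht x)]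
          exact hφ.eom t ht x hxI b
      simp only [hv, ha]
      rw [hz, map_add, rho_lie]
      noncomm_ring)
  have e : ∀ P : ℝ → Matrix m m ℂ, (∫ x in xm..xp, (P x)⁻¹ * -v t x * P x)
      = -∫ x in xm..xp, (P x)⁻¹ * v t x * P x := fun P => by
    rw [← intervalIntegral.integral_neg]
    simp only [mul_neg, neg_mul]
  rw [e, mul_neg, hconj, neg_sub] at key
  rw [hT t ht, D.laxT_eq, D.laxT_eq, ← hφ.bc_left t ht, ← hφ.bc_right t ht, (h3 t ht xm).deriv,
    (h3 t ht xp).deriv]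
  refine key.congr_of_eventuallyEq ?_
  filter_upwards [hJ.mem_nhds ht] with s hs
  exact hT s hs

variable {D ρ} in
/-- Conservation: the boundary terms at `x₊` and at `x₋` cancel by the boundary equations for `K₊`
and `K₋`. -/
theorem hasDerivAt_tau_of_isSolution {xm xp : ℝ} (hx : xm ≤ xp) {Ap Am : D.Idx → ℂ}
    {Λp Λm : Set ℝ} {Kp Km : ℝ → Matrix m m ℂ} (hp0 : 0 ∉ Λp) (hm0 : 0 ∉ Λm)
    (hp : SolvesIbc D ρ Ap Λp Kp) (hm : SolvesIbc D ρ Am Λm Km) {l : ℝ} (hlp : l ∈ Λp)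
    (hlm : l⁻¹ ∈ minusDomain Λm) {J : Set ℝ} {φ : ℝ → ℝ → Fin n → ℂ} (hJ : IsOpen J)
    (hφ : D.IsSolution J xm xp Am Ap φ) {t : ℝ} (ht : t ∈ J) :
    HasDerivAt (fun s => tau D ρ xm xp Kp (minusK Km) l (φ s)
      (fun x => deriv (fun s' => φ s' x) s)) 0 t := by
  have hl : l ≠ 0 := fun h => hp0 (h ▸ hlp)
  have h1 := hasDerivAt_transfer_of_isSolution ρ hJ hx hφ hl ht
  have h2 := hasDerivAt_transfer_of_isSolution (dualRep D ρ) hJ hx hφ (inv_ne_zero hl) ht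
  have h5 := HasDerivAt.matrix_trace (((h1.const_mul (Kp l)).mul_const (minusK Km l⁻¹)).fun_mul
    (HasDerivAt.matrix_transpose h2))
  convert! h5 using 1
  have hibc := hp l hlp (φ t xp)
  have hmbc := hm.solvesMbc hm0 l⁻¹ hlm (φ t xm)
  rw [inv_inv] at hmbc
  set T := transfer D ρ xm xp l (φ t) (fun x => deriv (fun s' => φ s' x) t)
  set T' := transfer D (dualRep D ρ) xm xp l⁻¹ (φ t) (fun x => deriv (fun s' => φ s' x) t)
  set N := minusK Km l⁻¹
  rw [Matrix.transpose_sub, Matrix.transpose_mul, Matrix.transpose_mul, dualRep_apply,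
    dualRep_apply, Matrix.transpose_transpose, Matrix.transpose_transpose]
  set B := ρ (D.laxT l (φ t xp) (D.durham Ap (φ t xp)))
  set B' := ρ (D.tr (D.laxT l⁻¹ (φ t xp) (D.durham Ap (φ t xp))))
  set C := ρ (D.laxT l (φ t xm) (D.durham Am (φ t xm)))
  set C' := ρ (D.tr (D.laxT l⁻¹ (φ t xm) (D.durham Am (φ t xm))))
  have e : Kp l * (T * C - B * T) * N * T'.transpose
        + Kp l * T * N * (C' * T'.transpose - T'.transpose * B')
      = Kp l * T * (N * C' + C * N) * T'.transpose
        - (Kp l * B * (T * N * T'.transpose) + Kp l * T * N * T'.transpose * B') := by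
    noncomm_ring
  rw [e, hmbc, mul_zero, zero_mul, zero_sub, Matrix.trace_neg, Matrix.trace_add,
    Matrix.trace_mul_comm _ B', mul_assoc (Kp l) T, mul_assoc (Kp l) (T * N), ← mul_assoc B',
    ← Matrix.trace_add, ← add_mul, hibc, zero_mul, Matrix.trace_zero, neg_zero]

end Conservation

/-! ### Contractions of the tensor square -/

section Pairing

variable {g : Type*} [LieRing g] [LieAlgebra ℂ g]

/-- The functional `V ⊗ V'` on `g ⊗ g`. -/
def pair (V V' : g →ₗ[ℂ] ℂ) : g ⊗[ℂ] g →ₗ[ℂ] ℂ := LinearMap.mul' ℂ ℂ ∘ₗ TensorProduct.map V V'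

@[simp]
theorem pair_tmul (V V' : g →ₗ[ℂ] ℂ) (y z : g) : pair V V' (y ⊗ₜ z) = V y * V' z := by
  simp [pair]

theorem pair_comp (V V' : g →ₗ[ℂ] ℂ) (f f' : g →ₗ[ℂ] g) (s : g ⊗[ℂ] g) :
    pair (V ∘ₗ f) (V' ∘ₗ f') s = pair V V' (TensorProduct.map f f' s) := by
  simp only [pair, TensorProduct.map_comp, LinearMap.comp_apply]

/-- If `V` and `V'` are transported by `ad A` and `ad A'`, then `V ⊗ V'` is transported by
`ad A ⊗ 1 + 1 ⊗ ad A'`. -/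
theorem hasDerivAt_pair {V V' : ℝ → g →ₗ[ℂ] ℂ} {A A' : g} {x : ℝ}
    (hV : ∀ y, HasDerivAt (fun x => V x y) (V x ⁅A, y⁆) x)
    (hV' : ∀ y, HasDerivAt (fun x => V' x y) (V' x ⁅A', y⁆) x) (s : g ⊗[ℂ] g) :
    HasDerivAt (fun x => pair (V x) (V' x) s) (pair (V x) (V' x) (act A A' s)) x := by
  induction s using TensorProduct.induction_on with
  | zero => simpa using hasDerivAt_const x (0 : ℂ)
  | tmul y z =>
    simp only [pair_tmul, act_tmul, map_add]
    exact (hV y).fun_mul (hV' z)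
  | add s s' hs hs' =>
    simp only [map_add]
    exact hs.fun_add hs'

end Pairing

section TraceForms

attribute [local instance 100] LieRing.ofAssociativeRing

variable {g : Type*} [LieRing g] [LieAlgebra ℂ g]
variable {m : Type*} [Fintype m] [DecidableEq m] (ρ : MatrixRep g m)

/-- The functional `y ↦ tr (ρ(y) R)`. -/
def traceForm (R : Matrix m m ℂ) : g →ₗ[ℂ] ℂ :=
  Matrix.traceLinearMap m ℂ ℂ ∘ₗ LinearMap.mulRight ℂ R ∘ₗ (ρ : g →ₗ[ℂ] Matrix m m ℂ)

theorem traceForm_apply (R : Matrix m m ℂ) (y : g) : traceForm ρ R y = (ρ y * R).trace := rfl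

theorem pair_traceForm (R R' : Matrix m m ℂ) (s : g ⊗[ℂ] g) :
    pair (traceForm ρ R) (traceForm ρ R') s = (rep2 ρ s * (leg1 R * leg2 R')).trace := by
  induction s using TensorProduct.induction_on with
  | zero => simp
  | tmul y z =>
    rw [pair_tmul, rep2_tmul, leg1_mul_leg2, ← Matrix.mul_kronecker_mul, Matrix.trace_kronecker,
      traceForm_apply, traceForm_apply]
  | add s s' hs hs' => rw [map_add, hs, hs', map_add, add_mul, Matrix.trace_add]

/-- This and the next three lemmas bring the four terms of `fourPair` at an end of the interval to
the form of the four terms of a reflection equation. The names record the order of the factors `F`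
and `K` in each leg. -/
theorem trace_mul_leg_FK_FK (K₁ K₂ F₁ F₂ : Matrix m m ℂ) (X : Matrix (m × m) (m × m) ℂ) :
    (X * (leg1 (F₁ * K₁) * leg2 (F₂ * K₂))).trace
      = (leg1 K₁ * leg2 K₂ * X * (leg1 F₁ * leg2 F₂)).trace := by
  have e : leg1 (F₁ * K₁) * leg2 (F₂ * K₂) = leg1 F₁ * leg2 F₂ * (leg1 K₁ * leg2 K₂) := by
    simp only [leg1_mul_leg2, ← Matrix.mul_kronecker_mul]
  rw [e, ← mul_assoc, Matrix.trace_mul_cycle]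

theorem trace_mul_leg_FK_KF (K₁ K₂ F₁ F₂ : Matrix m m ℂ) (X : Matrix (m × m) (m × m) ℂ) :
    (X * (leg1 (F₁ * K₁) * leg2 (K₂ * F₂))).trace
      = (leg1 K₁ * X * leg2 K₂ * (leg1 F₁ * leg2 F₂)).trace := by
  have e : leg1 (F₁ * K₁) * leg2 (K₂ * F₂) = leg2 K₂ * (leg1 F₁ * leg2 F₂) * leg1 K₁ := by
    simp only [leg1, leg2, ← Matrix.mul_kronecker_mul, one_mul, mul_one]
  rw [e, ← mul_assoc, Matrix.trace_mul_comm]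
  simp only [mul_assoc]

theorem trace_mul_leg_KF_FK (K₁ K₂ F₁ F₂ : Matrix m m ℂ) (X : Matrix (m × m) (m × m) ℂ) :
    (X * (leg1 (K₁ * F₁) * leg2 (F₂ * K₂))).trace
      = (leg2 K₂ * X * leg1 K₁ * (leg1 F₁ * leg2 F₂)).trace := by
  have e : leg1 (K₁ * F₁) * leg2 (F₂ * K₂) = leg1 K₁ * (leg1 F₁ * leg2 F₂) * leg2 K₂ := by
    simp only [leg1, leg2, ← Matrix.mul_kronecker_mul, one_mul, mul_one]
  rw [e, ← mul_assoc, Matrix.trace_mul_comm]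
  simp only [mul_assoc]

theorem trace_mul_leg_KF_KF (K₁ K₂ F₁ F₂ : Matrix m m ℂ) (X : Matrix (m × m) (m × m) ℂ) :
    (X * (leg1 (K₁ * F₁) * leg2 (K₂ * F₂))).trace
      = (X * leg1 K₁ * leg2 K₂ * (leg1 F₁ * leg2 F₂)).trace := by
  have e : leg1 (K₁ * F₁) * leg2 (K₂ * F₂) = leg1 K₁ * leg2 K₂ * (leg1 F₁ * leg2 F₂) := by
    simp only [leg1_mul_leg2, ← Matrix.mul_kronecker_mul]
  rw [e]
  simp only [mul_assoc]

end TraceForms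

/-! ### The canonical bracket in terms of the `r`-matrix -/

section Bracket

variable {g : Type*} [LieRing g] [LieAlgebra ℂ g] [Module.Finite ℂ g] [LieAlgebra.IsSimple ℂ g]
variable {H : LieSubalgebra ℂ g} [H.IsCartanSubalgebra]

namespace Generators

variable {n : ℕ} (D : Generators g H n)

theorem act_genX_rMatrix {l₁ l₂ : ℝ} (h₁ : l₁ ≠ 0) (h₂ : l₂ ≠ 0)
    (hl : (l₁ / l₂) ^ D.cox ≠ 1) (j : D.Idx) :
    act (D.genX l₁ j) (D.genX l₂ j) (D.rMatrix (l₁ / l₂))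
      = (D.rootH (D.aroot j) : g) ⊗ₜ D.genX l₂ j
        - D.genX l₁ j ⊗ₜ (D.rootH (D.aroot j) : g) := by
  have hl' : ((l₁ / l₂ : ℝ) : ℂ) ^ D.cox ≠ 1 := by exact_mod_cast hl
  rw [genX, genX, act_add]
  simp only [LinearMap.add_apply, D.act_E_rMatrix h₁ h₂ hl' j, D.act_E_negRoot_rMatrix h₁ h₂ hl j,
    TensorProduct.tmul_add, TensorProduct.add_tmul]
  abel

/-- The variation of the `r`-matrix under the space component of the Lax connection. -/
theorem act_lax_rMatrix {l₁ l₂ : ℝ} (h₁ : l₁ ≠ 0) (h₂ : l₂ ≠ 0)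
    (hl : (l₁ / l₂) ^ D.cox ≠ 1) (φ ψ : Fin n → ℂ) :
    act (D.lax (D.genX l₁) φ ψ) (D.lax (D.genX l₂) φ ψ) (D.rMatrix (l₁ / l₂))
      = ∑ j, D.weight j φ • ((D.rootH (D.aroot j) : g) ⊗ₜ D.genX l₂ j
        - D.genX l₁ j ⊗ₜ (D.rootH (D.aroot j) : g)) := by
  have hcar : (1 / 2 : ℂ) • D.cartan ψ = (((1 / 2 : ℂ) • ∑ a, ψ a • D.Hb a : H) : g) := by
    simp [cartan]
  rw [lax, lax, act_add, hcar, LinearMap.add_apply, D.act_cartan_rMatrix, zero_add, act_sum,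
    LinearMap.sum_apply]
  refine Finset.sum_congr rfl fun j _ => ?_
  rw [act_smul, LinearMap.smul_apply, D.act_genX_rMatrix h₁ h₂ hl]

/-- The gradient with respect to `φ` of `-W(a)`, where `a = lax Z φ ψ`. -/
def gradPhi (Z : D.Idx → g) (φ : Fin n → ℂ) (W : g →ₗ[ℂ] ℂ) : Fin n → ℂ := fun a =>
  -(1 / 2) * ∑ i, D.weight i φ * rootVec D.Hb (D.aroot i) a * W (Z i)

/-- The gradient with respect to `ψ` of `-W(a)`, where `a = lax Z φ ψ`; it does not depend on the
fields. -/
def gradPi (W : g →ₗ[ℂ] ℂ) : Fin n → ℂ := fun a => -(1 / 2) * W (D.Hb a)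

/-- `gradPhi` and `gradPi` are the gradients of minus the functional `W` of the Lax connection. -/
theorem neg_apply_dlax (Z : D.Idx → g) (φ dφ dψ : Fin n → ℂ) (W : g →ₗ[ℂ] ℂ) :
    -W (D.dlax Z φ dφ dψ) = ∑ a, (D.gradPhi Z φ W a * dφ a + D.gradPi W a * dψ a) := by
  rw [map_dlax]
  have h1 : ∑ a, D.gradPhi Z φ W a * dφ a
      = -∑ i, (D.weight i φ * (D.adot i dφ / 2)) • W (Z i) := by
    simp only [gradPhi, adot, Finset.mul_sum, Finset.sum_mul, Finset.sum_div, smul_eq_mul]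
    rw [Finset.sum_comm, ← Finset.sum_neg_distrib]
    refine Finset.sum_congr rfl fun i _ => ?_
    rw [← Finset.sum_neg_distrib]
    exact Finset.sum_congr rfl fun a _ => by ring
  rw [Finset.sum_add_distrib, h1, neg_add_rev]
  congr 1
  rw [← Finset.sum_neg_distrib]
  exact Finset.sum_congr rfl fun a _ => by rw [gradPi, smul_eq_mul]; ring

/-- The canonical bracket of the gradients is governed by the `r`-matrix. -/
theorem sum_grad_eq {l₁ l₂ : ℝ} (h₁ : l₁ ≠ 0) (h₂ : l₂ ≠ 0) (hl : (l₁ / l₂) ^ D.cox ≠ 1)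
    (φ ψ : Fin n → ℂ) (W W' : g →ₗ[ℂ] ℂ) :
    ∑ a, (D.gradPhi (D.genX l₁) φ W a * D.gradPi W' a
        - D.gradPi W a * D.gradPhi (D.genX l₂) φ W' a)
      = -(1 / 4) * pair W W' (act (D.lax (D.genX l₁) φ ψ) (D.lax (D.genX l₂) φ ψ)
          (D.rMatrix (l₁ / l₂))) := by
  rw [D.act_lax_rMatrix h₁ h₂ hl]
  have hW : ∀ (V : g →ₗ[ℂ] ℂ) (i : D.Idx), V (D.rootH (D.aroot i))
      = ∑ a, rootVec D.Hb (D.aroot i) a * V (D.Hb a) := fun V i => by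
    rw [← cartan_rootVec, cartan, map_sum]
    exact Finset.sum_congr rfl fun a _ => by rw [map_smul, smul_eq_mul]
  have hL : ∀ a, D.gradPhi (D.genX l₁) φ W a * D.gradPi W' a
      - D.gradPi W a * D.gradPhi (D.genX l₂) φ W' a
      = ∑ i, -(1 / 4) * (D.weight i φ * (rootVec D.Hb (D.aroot i) a * W (D.Hb a)
        * W' (D.genX l₂ i) - W (D.genX l₁ i) * (rootVec D.Hb (D.aroot i) a * W' (D.Hb a)))) := by
    intro a
    simp only [gradPhi, gradPi, Finset.mul_sum, Finset.sum_mul]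
    rw [← Finset.sum_sub_distrib]
    exact Finset.sum_congr rfl fun i _ => by ring
  rw [Finset.sum_congr rfl fun a _ => hL a, Finset.sum_comm, map_sum, Finset.mul_sum]
  refine Finset.sum_congr rfl fun i _ => ?_
  rw [map_smul, map_sub, pair_tmul, pair_tmul, hW, hW, Finset.sum_mul, Finset.mul_sum,
    ← Finset.sum_sub_distrib, smul_eq_mul, Finset.mul_sum, Finset.mul_sum]

end Generators

end Bracket

/-! ### The bracket as a boundary term -/

section Involution

attribute [local instance 100] LieRing.ofAssociativeRing
open scoped Matrix.Norms.Operator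
open MeasureTheory Set Filter Topology

variable {g : Type*} [LieRing g] [LieAlgebra ℂ g] [Module.Finite ℂ g] [LieAlgebra.IsSimple ℂ g]
variable {H : LieSubalgebra ℂ g} [H.IsCartanSubalgebra]
variable {n : ℕ} (D : Generators g H n)
variable {m : Type*} [Fintype m] [DecidableEq m] (ρ : MatrixRep g m)

theorem traceForm_dualRep (R : Matrix m m ℂ) :
    traceForm (dualRep D ρ) R = traceForm ρ R.transpose ∘ₗ D.tr := by
  ext y
  rw [LinearMap.comp_apply, traceForm_apply, traceForm_apply, dualRep_apply,
    ← Matrix.trace_transpose, Matrix.transpose_mul, Matrix.transpose_transpose,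
    Matrix.trace_mul_comm]

variable {D} in
theorem pair_comp_tr_right (V V' : g →ₗ[ℂ] ℂ) (s : g ⊗[ℂ] g) :
    pair V (V' ∘ₗ D.tr) s = pair V V' (D.tr2 s) :=
  pair_comp V V' LinearMap.id D.tr s

variable {D} in
theorem pair_comp_tr_left (V V' : g →ₗ[ℂ] ℂ) (s : g ⊗[ℂ] g) :
    pair (V ∘ₗ D.tr) V' s = pair V V' (D.tr1 s) :=
  pair_comp V V' D.tr LinearMap.id s

variable {D} in
theorem pair_comp_tr_both (V V' : g →ₗ[ℂ] ℂ) (s : g ⊗[ℂ] g) :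
    pair (V ∘ₗ D.tr) (V' ∘ₗ D.tr) s = pair V V' (D.tr12 s) :=
  pair_comp V V' D.tr D.tr s

/-- The sum of the four contractions with the `r`-matrix which belong to the pairs of factors of two
traces `tr (K T(λ) N Tᵗ(1/λ))`: unprimed functionals belong to `T(λ)`, primed ones to `Tᵗ(1/λ)`,
whence the inverted spectral parameters. -/
def fourPair (l₁ l₂ : ℝ) (V₁ V₁' V₂ V₂' : g →ₗ[ℂ] ℂ) : ℂ :=
  pair V₁ V₂ (D.rMatrix (l₁ / l₂)) + pair V₁ V₂' (D.rMatrix (l₁ / l₂⁻¹))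
    + pair V₁' V₂ (D.rMatrix (l₁⁻¹ / l₂)) + pair V₁' V₂' (D.rMatrix (l₁⁻¹ / l₂⁻¹))

variable {D ρ} in
/-- At the right end the four contractions add up to the reflection equation for `K₊`. -/
theorem SolvesRefl.fourPair_eq_zero {Λ : Set ℝ} {K : ℝ → Matrix m m ℂ} (h : SolvesRefl D ρ Λ K)
    {l₁ l₂ : ℝ} (hl₁ : l₁ ∈ Λ) (hl₂ : l₂ ∈ Λ) (hd : (l₁ / l₂) ^ D.cox ≠ 1)
    (hm : (l₁ * l₂) ^ D.cox ≠ 1) (G₁ G₂ : Matrix m m ℂ) :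
    fourPair D l₁ l₂ (traceForm ρ (G₁ * K l₁)) (traceForm ρ (K l₁ * G₁) ∘ₗ D.tr)
      (traceForm ρ (G₂ * K l₂)) (traceForm ρ (K l₂ * G₂) ∘ₗ D.tr) = 0 := by
  have e1 : l₁ / l₂⁻¹ = l₁ * l₂ := div_inv_eq_mul _ _
  have e2 : l₁⁻¹ / l₂ = (l₁ * l₂)⁻¹ := by rw [mul_inv, div_eq_mul_inv]
  have e3 : l₁⁻¹ / l₂⁻¹ = l₂ / l₁ := by rw [div_inv_eq_mul, inv_mul_eq_div]
  rw [fourPair, e1, e2, e3, pair_comp_tr_right, pair_comp_tr_left, pair_comp_tr_both,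
    pair_traceForm, pair_traceForm, pair_traceForm, pair_traceForm, trace_mul_leg_FK_FK,
    trace_mul_leg_FK_KF, trace_mul_leg_KF_FK, trace_mul_leg_KF_KF]
  have := congrArg (fun X => (X * (leg1 G₁ * leg2 G₂)).trace) (h l₁ hl₁ l₂ hl₂ hd hm)
  simp only [add_mul, Matrix.trace_add, zero_mul, Matrix.trace_zero] at this
  linear_combination this

variable {D ρ} in
/-- At the left end the four contractions add up to the reflection equation for `K₋`. -/
theorem SolvesMrefl.fourPair_eq_zero {Λ : Set ℝ} {K : ℝ → Matrix m m ℂ} (h : SolvesMrefl D ρ Λ K)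
    {l₁ l₂ : ℝ} (hl₁ : l₁⁻¹ ∈ Λ) (hl₂ : l₂⁻¹ ∈ Λ) (hd : (l₁ / l₂) ^ D.cox ≠ 1)
    (hm : (l₁ * l₂) ^ D.cox ≠ 1) (F₁ F₂ : Matrix m m ℂ) :
    fourPair D l₁ l₂ (traceForm ρ (K l₁⁻¹ * F₁)) (traceForm ρ (F₁ * K l₁⁻¹) ∘ₗ D.tr)
      (traceForm ρ (K l₂⁻¹ * F₂)) (traceForm ρ (F₂ * K l₂⁻¹) ∘ₗ D.tr) = 0 := by
  have e1 : l₁ / l₂⁻¹ = (l₁⁻¹ * l₂⁻¹)⁻¹ := by rw [mul_inv, inv_inv, div_eq_mul_inv]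
  have e2 : l₁⁻¹ / l₂ = l₁⁻¹ * l₂⁻¹ := div_eq_mul_inv _ _
  have e3 : l₁ / l₂ = l₂⁻¹ / l₁⁻¹ := by rw [div_inv_eq_mul, inv_mul_eq_div]
  have hinv : ∀ {x : ℝ}, x ^ D.cox ≠ 1 → x⁻¹ ^ D.cox ≠ 1 := fun h => by
    rwa [inv_zpow, ne_eq, inv_eq_one]
  have hd' : (l₁⁻¹ / l₂⁻¹) ^ D.cox ≠ 1 := by
    have := hinv hd
    rwa [inv_div, ← inv_mul_eq_div, ← div_inv_eq_mul] at this
  have hm' : (l₁⁻¹ * l₂⁻¹) ^ D.cox ≠ 1 := by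
    have := hinv hm
    rwa [mul_inv] at this
  rw [fourPair, e1, e2, e3, pair_comp_tr_right, pair_comp_tr_left, pair_comp_tr_both,
    pair_traceForm, pair_traceForm, pair_traceForm, pair_traceForm,
    trace_mul_leg_KF_KF (K l₁⁻¹) (K l₂⁻¹) F₁ F₂, trace_mul_leg_KF_FK (K l₁⁻¹) (K l₂⁻¹) F₁ F₂,
    trace_mul_leg_FK_KF (K l₁⁻¹) (K l₂⁻¹) F₁ F₂, trace_mul_leg_FK_FK (K l₁⁻¹) (K l₂⁻¹) F₁ F₂]
  have := congrArg (fun X => (X * (leg1 F₁ * leg2 F₂)).trace) (h _ hl₁ _ hl₂ hd' hm')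
  simp only [add_mul, Matrix.trace_add, zero_mul, Matrix.trace_zero] at this
  linear_combination this

section Gradients

variable (xm xp : ℝ) (φ π : ℝ → Fin n → ℂ)

/-- The functional `y ↦ tr (ρ(y) P(x) M P(x)⁻¹)`, where `P(x)` is the transfer matrix from `x₋`
to `x`. -/
def waveForm (l : ℝ) (M : Matrix m m ℂ) (x : ℝ) : g →ₗ[ℂ] ℂ :=
  traceForm ρ (transfer D ρ xm x l φ π * M * (transfer D ρ xm x l φ π)⁻¹)

/-- The response of `tr (K T(λ) N Tᵗ(1/λ))` to a variation of minus the Lax connection inside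
`T(λ)`. -/
def fwdForm (l : ℝ) (K N : Matrix m m ℂ) (x : ℝ) : g →ₗ[ℂ] ℂ :=
  waveForm D ρ xm φ π l (N * (transfer D (dualRep D ρ) xm xp l⁻¹ φ π).transpose * K
    * transfer D ρ xm xp l φ π) x

/-- The response of `tr (K T(λ) N Tᵗ(1/λ))` to a variation of minus the Lax connection inside
`Tᵗ(1/λ)`, which is the transpose of a transfer matrix for `dualRep`. -/
def bwdForm (l : ℝ) (K N : Matrix m m ℂ) (x : ℝ) : g →ₗ[ℂ] ℂ :=
  waveForm D (dualRep D ρ) xm φ π l⁻¹ ((K * transfer D ρ xm xp l φ π * N).transpose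
    * transfer D (dualRep D ρ) xm xp l⁻¹ φ π) x

/-- The functional derivative of `tr (K T(λ) N Tᵗ(1/λ))` with respect to `φ`. -/
def derivPhi (l : ℝ) (K N : Matrix m m ℂ) (x : ℝ) : Fin n → ℂ :=
  D.gradPhi (D.genX l) (φ x) (fwdForm D ρ xm xp φ π l K N x)
    + D.gradPhi (D.genX l⁻¹) (φ x) (bwdForm D ρ xm xp φ π l K N x)

/-- The functional derivative of `tr (K T(λ) N Tᵗ(1/λ))` with respect to `π`. -/
def derivPi (l : ℝ) (K N : Matrix m m ℂ) (x : ℝ) : Fin n → ℂ :=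
  D.gradPi (fwdForm D ρ xm xp φ π l K N x) + D.gradPi (bwdForm D ρ xm xp φ π l K N x)

variable {φ π}

theorem continuous_lax_field (l : ℝ) (hφ : Continuous φ) (hπ : Continuous π) :
    Continuous fun x => -ρ (D.laxX l (φ x) (π x)) :=
  ((continuous_rho_lax D ρ (D.genX l)).comp (f := fun x => (φ x, π x)) (hφ.prodMk hπ)).neg

theorem isUnit_transfer (l : ℝ) (hφ : Continuous φ) (hπ : Continuous π) :
    IsUnit (transfer D ρ xm xp l φ π).det :=
  isUnit_pathExp (continuous_lax_field D ρ l hφ hπ) xm xp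

theorem transfer_self (l : ℝ) (φ π : ℝ → Fin n → ℂ) : transfer D ρ xm xm l φ π = 1 :=
  pathExp_self _ _

/-- Since the transfer matrix `P` solves `∂ₓP = -a_x P`, the functionals are transported by the
adjoint action of `a_x`. -/
theorem hasDerivAt_waveForm (l : ℝ) (M : Matrix m m ℂ) (hφ : Continuous φ) (hπ : Continuous π)
    (x : ℝ) (y : g) :
    HasDerivAt (fun x => waveForm D ρ xm φ π l M x y)
      (waveForm D ρ xm φ π l M x ⁅D.lax (D.genX l) (φ x) (π x), y⁆) x := by
  have hc := continuous_lax_field D ρ l hφ hπ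
  have h1 : HasDerivAt (fun x => transfer D ρ xm x l φ π) _ x := hasDerivAt_pathExp hc xm x
  have h2 : HasDerivAt (fun x => (transfer D ρ xm x l φ π)⁻¹) _ x :=
    hasDerivAt_inv_pathExp hc xm x
  have h3 := HasDerivAt.matrix_trace (((h1.mul_const M).fun_mul h2).const_mul (ρ y))
  convert! h3 using 1
  rw [waveForm, traceForm_apply, rho_lie, ← D.laxX_eq]
  change _ = Matrix.trace (ρ y * (-ρ (D.laxX l (φ x) (π x)) * transfer D ρ xm x l φ π * M
    * (transfer D ρ xm x l φ π)⁻¹ + transfer D ρ xm x l φ π * M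
    * -((transfer D ρ xm x l φ π)⁻¹ * -ρ (D.laxX l (φ x) (π x)))))
  set A := ρ (D.laxX l (φ x) (π x))
  set P := transfer D ρ xm x l φ π
  have e1 : (A * ρ y - ρ y * A) * (P * M * P⁻¹)
      = A * (ρ y * (P * M * P⁻¹)) - ρ y * A * (P * M * P⁻¹) := by noncomm_ring
  have e2 : ρ y * (-A * P * M * P⁻¹ + P * M * -(P⁻¹ * -A))
      = ρ y * (P * M * P⁻¹) * A - ρ y * A * (P * M * P⁻¹) := by noncomm_ring
  rw [e1, e2, Matrix.trace_sub, Matrix.trace_sub, Matrix.trace_mul_comm A]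

/-- Transport of two functionals changes their contraction with the `r`-matrix by the variation of
the `r`-matrix under the Lax connection, which is the canonical bracket of the gradients. -/
theorem hasDerivAt_pair_waveForm {l₁ l₂ : ℝ} (h₁ : l₁ ≠ 0) (h₂ : l₂ ≠ 0)
    (hl : (l₁ / l₂) ^ D.cox ≠ 1) (ρ' : MatrixRep g m) (M M' : Matrix m m ℂ) (hφ : Continuous φ)
    (hπ : Continuous π) (x : ℝ) :
    HasDerivAt (fun x => pair (waveForm D ρ xm φ π l₁ M x) (waveForm D ρ' xm φ π l₂ M' x)
        (D.rMatrix (l₁ / l₂)))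
      (-4 * ∑ a, (D.gradPhi (D.genX l₁) (φ x) (waveForm D ρ xm φ π l₁ M x) a
          * D.gradPi (waveForm D ρ' xm φ π l₂ M' x) a
        - D.gradPi (waveForm D ρ xm φ π l₁ M x) a
          * D.gradPhi (D.genX l₂) (φ x) (waveForm D ρ' xm φ π l₂ M' x) a)) x := by
  rw [D.sum_grad_eq h₁ h₂ hl (φ x) (π x)]
  convert! hasDerivAt_pair (fun y => hasDerivAt_waveForm D ρ xm l₁ M hφ hπ x y)
    (fun y => hasDerivAt_waveForm D ρ' xm l₂ M' hφ hπ x y) (D.rMatrix (l₁ / l₂)) using 1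
  ring

theorem fwdForm_right (l : ℝ) (K N : Matrix m m ℂ) (hφ : Continuous φ) (hπ : Continuous π) :
    fwdForm D ρ xm xp φ π l K N xp = traceForm ρ (transfer D ρ xm xp l φ π * N
      * (transfer D (dualRep D ρ) xm xp l⁻¹ φ π).transpose * K) := by
  rw [fwdForm, waveForm, ← mul_assoc, Matrix.mul_nonsing_inv_cancel_right _ _
    (isUnit_transfer D ρ xm xp l hφ hπ)]
  simp only [mul_assoc]

theorem bwdForm_right (l : ℝ) (K N : Matrix m m ℂ) (hφ : Continuous φ) (hπ : Continuous π) :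
    bwdForm D ρ xm xp φ π l K N xp = traceForm ρ (K * (transfer D ρ xm xp l φ π * N
      * (transfer D (dualRep D ρ) xm xp l⁻¹ φ π).transpose)) ∘ₗ D.tr := by
  rw [bwdForm, waveForm, ← mul_assoc, Matrix.mul_nonsing_inv_cancel_right _ _
    (isUnit_transfer D (dualRep D ρ) xm xp l⁻¹ hφ hπ), traceForm_dualRep, Matrix.transpose_mul,
    Matrix.transpose_transpose]
  simp only [mul_assoc]

theorem fwdForm_left (l : ℝ) (K N : Matrix m m ℂ) (φ π : ℝ → Fin n → ℂ) :
    fwdForm D ρ xm xp φ π l K N xm = traceForm ρ (N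
      * ((transfer D (dualRep D ρ) xm xp l⁻¹ φ π).transpose * K * transfer D ρ xm xp l φ π)) := by
  rw [fwdForm, waveForm, transfer_self, inv_one, mul_one, one_mul]
  simp only [mul_assoc]

theorem bwdForm_left (l : ℝ) (K N : Matrix m m ℂ) (φ π : ℝ → Fin n → ℂ) :
    bwdForm D ρ xm xp φ π l K N xm = traceForm ρ
      ((transfer D (dualRep D ρ) xm xp l⁻¹ φ π).transpose * K * transfer D ρ xm xp l φ π * N)
        ∘ₗ D.tr := by
  rw [bwdForm, waveForm, transfer_self, inv_one, mul_one, one_mul, traceForm_dualRep,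
    Matrix.transpose_mul, Matrix.transpose_transpose]
  simp only [mul_assoc]

/-- The integrand of the bracket is the derivative of the four contractions with the
`r`-matrix. -/
theorem hasDerivAt_fourPair {l₁ l₂ : ℝ} (h₁ : l₁ ≠ 0) (h₂ : l₂ ≠ 0)
    (hd : (l₁ / l₂) ^ D.cox ≠ 1) (hm : (l₁ * l₂) ^ D.cox ≠ 1) (K₁ N₁ K₂ N₂ : Matrix m m ℂ)
    (hφ : Continuous φ) (hπ : Continuous π) (x : ℝ) :
    HasDerivAt (fun x => fourPair D l₁ l₂ (fwdForm D ρ xm xp φ π l₁ K₁ N₁ x)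
        (bwdForm D ρ xm xp φ π l₁ K₁ N₁ x) (fwdForm D ρ xm xp φ π l₂ K₂ N₂ x)
        (bwdForm D ρ xm xp φ π l₂ K₂ N₂ x))
      (-4 * ∑ a, (derivPhi D ρ xm xp φ π l₁ K₁ N₁ x a * derivPi D ρ xm xp φ π l₂ K₂ N₂ x a
        - derivPi D ρ xm xp φ π l₁ K₁ N₁ x a * derivPhi D ρ xm xp φ π l₂ K₂ N₂ x a)) x := by
  have hinv : ∀ {x : ℝ}, x ^ D.cox ≠ 1 → x⁻¹ ^ D.cox ≠ 1 := fun h => by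
    rwa [inv_zpow, ne_eq, inv_eq_one]
  have h12 : (l₁ / l₂⁻¹) ^ D.cox ≠ 1 := by rwa [div_inv_eq_mul]
  have h21 : (l₁⁻¹ / l₂) ^ D.cox ≠ 1 := by rw [div_eq_mul_inv, ← mul_inv]; exact hinv hm
  have h22 : (l₁⁻¹ / l₂⁻¹) ^ D.cox ≠ 1 := by
    rw [div_inv_eq_mul, inv_mul_eq_div, ← inv_div]; exact hinv hd
  have k := (((hasDerivAt_pair_waveForm D ρ xm h₁ h₂ hd ρ (N₁ *
    (transfer D (dualRep D ρ) xm xp l₁⁻¹ φ π).transpose * K₁ * transfer D ρ xm xp l₁ φ π) (N₂ *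
    (transfer D (dualRep D ρ) xm xp l₂⁻¹ φ π).transpose * K₂ * transfer D ρ xm xp l₂ φ π)
    hφ hπ x).fun_add (hasDerivAt_pair_waveForm D ρ xm h₁ (inv_ne_zero h₂) h12 (dualRep D ρ) (N₁ *
    (transfer D (dualRep D ρ) xm xp l₁⁻¹ φ π).transpose * K₁ * transfer D ρ xm xp l₁ φ π)
    ((K₂ * transfer D ρ xm xp l₂ φ π * N₂).transpose * transfer D (dualRep D ρ) xm xp l₂⁻¹ φ π)
    hφ hπ x)).fun_add (hasDerivAt_pair_waveForm D (dualRep D ρ) xm (inv_ne_zero h₁) h₂ h21 ρ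
    ((K₁ * transfer D ρ xm xp l₁ φ π * N₁).transpose * transfer D (dualRep D ρ) xm xp l₁⁻¹ φ π)
    (N₂ * (transfer D (dualRep D ρ) xm xp l₂⁻¹ φ π).transpose * K₂ * transfer D ρ xm xp l₂ φ π)
    hφ hπ x)).fun_add (hasDerivAt_pair_waveForm D (dualRep D ρ) xm (inv_ne_zero h₁)
    (inv_ne_zero h₂) h22 (dualRep D ρ)
    ((K₁ * transfer D ρ xm xp l₁ φ π * N₁).transpose * transfer D (dualRep D ρ) xm xp l₁⁻¹ φ π)
    ((K₂ * transfer D ρ xm xp l₂ φ π * N₂).transpose * transfer D (dualRep D ρ) xm xp l₂⁻¹ φ π)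
    hφ hπ x)
  refine k.congr_deriv ?_
  rw [← mul_add, ← mul_add, ← mul_add, ← Finset.sum_add_distrib, ← Finset.sum_add_distrib,
    ← Finset.sum_add_distrib]
  congr 1
  refine Finset.sum_congr rfl fun a _ => ?_
  simp only [derivPhi, derivPi, fwdForm, bwdForm, Pi.add_apply]
  ring

end Gradients

end Involution

/-! ### Functional derivatives and involution -/

section FunctionalDerivatives

attribute [local instance 100] LieRing.ofAssociativeRing
open scoped Matrix.Norms.Operator
open MeasureTheory Set Filter Topology

section Integrals

variable {m : Type*} [Fintype m] [DecidableEq m]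

theorem trace_mul_integral (A : Matrix m m ℂ) {F : ℝ → Matrix m m ℂ} (hF : Continuous F)
    (a b : ℝ) : (A * ∫ x in a..b, F x).trace = ∫ x in a..b, (A * F x).trace :=
  ((LinearMap.toContinuousLinearMap (Matrix.traceLinearMap m ℂ ℂ ∘ₗ
    LinearMap.mulLeft ℂ A)).intervalIntegral_comp_comm (hF.intervalIntegrable a b)).symm

theorem continuous_inv_pathExp_param {X : Type*} [TopologicalSpace X]
    {a : X → ℝ → Matrix m m ℂ} (ha : Continuous fun p : X × ℝ => a p.1 p.2) (x₀ : ℝ) :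
    Continuous fun p : X × ℝ => (pathExp (a p.1) x₀ p.2)⁻¹ := by
  have h : (fun p : X × ℝ => (pathExp (a p.1) x₀ p.2)⁻¹)
      = fun p => (pathExp (fun x => (-a p.1 x).transpose) x₀ p.2).transpose :=
    funext fun p => inv_pathExp (ha.comp (Continuous.prodMk_right p.1)) x₀ p.2
  rw [h]
  exact (continuous_pathExp_param (a := fun s x => (-a s x).transpose)
    (ha.neg.matrix_transpose) x₀).matrix_transpose

end Integrals

variable {g : Type*} [LieRing g] [LieAlgebra ℂ g] [Module.Finite ℂ g] [LieAlgebra.IsSimple ℂ g]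
variable {H : LieSubalgebra ℂ g} [H.IsCartanSubalgebra]
variable {n : ℕ} (D : Generators g H n)
variable {m : Type*} [Fintype m] [DecidableEq m] (ρ : MatrixRep g m)
variable (xm xp : ℝ) {φ π : ℝ → Fin n → ℂ}

section Continuity

variable {X : Type*} [TopologicalSpace X] {c : X → ℝ} {K N : X → Matrix m m ℂ}

theorem continuous_rho_genX (hc : Continuous c) (h0 : ∀ s, c s ≠ 0) (i : D.Idx) :
    Continuous fun s => ρ (D.genX (c s) i) := by
  have h : (fun s => ρ (D.genX (c s) i)) = fun s => ((c s : ℝ) : ℂ) • ρ (D.E (D.aroot i))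
      + ((c s : ℝ) : ℂ)⁻¹ • ρ (D.E (negRoot (D.aroot i))) := by
    funext s
    rw [Generators.genX, map_add, map_smul, map_smul]
  rw [h]
  have h1 : Continuous fun s => ((c s : ℝ) : ℂ) := Complex.continuous_ofReal.comp hc
  have h2 : Continuous fun s => ((c s : ℝ) : ℂ)⁻¹ := h1.inv₀ fun s => by exact_mod_cast h0 s
  exact (h1.smul continuous_const).add (h2.smul continuous_const)

theorem continuous_rho_laxX (hc : Continuous c) (h0 : ∀ s, c s ≠ 0) (hφ : Continuous φ)
    (hπ : Continuous π) :
    Continuous fun p : X × ℝ => -ρ (D.laxX (c p.1) (φ p.2) (π p.2)) := by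
  have h : (fun p : X × ℝ => -ρ (D.laxX (c p.1) (φ p.2) (π p.2))) = fun p =>
      -(∑ a, ((1 / 2 : ℂ) * π p.2 a) • ρ (D.Hb a)
        + ∑ i, D.weight i (φ p.2) • ρ (D.genX (c p.1) i)) := by
    funext p
    rw [D.laxX_eq]
    exact congrArg Neg.neg (D.map_lax (ρ : g →ₗ[ℂ] Matrix m m ℂ) _ _ _)
  rw [h]
  have hw : ∀ i, Continuous fun p : X × ℝ => D.weight i (φ p.2) := fun i =>
    (D.continuous_weight i).comp (hφ.comp continuous_snd)
  have hp : ∀ a, Continuous fun p : X × ℝ => (1 / 2 : ℂ) * π p.2 a := fun a =>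
    continuous_const.mul ((continuous_apply a).comp (hπ.comp continuous_snd))
  exact ((continuous_finsetSum _ fun a _ => (hp a).smul continuous_const).add
    (continuous_finsetSum _ fun i _ => (hw i).smul
      ((continuous_rho_genX D ρ hc h0 i).comp continuous_fst))).neg

theorem continuous_transfer (hc : Continuous c) (h0 : ∀ s, c s ≠ 0) (hφ : Continuous φ)
    (hπ : Continuous π) : Continuous fun p : X × ℝ => transfer D ρ xm p.2 (c p.1) φ π :=
  continuous_pathExp_param (a := fun s x => -ρ (D.laxX (c s) (φ x) (π x)))
    (continuous_rho_laxX D ρ hc h0 hφ hπ) xm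

theorem continuous_inv_transfer (hc : Continuous c) (h0 : ∀ s, c s ≠ 0) (hφ : Continuous φ)
    (hπ : Continuous π) : Continuous fun p : X × ℝ => (transfer D ρ xm p.2 (c p.1) φ π)⁻¹ :=
  continuous_inv_pathExp_param (a := fun s x => -ρ (D.laxX (c s) (φ x) (π x)))
    (continuous_rho_laxX D ρ hc h0 hφ hπ) xm

theorem continuous_transfer_end (hc : Continuous c) (h0 : ∀ s, c s ≠ 0) (hφ : Continuous φ)
    (hπ : Continuous π) : Continuous fun s => transfer D ρ xm xp (c s) φ π :=
  (continuous_transfer D ρ xm hc h0 hφ hπ).comp (f := fun s => (s, xp)) (by fun_prop)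

/-- Continuity of the value of a wave form on a continuous family of elements. -/
theorem continuous_waveForm (hc : Continuous c) (h0 : ∀ s, c s ≠ 0) {M : X → Matrix m m ℂ}
    (hM : Continuous M) (hφ : Continuous φ) (hπ : Continuous π) {y : X → g}
    (hy : Continuous fun s => ρ (y s)) :
    Continuous fun p : X × ℝ => waveForm D ρ xm φ π (c p.1) (M p.1) p.2 (y p.1) := by
  have h1 := continuous_transfer D ρ xm hc h0 hφ hπ
  have h2 := continuous_inv_transfer D ρ xm hc h0 hφ hπ
  have h3 : Continuous fun p : X × ℝ => ρ (y p.1) := hy.comp continuous_fst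
  have h4 : Continuous fun p : X × ℝ => M p.1 := hM.comp continuous_fst
  exact (h3.mul ((h1.mul h4).mul h2)).matrix_trace

theorem continuous_fwdForm (hc : Continuous c) (h0 : ∀ s, c s ≠ 0) (hK : Continuous K)
    (hN : Continuous N) (hφ : Continuous φ) (hπ : Continuous π) {y : X → g}
    (hy : Continuous fun s => ρ (y s)) :
    Continuous fun p : X × ℝ => fwdForm D ρ xm xp φ π (c p.1) (K p.1) (N p.1) p.2 (y p.1) := by
  have h1 := continuous_transfer_end D ρ xm xp hc h0 hφ hπ
  have h2 : Continuous fun s => transfer D (dualRep D ρ) xm xp (c s)⁻¹ φ π :=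
    continuous_transfer_end D (dualRep D ρ) xm xp (hc.inv₀ h0) (fun s => inv_ne_zero (h0 s)) hφ hπ
  exact continuous_waveForm D ρ xm hc h0 (M := fun s => N s *
    (transfer D (dualRep D ρ) xm xp (c s)⁻¹ φ π).transpose * K s * transfer D ρ xm xp (c s) φ π)
    (((hN.mul h2.matrix_transpose).mul hK).mul h1) hφ hπ hy

theorem continuous_bwdForm (hc : Continuous c) (h0 : ∀ s, c s ≠ 0) (hK : Continuous K)
    (hN : Continuous N) (hφ : Continuous φ) (hπ : Continuous π) {y : X → g}
    (hy : Continuous fun s => dualRep D ρ (y s)) :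
    Continuous fun p : X × ℝ => bwdForm D ρ xm xp φ π (c p.1) (K p.1) (N p.1) p.2 (y p.1) := by
  have h1 := continuous_transfer_end D ρ xm xp hc h0 hφ hπ
  have h2 : Continuous fun s => transfer D (dualRep D ρ) xm xp (c s)⁻¹ φ π :=
    continuous_transfer_end D (dualRep D ρ) xm xp (hc.inv₀ h0) (fun s => inv_ne_zero (h0 s)) hφ hπ
  exact continuous_waveForm D (dualRep D ρ) xm (c := fun s => (c s)⁻¹) (hc.inv₀ h0)
    (fun s => inv_ne_zero (h0 s)) (M := fun s => (K s * transfer D ρ xm xp (c s) φ π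
      * N s).transpose * transfer D (dualRep D ρ) xm xp (c s)⁻¹ φ π)
    (((hK.mul h1).mul hN).matrix_transpose.mul h2) hφ hπ hy

theorem continuous_derivPhi (hc : Continuous c) (h0 : ∀ s, c s ≠ 0) (hK : Continuous K)
    (hN : Continuous N) (hφ : Continuous φ) (hπ : Continuous π) :
    Continuous fun p : X × ℝ => derivPhi D ρ xm xp φ π (c p.1) (K p.1) (N p.1) p.2 := by
  refine continuous_pi fun a => ?_
  have hw : ∀ i, Continuous fun p : X × ℝ => D.weight i (φ p.2) := fun i =>
    (D.continuous_weight i).comp (hφ.comp continuous_snd)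
  have h1 := fun i => continuous_fwdForm D ρ xm xp hc h0 hK hN hφ hπ
    (continuous_rho_genX D ρ hc h0 i)
  have h2 := fun i => continuous_bwdForm D ρ xm xp hc h0 hK hN hφ hπ
    (continuous_rho_genX D (dualRep D ρ) (hc.inv₀ h0) (fun s => inv_ne_zero (h0 s)) i)
  exact (continuous_const.mul (continuous_finsetSum _ fun i _ =>
    ((hw i).mul continuous_const).mul (h1 i))).add (continuous_const.mul
      (continuous_finsetSum _ fun i _ => ((hw i).mul continuous_const).mul (h2 i)))

theorem continuous_derivPi (hc : Continuous c) (h0 : ∀ s, c s ≠ 0) (hK : Continuous K)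
    (hN : Continuous N) (hφ : Continuous φ) (hπ : Continuous π) :
    Continuous fun p : X × ℝ => derivPi D ρ xm xp φ π (c p.1) (K p.1) (N p.1) p.2 := by
  refine continuous_pi fun a => ?_
  exact (continuous_const.mul (continuous_fwdForm D ρ xm xp hc h0 hK hN hφ hπ
    (y := fun _ => (D.Hb a : g)) continuous_const)).add
    (continuous_const.mul (continuous_bwdForm D ρ xm xp hc h0 hK hN hφ hπ
    (y := fun _ => (D.Hb a : g)) continuous_const))

end Continuity

section FixedParameter

variable {l : ℝ} (K N : Matrix m m ℂ)

theorem continuous_derivPhi_apply (hl : l ≠ 0) (hφ : Continuous φ) (hπ : Continuous π)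
    (a : Fin n) : Continuous fun x => derivPhi D ρ xm xp φ π l K N x a := by
  have h := continuous_derivPhi (X := Unit) D ρ xm xp (c := fun _ => l) (K := fun _ => K)
    (N := fun _ => N) continuous_const (fun _ => hl) continuous_const continuous_const hφ hπ
  have h2 : Continuous fun p : Unit × ℝ => derivPhi D ρ xm xp φ π l K N p.2 a :=
    (continuous_apply a).comp h
  exact h2.comp (f := fun x => ((), x)) (by fun_prop)

theorem continuous_derivPi_apply (hl : l ≠ 0) (hφ : Continuous φ) (hπ : Continuous π)
    (a : Fin n) : Continuous fun x => derivPi D ρ xm xp φ π l K N x a := by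
  have h := continuous_derivPi (X := Unit) D ρ xm xp (c := fun _ => l) (K := fun _ => K)
    (N := fun _ => N) continuous_const (fun _ => hl) continuous_const continuous_const hφ hπ
  have h2 : Continuous fun p : Unit × ℝ => derivPi D ρ xm xp φ π l K N p.2 a :=
    (continuous_apply a).comp h
  exact h2.comp (f := fun x => ((), x)) (by fun_prop)

/-- The first variation of the transfer matrix. -/
theorem hasDerivAt_transfer_variation (l : ℝ) (hφ : Continuous φ) (hπ : Continuous π)
    {dφ dπ : ℝ → Fin n → ℂ} (hdφ : Continuous dφ) (hdπ : Continuous dπ) :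
    HasDerivAt (fun ε : ℂ => transfer D ρ xm xp l (φ + ε • dφ) (π + ε • dπ))
      (transfer D ρ xm xp l φ π * ∫ x in xm..xp, (transfer D ρ xm x l φ π)⁻¹
        * -ρ (D.dlax (D.genX l) (φ x) (dφ x) (dπ x)) * transfer D ρ xm x l φ π) 0 := by
  set a : ℂ → ℝ → Matrix m m ℂ := fun ε x =>
    -ρ (D.lax (D.genX l) (φ x + ε • dφ x) (π x + ε • dπ x)) with ha
  set a' : ℂ → ℝ → Matrix m m ℂ := fun ε x =>
    -ρ (D.dlax (D.genX l) (φ x + ε • dφ x) (dφ x) (dπ x)) with ha'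
  have c1 : Continuous fun p : ℂ × ℝ => φ p.2 + p.1 • dφ p.2 := by fun_prop
  have c2 : Continuous fun p : ℂ × ℝ => π p.2 + p.1 • dπ p.2 := by fun_prop
  have c3 : Continuous fun p : ℂ × ℝ => (dφ p.2, dπ p.2) := by fun_prop
  have hac : ContinuousOn (fun p : ℂ × ℝ => a p.1 p.2) (univ ×ˢ univ) :=
    ((continuous_rho_lax D ρ (D.genX l)).comp (f := fun p : ℂ × ℝ =>
      (φ p.2 + p.1 • dφ p.2, π p.2 + p.1 • dπ p.2)) (c1.prodMk c2)).neg.continuousOn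
  have hac' : ContinuousOn (fun p : ℂ × ℝ => a' p.1 p.2) (univ ×ˢ univ) :=
    ((continuous_rho_dlax D ρ (D.genX l)).comp (f := fun p : ℂ × ℝ =>
      (φ p.2 + p.1 • dφ p.2, dφ p.2, dπ p.2)) (c1.prodMk c3)).neg.continuousOn
  have hlin : ∀ (u v : Fin n → ℂ) (ε : ℂ), HasDerivAt (fun ε : ℂ => u + ε • v) v ε :=
    fun u v ε => by simpa using ((hasDerivAt_id ε).smul_const v).const_add u
  have had : ∀ ε ∈ (univ : Set ℂ), ∀ x, HasDerivAt (fun ε => a ε x) (a' ε x) ε := fun ε _ x =>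
    (hasDerivAt_rho_lax D ρ (D.genX l) (hlin _ _ ε) (hlin _ _ ε)).fun_neg
  have key := hasDerivAt_pathExp_param (𝕜 := ℂ) (ε₀ := 0) univ_mem hac hac' had xm xp
  have e : a 0 = fun x => -ρ (D.laxX l (φ x) (π x)) := by
    funext x
    simp only [ha, zero_smul, add_zero, D.laxX_eq]
  have e' : a' 0 = fun x => -ρ (D.dlax (D.genX l) (φ x) (dφ x) (dπ x)) := by
    funext x
    simp only [ha', zero_smul, add_zero]
  rw [e, e'] at key
  exact key

theorem trace_mul_integral_variation (l : ℝ) (M : Matrix m m ℂ) (hφ : Continuous φ)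
    (hπ : Continuous π) {dφ dπ : ℝ → Fin n → ℂ} (hdφ : Continuous dφ) (hdπ : Continuous dπ) :
    (M * ∫ x in xm..xp, (transfer D ρ xm x l φ π)⁻¹
        * -ρ (D.dlax (D.genX l) (φ x) (dφ x) (dπ x)) * transfer D ρ xm x l φ π).trace
      = ∫ x in xm..xp, -waveForm D ρ xm φ π l M x (D.dlax (D.genX l) (φ x) (dφ x) (dπ x)) := by
  have hc := continuous_lax_field D ρ l hφ hπ
  have h1 : Continuous fun x => transfer D ρ xm x l φ π := continuous_pathExp hc xm
  have h2 : Continuous fun x => (transfer D ρ xm x l φ π)⁻¹ := continuous_inv_pathExp hc xm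
  have h3 : Continuous fun x => -ρ (D.dlax (D.genX l) (φ x) (dφ x) (dπ x)) :=
    ((continuous_rho_dlax D ρ (D.genX l)).comp (f := fun x => (φ x, dφ x, dπ x))
      (hφ.prodMk (hdφ.prodMk hdπ))).neg
  have h4 : Continuous fun x => (transfer D ρ xm x l φ π)⁻¹
      * -ρ (D.dlax (D.genX l) (φ x) (dφ x) (dπ x)) * transfer D ρ xm x l φ π := (h2.mul h3).mul h1
  rw [trace_mul_integral M h4]
  refine intervalIntegral.integral_congr fun x _ => ?_
  simp only [waveForm, traceForm_apply]
  generalize ρ (D.dlax (D.genX l) (φ x) (dφ x) (dπ x)) = B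
  generalize transfer D ρ xm x l φ π = P
  have e : M * (P⁻¹ * -B * P) = -(M * P⁻¹ * (B * P)) := by noncomm_ring
  rw [e, Matrix.trace_neg, Matrix.trace_mul_comm]
  simp only [mul_assoc]

theorem continuous_waveForm_dlax (l : ℝ) (M : Matrix m m ℂ) (hφ : Continuous φ)
    (hπ : Continuous π) {dφ dπ : ℝ → Fin n → ℂ} (hdφ : Continuous dφ) (hdπ : Continuous dπ) :
    Continuous fun x => -waveForm D ρ xm φ π l M x (D.dlax (D.genX l) (φ x) (dφ x) (dπ x)) := by
  have hc := continuous_lax_field D ρ l hφ hπ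
  have h1 : Continuous fun x => transfer D ρ xm x l φ π := continuous_pathExp hc xm
  have h2 : Continuous fun x => (transfer D ρ xm x l φ π)⁻¹ := continuous_inv_pathExp hc xm
  have h3 : Continuous fun x => ρ (D.dlax (D.genX l) (φ x) (dφ x) (dπ x)) :=
    (continuous_rho_dlax D ρ (D.genX l)).comp (f := fun x => (φ x, dφ x, dπ x))
      (hφ.prodMk (hdφ.prodMk hdπ))
  exact (h3.mul ((h1.mul continuous_const).mul h2)).matrix_trace.neg

/-- The functional derivatives of `τ(λ)`. -/
theorem hasFunctionalDeriv_tau (hl : l ≠ 0) (Kp Km : ℝ → Matrix m m ℂ) (hφ : Continuous φ)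
    (hπ : Continuous π) :
    HasFunctionalDeriv xm xp (tau D ρ xm xp Kp Km l) φ π
      (derivPhi D ρ xm xp φ π l (Kp l) (Km l⁻¹)) (derivPi D ρ xm xp φ π l (Kp l) (Km l⁻¹)) := by
  have cu := continuous_pi fun a =>
    continuous_derivPhi_apply D ρ xm xp (Kp l) (Km l⁻¹) hl hφ hπ a
  have cv := continuous_pi fun a =>
    continuous_derivPi_apply D ρ xm xp (Kp l) (Km l⁻¹) hl hφ hπ a
  refine ⟨cu.continuousOn, cv.continuousOn, fun dφ dπ hdφ hdπ => ?_⟩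
  have h1 := hasDerivAt_transfer_variation D ρ xm xp l hφ hπ hdφ hdπ
  have h2 := hasDerivAt_transfer_variation D (dualRep D ρ) xm xp l⁻¹ hφ hπ hdφ hdπ
  have h3 := HasDerivAt.matrix_trace (((h1.const_mul (Kp l)).mul_const (Km l⁻¹)).fun_mul
    (HasDerivAt.matrix_transpose h2))
  simp only [zero_smul, add_zero] at h3
  refine h3.congr_deriv ?_
  set T := transfer D ρ xm xp l φ π with hT
  set T' := transfer D (dualRep D ρ) xm xp l⁻¹ φ π with hT'
  set I := ∫ x in xm..xp, (transfer D ρ xm x l φ π)⁻¹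
    * -ρ (D.dlax (D.genX l) (φ x) (dφ x) (dπ x)) * transfer D ρ xm x l φ π with hI
  set I' := ∫ x in xm..xp, (transfer D (dualRep D ρ) xm x l⁻¹ φ π)⁻¹
    * -dualRep D ρ (D.dlax (D.genX l⁻¹) (φ x) (dφ x) (dπ x))
    * transfer D (dualRep D ρ) xm x l⁻¹ φ π with hI'
  have e1 : (Kp l * (T * I) * Km l⁻¹ * T'.transpose).trace
      = (Km l⁻¹ * T'.transpose * Kp l * T * I).trace := by
    rw [mul_assoc _ (Km l⁻¹), Matrix.trace_mul_comm]
    simp only [mul_assoc]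
  have e2 : (Kp l * T * Km l⁻¹ * (T' * I').transpose).trace
      = ((Kp l * T * Km l⁻¹).transpose * T' * I').trace := by
    rw [← Matrix.trace_transpose, Matrix.transpose_mul, Matrix.transpose_transpose,
      Matrix.trace_mul_comm, ← mul_assoc]
  have c1 := continuous_waveForm_dlax D ρ xm l (Km l⁻¹ * T'.transpose * Kp l * T) hφ hπ hdφ hdπ
  have c2 := continuous_waveForm_dlax D (dualRep D ρ) xm l⁻¹
    ((Kp l * T * Km l⁻¹).transpose * T') hφ hπ hdφ hdπ
  rw [Matrix.trace_add, e1, e2, hI, hI',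
    trace_mul_integral_variation D ρ xm xp l _ hφ hπ hdφ hdπ,
    trace_mul_integral_variation D (dualRep D ρ) xm xp l⁻¹ _ hφ hπ hdφ hdπ,
    ← intervalIntegral.integral_add (c1.intervalIntegrable _ _) (c2.intervalIntegrable _ _)]
  refine intervalIntegral.integral_congr fun x _ => ?_
  simp only [D.neg_apply_dlax]
  rw [← Finset.sum_add_distrib]
  refine Finset.sum_congr rfl fun a _ => ?_
  simp only [derivPhi, derivPi, fwdForm, bwdForm, Pi.add_apply]
  ring

end FixedParameter

/-- The canonical bracket of `τ(λ₁)` and `τ(λ₂)`, in terms of their functional derivatives. -/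
def bracket (Kp Km : ℝ → Matrix m m ℂ) (φ π : ℝ → Fin n → ℂ) (l₁ l₂ : ℝ) : ℂ :=
  ∫ x in xm..xp, ∑ a,
    (derivPhi D ρ xm xp φ π l₁ (Kp l₁) (Km l₁⁻¹) x a
      * derivPi D ρ xm xp φ π l₂ (Kp l₂) (Km l₂⁻¹) x a
    - derivPi D ρ xm xp φ π l₁ (Kp l₁) (Km l₁⁻¹) x a
      * derivPhi D ρ xm xp φ π l₂ (Kp l₂) (Km l₂⁻¹) x a)

/-- The bracket is the difference of the boundary values of `fourPair`, and these vanish by the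
reflection equations for `K₊` and `K₋`. -/
theorem bracket_eq_zero_of_regular {Λp Λm : Set ℝ} {Kp Km : ℝ → Matrix m m ℂ}
    (hp : SolvesRefl D ρ Λp Kp) (hm : SolvesMrefl D ρ Λm Km) {l₁ l₂ : ℝ} (h₁ : l₁ ≠ 0)
    (h₂ : l₂ ≠ 0) (hp₁ : l₁ ∈ Λp) (hp₂ : l₂ ∈ Λp) (hm₁ : l₁⁻¹ ∈ Λm) (hm₂ : l₂⁻¹ ∈ Λm)
    (hd : (l₁ / l₂) ^ D.cox ≠ 1) (hmul : (l₁ * l₂) ^ D.cox ≠ 1) (hφ : Continuous φ)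
    (hπ : Continuous π) : bracket D ρ xm xp Kp Km φ π l₁ l₂ = 0 := by
  have u₁ := continuous_derivPhi_apply D ρ xm xp (Kp l₁) (Km l₁⁻¹) h₁ hφ hπ
  have v₁ := continuous_derivPi_apply D ρ xm xp (Kp l₁) (Km l₁⁻¹) h₁ hφ hπ
  have u₂ := continuous_derivPhi_apply D ρ xm xp (Kp l₂) (Km l₂⁻¹) h₂ hφ hπ
  have v₂ := continuous_derivPi_apply D ρ xm xp (Kp l₂) (Km l₂⁻¹) h₂ hφ hπ
  have hS : Continuous fun x => (-4 : ℂ) * ∑ a, (derivPhi D ρ xm xp φ π l₁ (Kp l₁) (Km l₁⁻¹) x a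
      * derivPi D ρ xm xp φ π l₂ (Kp l₂) (Km l₂⁻¹) x a
    - derivPi D ρ xm xp φ π l₁ (Kp l₁) (Km l₁⁻¹) x a
      * derivPhi D ρ xm xp φ π l₂ (Kp l₂) (Km l₂⁻¹) x a) :=
    continuous_const.mul (continuous_finsetSum _ fun a _ =>
      ((u₁ a).mul (v₂ a)).sub ((v₁ a).mul (u₂ a)))
  have hF := intervalIntegral.integral_eq_sub_of_hasDerivAt (a := xm) (b := xp)
    (fun x _ => hasDerivAt_fourPair D ρ xm xp h₁ h₂ hd hmul (Kp l₁) (Km l₁⁻¹) (Kp l₂) (Km l₂⁻¹)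
      hφ hπ x) (hS.intervalIntegrable _ _)
  rw [fwdForm_right D ρ xm xp _ _ _ hφ hπ, fwdForm_right D ρ xm xp _ _ _ hφ hπ,
    bwdForm_right D ρ xm xp _ _ _ hφ hπ, bwdForm_right D ρ xm xp _ _ _ hφ hπ, fwdForm_left,
    fwdForm_left, bwdForm_left, bwdForm_left, hp.fourPair_eq_zero hp₁ hp₂ hd hmul,
    hm.fourPair_eq_zero hm₁ hm₂ hd hmul, sub_zero, intervalIntegral.integral_const_mul] at hF
  exact (mul_eq_zero.mp hF).resolve_left (by norm_num)

theorem continuousAt_bracket {U : Set ℝ} (hU : IsOpen U) (hU0 : 0 ∉ U)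
    {Kp Km : ℝ → Matrix m m ℂ} (hKp : ContinuousOn Kp U)
    (hKm : ContinuousOn (fun l => Km l⁻¹) U) (hφ : Continuous φ) (hπ : Continuous π) {l₁ l₂ : ℝ}
    (h₁ : l₁ ∈ U) (h₂ : l₂ ∈ U) :
    ContinuousAt (fun p : ℝ × ℝ => bracket D ρ xm xp Kp Km φ π p.1 p.2) (l₁, l₂) := by
  have hK : Continuous fun s : U => Kp s := continuousOn_iff_continuous_domRestrict.mp hKp
  have hN : Continuous fun s : U => Km (s : ℝ)⁻¹ := continuousOn_iff_continuous_domRestrict.mp hKm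
  have h0 : ∀ s : U, (s : ℝ) ≠ 0 := fun s hs => hU0 (hs ▸ s.2)
  have hu := continuous_derivPhi D ρ xm xp (c := fun s : U => (s : ℝ)) continuous_subtype_val h0
    hK hN hφ hπ
  have hv := continuous_derivPi D ρ xm xp (c := fun s : U => (s : ℝ)) continuous_subtype_val h0
    hK hN hφ hπ
  have h1 : ∀ {f : U × ℝ → Fin n → ℂ}, Continuous f → ∀ a,
      Continuous fun p : (U ×ˢ U : Set (ℝ × ℝ)) × ℝ => f (⟨p.1.1.1, p.1.2.1⟩, p.2) a :=
    fun {f} hf a => (continuous_apply a).comp (hf.comp (by fun_prop))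
  have h2 : ∀ {f : U × ℝ → Fin n → ℂ}, Continuous f → ∀ a,
      Continuous fun p : (U ×ˢ U : Set (ℝ × ℝ)) × ℝ => f (⟨p.1.1.2, p.1.2.2⟩, p.2) a :=
    fun {f} hf a => (continuous_apply a).comp (hf.comp (by fun_prop))
  have hcont : ContinuousOn (fun p : ℝ × ℝ => bracket D ρ xm xp Kp Km φ π p.1 p.2) (U ×ˢ U) := by
    rw [continuousOn_iff_continuous_domRestrict]
    refine intervalIntegral.continuous_parametric_intervalIntegral_of_continuous'
      (X := (U ×ˢ U : Set (ℝ × ℝ))) (f := fun p x => ∑ a,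
        (derivPhi D ρ xm xp φ π p.1.1 (Kp p.1.1) (Km p.1.1⁻¹) x a
          * derivPi D ρ xm xp φ π p.1.2 (Kp p.1.2) (Km p.1.2⁻¹) x a
        - derivPi D ρ xm xp φ π p.1.1 (Kp p.1.1) (Km p.1.1⁻¹) x a
          * derivPhi D ρ xm xp φ π p.1.2 (Kp p.1.2) (Km p.1.2⁻¹) x a)) ?_ xm xp
    exact continuous_finsetSum _ fun a _ =>
      ((h1 hu a).mul (h2 hv a)).sub ((h1 hv a).mul (h2 hu a))
  exact hcont.continuousAt ((hU.prod hU).mem_nhds ⟨h₁, h₂⟩)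

variable {D ρ xm xp} in
/-- Involution: at regular spectral parameters by the reflection equations, at the remaining ones
by continuity. -/
theorem poissonCommuteAt_tau {Ap Am : D.Idx → ℂ} {Λp Λm : Set ℝ} {Kp Km : ℝ → Matrix m m ℂ}
    (hp0 : 0 ∉ Λp) (hm0 : 0 ∉ Λm) (hp : SolvesIbc D ρ Ap Λp Kp) (hm : SolvesIbc D ρ Am Λm Km)
    (hΛp : IsOpen Λp) (hΛm : IsOpen Λm) (hKp : ContinuousOn Kp Λp) (hKm : ContinuousOn Km Λm)
    {l₁ l₂ : ℝ} (hp₁ : l₁ ∈ Λp) (hm₁ : l₁⁻¹ ∈ minusDomain Λm) (hp₂ : l₂ ∈ Λp)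
    (hm₂ : l₂⁻¹ ∈ minusDomain Λm) (hφ : Continuous φ) (hπ : Continuous π) :
    PoissonCommuteAt xm xp (tau D ρ xm xp Kp (minusK Km) l₁)
      (tau D ρ xm xp Kp (minusK Km) l₂) φ π := by
  have hne : ∀ {l}, l ∈ Λp → l ≠ 0 := fun hl hz => hp0 (hz ▸ hl)
  refine ⟨_, _, _, _, hasFunctionalDeriv_tau D ρ xm xp (hne hp₁) Kp (minusK Km) hφ hπ,
    hasFunctionalDeriv_tau D ρ xm xp (hne hp₂) Kp (minusK Km) hφ hπ, ?_⟩
  change bracket D ρ xm xp Kp (minusK Km) φ π l₁ l₂ = 0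
  have hmem : ∀ l : ℝ, l⁻¹ ∈ minusDomain Λm ↔ -l ∈ Λm := fun l => by
    rw [minusDomain, Set.mem_ofPred_eq, inv_inv]
  -- The common domain of the two traces, on which the bracket is continuous.
  set U : Set ℝ := Λp ∩ (fun l => -l) ⁻¹' Λm with hUdef
  have hU : IsOpen U := hΛp.inter (hΛm.preimage continuous_neg)
  have hKmU : ContinuousOn (fun l => minusK Km l⁻¹) U := by
    simp only [minusK, inv_inv]
    exact hKm.comp continuous_neg.continuousOn fun l hl => hl.2
  have hcont := continuousAt_bracket D ρ xm xp hU (fun h => hp0 h.1) (hKp.mono inter_subset_left)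
    hKmU hφ hπ (l₁ := l₁) (l₂ := l₂) ⟨hp₁, (hmem _).mp hm₁⟩ ⟨hp₂, (hmem _).mp hm₂⟩
  by_contra hcon
  have hO := (hcont.eventually_ne hcon).and (prod_mem_nhds
    (hU.mem_nhds ⟨hp₁, (hmem _).mp hm₁⟩) (hU.mem_nhds ⟨hp₂, (hmem _).mp hm₂⟩))
  -- Only regularity of the `r`-matrices is needed here, so any boundary coefficients will do.
  obtain ⟨k₁, k₂, ⟨hne', hk₁, hk₂⟩, h1, h2, hd, hmul, -, -⟩ :=
    D.exists_regular (hne hp₂) hO 0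
  exact hne' (bracket_eq_zero_of_regular D ρ xm xp (hp.solvesRefl hp0 hΛp hKp)
    ((hm.solvesRefl hm0 hΛm hKm).solvesMrefl hm0) h1 h2 hk₁.1 hk₂.1 ((hmem _).mpr hk₁.2)
    ((hmem _).mpr hk₂.2) hd hmul hφ hπ)

end FunctionalDerivatives

end AffineToda

end

open AffineToda in
theorem mainTheorem3
    {g : Type*} [LieRing g] [LieAlgebra ℂ g] [Module.Finite ℂ g] [LieAlgebra.IsSimple ℂ g]
    {H : LieSubalgebra ℂ g} [H.IsCartanSubalgebra] {n : ℕ} (D : Generators g H n)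
    {m : Type*} [Fintype m] [DecidableEq m] (ρ : MatrixRep g m) :
    -- symmetry of the Lax connection
    (∀ l : ℝ, l ≠ 0 → ∀ φ ψ : Fin n → ℂ, D.tr (D.laxT (-l⁻¹) φ ψ) = D.laxT l φ ψ) ∧
    -- symmetry of the r-matrix
    (∀ l : ℝ, l ≠ 0 → l ^ D.cox ≠ 1 → D.tr12 (D.rMatrix l) = -D.rMatrix l⁻¹) ∧
    -- the boundary equation passes from `K_+` to `K_-`
    (∀ (A : D.Idx → ℂ) (Λ : Set ℝ) (K : ℝ → Matrix m m ℂ), 0 ∉ Λ →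
      SolvesIbc D ρ A Λ K → SolvesMbc D ρ A (minusDomain Λ) (minusK K)) ∧
    -- the reflection equation passes from `K_+` to `K_-`
    (∀ (Λ : Set ℝ) (K : ℝ → Matrix m m ℂ), 0 ∉ Λ →
      SolvesRefl D ρ Λ K → SolvesMrefl D ρ (minusDomain Λ) (minusK K)) ∧
    -- the boundary equation alone implies both reflection equations
    (∀ (A : D.Idx → ℂ) (Λ : Set ℝ) (K : ℝ → Matrix m m ℂ), 0 ∉ Λ → IsOpen Λ → ContinuousOn K Λ →
      SolvesIbc D ρ A Λ K →
        SolvesRefl D ρ Λ K ∧ SolvesMrefl D ρ (minusDomain Λ) (minusK K)) ∧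
    -- integrability on an interval, with independent boundary conditions at the two ends
    (∀ (xm xp : ℝ), xm < xp → ∀ (Ap Am : D.Idx → ℂ) (Λp Λm : Set ℝ) (Kp Km : ℝ → Matrix m m ℂ),
      0 ∉ Λp → 0 ∉ Λm → SolvesIbc D ρ Ap Λp Kp → SolvesIbc D ρ Am Λm Km →
      -- conservation in time
      (∀ l ∈ Λp, l⁻¹ ∈ minusDomain Λm →
        ∀ (J : Set ℝ) (φ : ℝ → ℝ → Fin n → ℂ), IsOpen J → D.IsSolution J xm xp Am Ap φ →
          ∀ t ∈ J, HasDerivAt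
            (fun s => tau D ρ xm xp Kp (minusK Km) l (φ s) (fun x => deriv (fun s' => φ s' x) s))
            0 t) ∧
      -- involution
      (IsOpen Λp → IsOpen Λm → ContinuousOn Kp Λp → ContinuousOn Km Λm →
        ∀ l₁ ∈ Λp, l₁⁻¹ ∈ minusDomain Λm → ∀ l₂ ∈ Λp, l₂⁻¹ ∈ minusDomain Λm →
          ∀ φ π : ℝ → Fin n → ℂ, Continuous φ → Continuous π →
            PoissonCommuteAt xm xp (tau D ρ xm xp Kp (minusK Km) l₁)
              (tau D ρ xm xp Kp (minusK Km) l₂) φ π)) := by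
  refine ⟨fun l hl φ ψ => D.tr_laxT hl φ ψ, fun l hl0 hl => D.tr12_rMatrix hl0 hl,
    fun A Λ K h0 h => h.solvesMbc h0, fun Λ K h0 h => h.solvesMrefl h0,
    fun A Λ K h0 hΛ hK h => ?_, fun xm xp hx Ap Am Λp Λm Kp Km hp0 hm0 hp hm => ⟨?_, ?_⟩⟩
  · have hr := h.solvesRefl h0 hΛ hK
    exact ⟨hr, hr.solvesMrefl h0⟩
  · intro l hlp hlm J φ hJ hφ t ht
    exact hasDerivAt_tau_of_isSolution hx.le hp0 hm0 hp hm hlp hlm hJ hφ ht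
  · intro hΛp hΛm hKp hKm l₁ hp₁ hm₁ l₂ hp₂ hm₂ φ π hφ hπ
    exact poissonCommuteAt_tau hp0 hm0 hp hm hΛp hΛm hKp hKm hp₁ hm₁ hp₂ hm₂ hφ hπ
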